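/- Let $a^+,a^->0$, $\beta^+,\beta^-\ge 0$, and let $$\mathcal D=\{x=(x_1,x_2)\in\mathbb R^2: x_1\ge 0,\ -a^-x_1^{\beta^-}\le x_2\le a^+x_1^{\beta^+}\}.$$ Let $B\in(0,\infty)$ and let $\mathcal D_B\subseteq\mathcal D$ be such that $d(x,\mathbb R^2\setminus\mathcal D)\le B$ for all $x\in\mathcal D_B$. If $\beta^+=0$, suppose also that every $x\in\mathcal D_B$ with $x_2\le 0$ lies within distance $B$ of $\{y\notin\mathcal D:y_2<0\}$; if $\beta^-=0$, suppose also that every $x\in\mathcal D_B$ with $x_2\ge 0$ lies within distance $B$ of $\{y\notin\mathcal D:y_2>0\}$. Let $\xi=(\xi_0,\xi_1,\dots)$ be a time-homogeneous Markov chain on $S\subseteq\mathcal D$ with fixed initial state $\xi_0=x_0\in S$; write $\mathbb P_x,\mathbb E_x$ for probability and expectation given $\xi_0=x$, and $\Delta=\xi_1-\xi_0$. Put $S_I=S\cap(\mathcal D\setminus\mathcal D_B)$ and $S_B^\pm=\{x\in S\cap\mathcal D_B:\pm x_2>0\}$. For $x_1>0$ let $n^\pm(x_1)$ be the inwards-pointing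 unit normal to $\partial\mathcal D$ at $(x_1,\pm a^\pm x_1^{\beta^\pm})$, i.e. the normalization of $(a^\pm\beta^\pm x_1^{\beta^\pm-1},\mp1)$. Let $\Sigma=\begin{pmatrix}\sigma_1^2&\rho\\ \rho&\sigma_2^2\end{pmatrix}$ be a symmetric positive-definite matrix. Assume: - (N) $\mathbb P_x(\limsup_n\|\xi_n\|=\infty)=1$ for all $x\in S$; - (M) $\sup_{x\in S}\mathbb E_x\|\Delta\|^p<\infty$ for some $p>2$; - (D) $\sup_{x\in S_I:\|x\|\ge r}\|\mathbb E_x\Delta\|=o(r^{-1})$ as $r\to\infty$; - (R) (normal reflection) there are functions $\mu^\pm:S_B^\pm\to\mathbb R$ with $\liminf_{\|x\|\to\infty}\mu^\pm(x)>0$ and $\sup_{x\in S_B^\pm:\|x\|\ge r}\|\mathbb E_x\Delta-\mu^\pm(x)n^\pm(x_1)\|=O(r^{-1})$ as $r\to\infty$; - (C) $\sup_{x\in S_I:\|x\|\ge r}\|\mathbb E_x(\Delta\Delta^{\top})-\Sigma\|_{\mathrm{op}}\to0$ as $r\to\infty$. Consider also the stronger conditions - (D$_+$) $\sup_{x\in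 S_I:\|x\|\ge r}\|\mathbb E_x\Delta\|=O(r^{-1-\varepsilon})$ for some $\varepsilon>0$; - (C$_+$) $\sup_{x\in S_I:\|x\|\ge r}\|\mathbb E_x(\Delta\Delta^{\top})-\Sigma\|_{\mathrm{op}}=O(r^{-\varepsilon})$ for some $\varepsilon>0$. Call $\xi$ *recurrent* if there is a constant $r_0<\infty$ with $\liminf_n\|\xi_n\|\le r_0$ a.s., and *transient* if $\|\xi_n\|\to\infty$ a.s. Then: (a) Suppose $\beta^+,\beta^-\in[0,1)$ and let $\beta=\max(\beta^+,\beta^-)$. (i) If $0<\beta<\sigma_1^2/\sigma_2^2$, then $\xi$ is recurrent. (ii) If $\sigma_1^2/\sigma_2^2<\beta<1$, then $\xi$ is transient. (iii) If $\beta=\sigma_1^2/\sigma_2^2$ and (D$_+$), (C$_+$) hold, then $\xi$ is recurrent. (b) If $\beta^+,\beta^->1$ and (D$_+$), (C$_+$) hold, then $\xi$ is recurrent. -/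

import Mathlib

open MeasureTheory ProbabilityTheory Filter Topology
open scoped ENNReal NNReal

namespace ReflectedWalk

noncomputable section

/-- The Euclidean plane; `x 0` and `x 1` are the first and second Cartesian coordinates. -/
abbrev Plane : Type := EuclideanSpace ℝ (Fin 2)

/-- The generalized parabolic domain
`{x : x₁ ≥ 0, -a⁻ x₁ ^ β⁻ ≤ x₂ ≤ a⁺ x₁ ^ β⁺}`. -/
def domain (aP aM βP βM : ℝ) : Set Plane :=
  {x | 0 ≤ x 0 ∧ -(aM * x 0 ^ βM) ≤ x 1 ∧ x 1 ≤ aP * x 0 ^ βP}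

/-- `DB` is a boundary layer of `D` of thickness `B`: a subset of `D` all of whose points
are within distance `B` of the complement of `D`. -/
def IsBoundaryLayer (D DB : Set Plane) (B : ℝ) : Prop :=
  DB ⊆ D ∧ ∀ x ∈ DB, Metric.infDist x Dᶜ ≤ B

/-- The interior part of the state space. -/
def interiorPart (S D DB : Set Plane) : Set Plane := S ∩ (D \ DB)

/-- The part of the state space in the boundary layer in the open upper half-plane. -/
def upperPart (S DB : Set Plane) : Set Plane := S ∩ {x | x ∈ DB ∧ 0 < x 1}

/-- The part of the state space in the boundary layer in the open lower half-plane. -/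
def lowerPart (S DB : Set Plane) : Set Plane := S ∩ {x | x ∈ DB ∧ x 1 < 0}

/-- Anticlockwise rotation of the vector `(u, v)` by the angle `φ`. -/
def rotated (φ u v : ℝ) : Plane :=
  !₂[Real.cos φ * u - Real.sin φ * v, Real.sin φ * u + Real.cos φ * v]

/-- The unit vector `n⁺(t, α)`: the inwards-pointing unit normal at `(t, a t ^ β)`, which is
`(a β t ^ (β - 1), -1)` normalized, rotated anticlockwise by `α`. -/
def upperNormal (a β t α : ℝ) : Plane :=
  (Real.sqrt (1 + (a * β * t ^ (β - 1)) ^ 2))⁻¹ • rotated α (a * β * t ^ (β - 1)) (-1)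

/-- The unit vector `n⁻(t, α)`: the inwards-pointing unit normal at `(t, -a t ^ β)`, which is
`(a β t ^ (β - 1), 1)` normalized, rotated clockwise by `α`. -/
def lowerNormal (a β t α : ℝ) : Plane :=
  (Real.sqrt (1 + (a * β * t ^ (β - 1)) ^ 2))⁻¹ • rotated (-α) (a * β * t ^ (β - 1)) 1

section Chain

variable {S : Set Plane}

/-- The law on path space `ℕ → S` of the time-homogeneous Markov chain with one-step
transition kernel `κ`, started from the point `x`. -/
def chainLaw (κ : Kernel S S) [IsMarkovKernel κ] (x : S) : Measure (ℕ → S) :=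
  Kernel.traj (X := fun _ => S)
    (fun n => κ.comap (fun h : (i : Finset.Iic n) → S => h ⟨n, Finset.mem_Iic.2 le_rfl⟩)
      (measurable_pi_apply _)) 0 (fun _ => x)

/-- Expected increment `E_x Δ`, where `Δ = ξ₁ - ξ₀`. -/
def meanIncrement (κ : Kernel S S) (x : S) : Plane :=
  ∫ y, ((y : Plane) - (x : Plane)) ∂(κ x)

/-- The matrix `E_x (Δ Δᵀ)`. -/
def secondMoment (κ : Kernel S S) (x : S) : Matrix (Fin 2) (Fin 2) ℝ :=
  Matrix.of fun i j =>
    ∫ y, ((y : Plane) i - (x : Plane) i) * ((y : Plane) j - (x : Plane) j) ∂(κ x)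

/-- The Euclidean operator norm of a `2 × 2` matrix. -/
def opNorm (M : Matrix (Fin 2) (Fin 2) ℝ) : ℝ :=
  ‖Matrix.toEuclideanCLM (n := Fin 2) (𝕜 := ℝ) M‖

/-- Assumption (N): from every starting point, `limsup ‖ξ_n‖ = ∞` almost surely. -/
def NonConfinement (κ : Kernel S S) [IsMarkovKernel κ] : Prop :=
  ∀ x : S, ∀ᵐ ω ∂(chainLaw κ x), limsup (fun n => ‖(ω n : Plane)‖ₑ) atTop = ⊤

/-- Assumption (M_p): for some `p > 2`, `sup_x E_x ‖Δ‖ ^ p < ∞`. -/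
def BoundedMoments (κ : Kernel S S) : Prop :=
  ∃ p : ℝ, 2 < p ∧ (⨆ x : S, ∫⁻ y, ‖(y : Plane) - (x : Plane)‖ₑ ^ p ∂(κ x)) < ⊤

/-- Assumption (D): `sup {‖E_x Δ‖ : x ∈ I, ‖x‖ ≥ r} = o(1 / r)` as `r → ∞`. -/
def ZeroDrift (κ : Kernel S S) (I : Set Plane) : Prop :=
  ∀ ε : ℝ, 0 < ε → ∃ R : ℝ, 0 < R ∧ ∀ r : ℝ, R ≤ r →
    ∀ x : S, (x : Plane) ∈ I → r ≤ ‖(x : Plane)‖ → ‖meanIncrement κ x‖ ≤ ε * r⁻¹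

/-- Assumption (D₊): for some `ε > 0`,
`sup {‖E_x Δ‖ : x ∈ I, ‖x‖ ≥ r} = O(r ^ (-1 - ε))` as `r → ∞`. -/
def ZeroDriftPlus (κ : Kernel S S) (I : Set Plane) : Prop :=
  ∃ ε : ℝ, 0 < ε ∧ ∃ C R : ℝ, 0 < R ∧ ∀ r : ℝ, R ≤ r →
    ∀ x : S, (x : Plane) ∈ I → r ≤ ‖(x : Plane)‖ → ‖meanIncrement κ x‖ ≤ C * r ^ (-1 - ε)

/-- Assumption (C) with limiting covariance matrix `Σ`:
`sup {‖E_x (Δ Δᵀ) - Σ‖ : x ∈ I, ‖x‖ ≥ r} → 0` as `r → ∞`. -/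
def Covariance (κ : Kernel S S) (I : Set Plane) (Sig : Matrix (Fin 2) (Fin 2) ℝ) : Prop :=
  ∀ ε : ℝ, 0 < ε → ∃ R : ℝ, ∀ r : ℝ, R ≤ r →
    ∀ x : S, (x : Plane) ∈ I → r ≤ ‖(x : Plane)‖ → opNorm (secondMoment κ x - Sig) ≤ ε

/-- Assumption (C₊) with limiting covariance matrix `Σ`: for some `ε > 0`,
`sup {‖E_x (Δ Δᵀ) - Σ‖ : x ∈ I, ‖x‖ ≥ r} = O(r ^ (-ε))` as `r → ∞`. -/
def CovariancePlus (κ : Kernel S S) (I : Set Plane) (Sig : Matrix (Fin 2) (Fin 2) ℝ) : Prop :=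
  ∃ ε : ℝ, 0 < ε ∧ ∃ C R : ℝ, 0 < R ∧ ∀ r : ℝ, R ≤ r →
    ∀ x : S, (x : Plane) ∈ I → r ≤ ‖(x : Plane)‖ →
      opNorm (secondMoment κ x - Sig) ≤ C * r ^ (-ε)

/-- One half of assumption (R): on the part `T` of the boundary layer, the mean increment is
`μ(x) n(x) + O(1 / r)` uniformly over `‖x‖ ≥ r`, with `liminf μ(x) > 0` as `‖x‖ → ∞`. -/
def ReflectsAlong (κ : Kernel S S) (T : Set Plane) (n : Plane → Plane) : Prop :=
  ∃ μ : Plane → ℝ,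
    (∃ c R : ℝ, 0 < c ∧ ∀ x : S, (x : Plane) ∈ T → R ≤ ‖(x : Plane)‖ → c ≤ μ x) ∧
    ∃ C R : ℝ, 0 < R ∧ ∀ r : ℝ, R ≤ r →
      ∀ x : S, (x : Plane) ∈ T → r ≤ ‖(x : Plane)‖ →
        ‖meanIncrement κ x - μ x • n x‖ ≤ C * r⁻¹

/-- Assumption (R) with reflection angles `αP` (upper boundary) and `αM` (lower boundary). -/
def Reflection (κ : Kernel S S) (DB : Set Plane) (aP aM βP βM αP αM : ℝ) : Prop :=
  ReflectsAlong κ (upperPart S DB) (fun x => upperNormal aP βP (x 0) αP) ∧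
  ReflectsAlong κ (lowerPart S DB) (fun x => lowerNormal aM βM (x 0) αM)

/-- The chain started from `x₀` is recurrent: for some constant `r₀`,
`liminf ‖ξ_n‖ ≤ r₀` almost surely. -/
def IsRecurrent (κ : Kernel S S) [IsMarkovKernel κ] (x₀ : S) : Prop :=
  ∃ r₀ : ℝ≥0, ∀ᵐ ω ∂(chainLaw κ x₀),
    liminf (fun n => ‖(ω n : Plane)‖ₑ) atTop ≤ (r₀ : ℝ≥0∞)

/-- The chain started from `x₀` is transient: `‖ξ_n‖ → ∞` almost surely. -/
def IsTransient (κ : Kernel S S) [IsMarkovKernel κ] (x₀ : S) : Prop :=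
  ∀ᵐ ω ∂(chainLaw κ x₀), Tendsto (fun n => ‖(ω n : Plane)‖) atTop atTop

end Chain

end

end ReflectedWalk

/-! The chain is tested against a function `h` of logarithmic growth whose one-step drift is known
up to order ‖x‖⁻². Recurrence comes from V = log(h + const) in `isRecurrent_of_lyapunov`, transience
from V = 1/(h + const) in `isTransient_of_lyapunov`; both combine convergence of nonnegative
supermartingales with non-confinement. The criteria `isRecurrent_of_expansion` and
`isTransient_of_expansion` reduce everything to the drift of `h` itself: below -c‖x‖⁻² gives
recurrence, above c‖x‖⁻² gives transience. A drift of order at most ‖x‖^(-2-η) still gives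
recurrence if the gradient of `h` has exact size ‖x‖⁻¹: concavity of the outer logarithm gains a
multiple of ‖x‖⁻²/h², while `h` grows only like log ‖x‖.

When both exponents are below one, t = 1 + x 0 is comparable with the norm, and `thinFn` is log t +
(β/2)(x 1 / t)² plus two corrections. Its interior drift is (βσ₂² - σ₁²)/(2t²) to leading order, and
the sign of this number is the phase transition. The coefficient β/2 is forced by reflection: along
the normal of a curve of exponent β the logarithm contributes aβt^(β-2), the quadratic term
-2(β/2)at^(β-2), and the two cancel. The correction g t^(-2-ν)(x 1)² then gives a contribution of
order t^(β-2-ν) and sign opposite to g at such a curve. A second curve of smaller exponent β'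
escapes the cancellation, but only by order t^(β'-2). There the linear correction b t^(θ-2) x 1 with
θ = β - 2ν and a suitable sign of b dominates, while at the wider curve it is negligible because θ <
β - ν. Since θ > 0, all this exceeds the second order terms, which are O(t⁻²). This is
`normal_derivative_thinFn_le`.

When both exponents exceed one, the boundary curves hug the vertical axis and the normals become
horizontal, as for a half-plane. With v a root of v²σ₁² + 2ivρ - σ₂² = 0 and ζ = 1 + v x 0 + i x 1,
holomorphic functions of ζ are harmonic for the limiting covariance. The function Re(v⁻¹ log ζ) has
horizontal derivative Re(1/ζ), almost zero near the axis. Subtracting x 0 (1 + ‖x‖²)^(-(1+ν)/2)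
makes the normal derivative negative of order ‖x‖^(-1-ν) (`exists_wide_normal_derivative_le`), at an
interior cost of order ‖x‖^(-2-ν) only, and the borderline criterion applies to `wideFn`.

Only a moment of order q > 2 is available, so Taylor expansions must be global and integrable: this
is `HasExpansion`, obtained by `hasExpansion_of_scale` from a Taylor bound for relatively small
jumps and a crude bound for all jumps. -/

namespace ReflectedWalk

noncomputable section

/-! ### Markov property and supermartingale convergence. -/

/-- The Markov property of an Ionescu-Tulcea trajectory at time `n`, in integrated form. -/
lemma setLIntegral_traj_succ {E : Type*} [MeasurableSpace E]
    (K : (n : ℕ) → Kernel ((i : Finset.Iic n) → E) E) [∀ n, IsMarkovKernel (K n)]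
    (h₀ : (i : Finset.Iic 0) → E) (n : ℕ) {A : Set ((i : Finset.Iic n) → E)}
    (hA : MeasurableSet A) {f : E → ℝ≥0∞} (hf : Measurable f) :
    ∫⁻ ω in Preorder.frestrictLe (π := fun _ : ℕ => E) n ⁻¹' A, f (ω (n + 1))
        ∂(Kernel.traj (X := fun _ => E) K 0 h₀) =
      ∫⁻ ω in Preorder.frestrictLe (π := fun _ : ℕ => E) n ⁻¹' A,
        ∫⁻ y, f y ∂(K n (Preorder.frestrictLe (π := fun _ : ℕ => E) n ω))
        ∂(Kernel.traj (X := fun _ => E) K 0 h₀) := by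
  have hm : Measurable (Preorder.frestrictLe (π := fun _ : ℕ => E) n) := by fun_prop
  -- The joint law of the history up to `n` and the next coordinate is a composition product; both
  -- sides are integrals of `g` against it.
  have hmap := Kernel.partialTraj_compProd_eq_map_traj (X := fun _ : ℕ => E) (κ := K)
    (Nat.zero_le n) (x₀ := h₀)
  set g : ((i : Finset.Iic n) → E) × E → ℝ≥0∞ := fun p => A.indicator (fun _ => f p.2) p.1
    with hg
  have hmeas : Measurable g := by
    have : g = (Prod.fst ⁻¹' A).indicator fun p => f p.2 := by
      ext p; by_cases hp : p.1 ∈ A <;> simp [hg, hp]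
    rw [this]
    exact (hf.comp measurable_snd).indicator (measurable_fst hA)
  have hpair : Measurable fun ω : ℕ → E =>
      (Preorder.frestrictLe (π := fun _ : ℕ => E) n ω, ω (n + 1)) :=
    hm.prodMk (measurable_pi_apply _)
  have h1 := lintegral_map (μ := Kernel.traj (X := fun _ => E) K 0 h₀) hmeas hpair
  rw [← hmap, Measure.lintegral_compProd hmeas] at h1
  have hmF : Measurable (A.indicator fun h => ∫⁻ y, f y ∂(K n h)) :=
    (hf.lintegral_kernel (κ := K n)).indicator hA
  have h2 := lintegral_map (μ := Kernel.traj (X := fun _ => E) K 0 h₀) hmF hm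
  rw [Kernel.traj_map_frestrictLe_apply] at h2
  have h3 : ∀ h, ∫⁻ y, g (h, y) ∂(K n h) = A.indicator (fun h => ∫⁻ y, f y ∂(K n h)) h := by
    intro h
    by_cases hh : h ∈ A <;> simp [hg, hh]
  rw [lintegral_congr h3, h2] at h1
  rw [← lintegral_indicator (hm hA), ← lintegral_indicator (hm hA)]
  exact h1.symm

/-- The Markov property of the chain at time `n`, in integrated form. -/
lemma setLIntegral_chainLaw_succ {S : Set Plane} (κ : Kernel S S) [IsMarkovKernel κ] (x : S)
    (n : ℕ) {s : Set (ℕ → S)} (hs : MeasurableSet[Filtration.piLE (X := fun _ : ℕ => S) n] s)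
    {f : S → ℝ≥0∞} (hf : Measurable f) :
    ∫⁻ ω in s, f (ω (n + 1)) ∂(chainLaw κ x) =
      ∫⁻ ω in s, ∫⁻ y, f y ∂(κ (ω n)) ∂(chainLaw κ x) := by
  rw [Filtration.piLE_eq_comap_frestrictLe] at hs
  obtain ⟨A, hA, rfl⟩ := hs
  exact setLIntegral_traj_succ (fun n =>
    κ.comap (fun h : (i : Finset.Iic n) → S => h ⟨n, Finset.mem_Iic.2 le_rfl⟩)
      (measurable_pi_apply _)) (fun _ => x) n hA hf

/-- Nonnegative supermartingale convergence, with the supermartingale property in integrated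
form. -/
lemma ae_tendsto_of_setLIntegral_succ_le {Ω : Type*} {m0 : MeasurableSpace Ω} {μ : Measure Ω}
    [IsFiniteMeasure μ] (ℱ : Filtration ℕ m0) {f : ℕ → Ω → ℝ} (hf0 : ∀ n ω, 0 ≤ f n ω)
    (hf : ∀ n, Measurable[ℱ n] (f n)) {k : ℝ≥0} (h0 : ∫⁻ ω, ENNReal.ofReal (f 0 ω) ∂μ ≤ k)
    (hs : ∀ n s, MeasurableSet[ℱ n] s →
      ∫⁻ ω in s, ENNReal.ofReal (f (n + 1) ω) ∂μ ≤ ∫⁻ ω in s, ENNReal.ofReal (f n ω) ∂μ) :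
    ∀ᵐ ω ∂μ, ∃ c, Tendsto (fun n => f n ω) atTop (𝓝 c) := by
  have hle : ∀ n, ∫⁻ ω, ENNReal.ofReal (f n ω) ∂μ ≤ k := by
    intro n
    induction n with
    | zero => exact h0
    | succ n ih =>
      refine le_trans ?_ ih
      simpa using hs n Set.univ MeasurableSet.univ
  have hm : ∀ n, Measurable (f n) := fun n => (hf n).mono (ℱ.le n) le_rfl
  have hint : ∀ n, Integrable (f n) μ := fun n => by
    refine ⟨(hm n).aestronglyMeasurable, ?_⟩
    rw [hasFiniteIntegral_iff_ofReal (ae_of_all _ (hf0 n))]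
    exact (hle n).trans_lt ENNReal.coe_lt_top
  -- The convergence theorem asks for an L¹-bounded submartingale; for `-f` the bound is the
  -- expectation of `f`, which never exceeds its initial value.
  have hsup : Submartingale (fun n ω => -f n ω) ℱ μ := by
    refine submartingale_of_setIntegral_le_succ
      (fun n => ((hf n).stronglyMeasurable).neg) (fun n => (hint n).neg) fun n s hsm => ?_
    rw [integral_neg, integral_neg, neg_le_neg_iff,
      integral_eq_lintegral_of_nonneg_ae (ae_of_all _ (hf0 _)) (hm _).aestronglyMeasurable,
      integral_eq_lintegral_of_nonneg_ae (ae_of_all _ (hf0 _)) (hm _).aestronglyMeasurable]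
    refine ENNReal.toReal_mono ?_ (hs n s hsm)
    exact ((setLIntegral_le_lintegral _ _).trans_lt ((hle n).trans_lt ENNReal.coe_lt_top)).ne
  have hconv := hsup.ae_tendsto_limitProcess (R := k) fun n => by
    rw [eLpNorm_one_eq_lintegral_enorm]
    refine le_trans (le_of_eq (lintegral_congr fun ω => ?_)) (hle n)
    rw [Real.enorm_eq_ofReal_abs, abs_neg, abs_of_nonneg (hf0 n ω)]
  filter_upwards [hconv] with ω hω
  exact ⟨_, by simpa using hω.neg⟩

lemma measurable_piLE_eval {S : Set Plane} {j n : ℕ} (hj : j ≤ n) :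
    Measurable[Filtration.piLE (X := fun _ : ℕ => S) n] (fun ω : ℕ → S => ω j) := by
  have : (fun ω : ℕ → S => ω j) =
      (fun h : (i : Set.Iic n) → S => h ⟨j, hj⟩) ∘ Preorder.restrictLe (π := fun _ : ℕ => S) n := rfl
  rw [this]
  exact (measurable_pi_apply _).comp (comap_measurable _)

instance {S : Set Plane} (κ : Kernel S S) [IsMarkovKernel κ] (x : S) :
    IsProbabilityMeasure (chainLaw κ x) := by
  unfold chainLaw; infer_instance

lemma frequently_norm_gt_of_limsup_eq_top {u : ℕ → Plane}
    (h : limsup (fun n => ‖u n‖ₑ) atTop = ⊤) (K : ℝ) : ∃ᶠ n in atTop, K < ‖u n‖ := by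
  have : ∃ᶠ n in atTop, ENNReal.ofReal K < ‖u n‖ₑ := by
    refine frequently_lt_of_lt_limsup (by isBoundedDefault) ?_
    rw [h]; exact ENNReal.ofReal_lt_top
  refine this.mono fun n hn => ?_
  rw [← ofReal_norm] at hn
  exact (ENNReal.ofReal_lt_ofReal_iff').1 hn |>.1

/-! ### Recurrence and transience from Lyapunov functions. -/

/-- Foster's criterion: a nonnegative function growing to infinity which is superharmonic outside
a ball forces recurrence. -/
theorem isRecurrent_of_lyapunov {S : Set Plane} (κ : Kernel S S) [IsMarkovKernel κ]
    (hN : NonConfinement κ) {V : S → ℝ} (hVm : Measurable V) (hV0 : ∀ x, 0 ≤ V x)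
    (hVinf : ∀ M : ℝ, ∃ R : ℝ, ∀ x : S, R ≤ ‖(x : Plane)‖ → M ≤ V x) {R : ℝ}
    (hint : ∀ x : S, R ≤ ‖(x : Plane)‖ → Integrable V (κ x))
    (hdrift : ∀ x : S, R ≤ ‖(x : Plane)‖ → ∫ y, V y ∂(κ x) ≤ V x) (x₀ : S) :
    IsRecurrent κ x₀ := by
  refine ⟨R.toNNReal, ?_⟩
  have hd : ∀ x : S, R ≤ ‖(x : Plane)‖ →
      ∫⁻ y, ENNReal.ofReal (V y) ∂(κ x) ≤ ENNReal.ofReal (V x) := fun x hx => by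
    rw [← ofReal_integral_eq_lintegral_ofReal (hint x hx) (ae_of_all _ hV0)]
    exact ENNReal.ofReal_le_ofReal (hdrift x hx)
  -- The bound `k` only makes the supermartingale started at time `N` integrable; every path
  -- satisfies it for some `k`, and countably many pairs suffice.
  have key : ∀ N k : ℕ, ∀ᵐ ω ∂(chainLaw κ x₀), V (ω N) ≤ k →
      ¬ ∀ j, R < ‖(ω (N + j) : Plane)‖ := by
    intro N k
    let ℱ : Filtration ℕ (inferInstance : MeasurableSpace (ℕ → S)) :=
      { seq := fun m => Filtration.piLE (X := fun _ : ℕ => S) (N + m)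
        mono' := fun i j hij => Filtration.piLE.mono (Nat.add_le_add_left hij N)
        le' := fun m => Filtration.piLE.le (N + m) }
    -- With `j < m` rather than `j ≤ m`, the event `G (m + 1)` is known at time `N + m` and forces
    -- the chain to be outside the ball then, where the drift condition applies.
    let G : ℕ → Set (ℕ → S) := fun m =>
      {ω | V (ω N) ≤ k ∧ ∀ j < m, R < ‖(ω (N + j) : Plane)‖}
    -- `V` along the path, killed after the first visit to the ball. Killing preserves the
    -- supermartingale property because `V` is nonnegative.
    let Y : ℕ → (ℕ → S) → ℝ := fun m => (G m).indicator fun ω => V (ω (N + m))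
    have hGm : ∀ m l, m ≤ l + 1 → MeasurableSet[ℱ l] (G m) := by
      intro m l hml
      have h1 : MeasurableSet[ℱ l] {ω : ℕ → S | V (ω N) ≤ k} := by
        have : Measurable[ℱ l] fun ω : ℕ → S => V (ω N) :=
          hVm.comp (measurable_piLE_eval (Nat.le_add_right N l))
        exact this measurableSet_Iic
      have h2 : MeasurableSet[ℱ l] (⋂ j ∈ Set.Iio m, {ω : ℕ → S | R < ‖(ω (N + j) : Plane)‖}) := by
        refine MeasurableSet.biInter (Set.to_countable _) fun j hj => ?_
        have : Measurable[ℱ l] fun ω : ℕ → S => ‖(ω (N + j) : Plane)‖ :=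
          (measurable_subtype_coe.norm).comp
            (measurable_piLE_eval (by have : j < m := hj; omega))
        exact this measurableSet_Ioi
      have : G m = {ω : ℕ → S | V (ω N) ≤ k} ∩
          ⋂ j ∈ Set.Iio m, {ω : ℕ → S | R < ‖(ω (N + j) : Plane)‖} := by
        ext ω; simp [G]
      rw [this]
      exact h1.inter h2
    have hY0 : ∀ m ω, 0 ≤ Y m ω := fun m ω => Set.indicator_nonneg (fun _ _ => hV0 _) _
    have hYm : ∀ m, Measurable[ℱ m] (Y m) := fun m =>
      (hVm.comp (measurable_piLE_eval le_rfl)).indicator (hGm m m (Nat.le_succ m))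
    have hYofReal : ∀ m ω, ENNReal.ofReal (Y m ω) =
        (G m).indicator (fun ω => ENNReal.ofReal (V (ω (N + m)))) ω := by
      intro m ω
      by_cases h : ω ∈ G m <;> simp [Y, h]
    have hconv := ae_tendsto_of_setLIntegral_succ_le (μ := chainLaw κ x₀) ℱ hY0 hYm
      (k := k) (by
        calc ∫⁻ ω, ENNReal.ofReal (Y 0 ω) ∂(chainLaw κ x₀)
            ≤ ∫⁻ _, (k : ℝ≥0∞) ∂(chainLaw κ x₀) := by
              refine lintegral_mono fun ω => ?_
              have : Y 0 ω ≤ k := by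
                by_cases h : ω ∈ G 0
                · simpa [Y, h] using h.1
                · simp [Y, h]
              exact ENNReal.ofReal_le_of_le_toReal (by simpa using this)
          _ = _ := by simp)
      (by
        intro m s hs
        have hG := ℱ.le m _ (hGm (m + 1) m le_rfl)
        simp_rw [hYofReal]
        rw [setLIntegral_indicator hG]
        calc ∫⁻ ω in G (m + 1) ∩ s, ENNReal.ofReal (V (ω (N + (m + 1)))) ∂(chainLaw κ x₀)
            = ∫⁻ ω in G (m + 1) ∩ s, ∫⁻ y, ENNReal.ofReal (V y) ∂(κ (ω (N + m)))
                ∂(chainLaw κ x₀) :=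
              setLIntegral_chainLaw_succ κ x₀ (N + m) ((hGm (m + 1) m le_rfl).inter hs)
                hVm.ennreal_ofReal
          _ ≤ ∫⁻ ω in G (m + 1) ∩ s,
                (G m).indicator (fun ω => ENNReal.ofReal (V (ω (N + m)))) ω ∂(chainLaw κ x₀) := by
              refine setLIntegral_mono_ae' (hG.inter (ℱ.le m _ hs)) (ae_of_all _ fun ω hω => ?_)
              have hωm : ω ∈ G m := ⟨hω.1.1, fun j hj => hω.1.2 j (Nat.lt_succ_of_lt hj)⟩
              rw [Set.indicator_of_mem hωm]
              exact hd _ (hω.1.2 m (Nat.lt_succ_self m)).le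
          _ ≤ _ := lintegral_mono_set Set.inter_subset_right)
    filter_upwards [hconv, hN x₀] with ω ⟨c, hc⟩ hω hk hall
    obtain ⟨R', hR'⟩ := hVinf (c + 1)
    have hY : ∀ m, Y m ω = V (ω (N + m)) := fun m =>
      Set.indicator_of_mem (show ω ∈ G m from ⟨hk, fun j _ => hall j⟩) _
    have hev : ∀ᶠ m in atTop, Y m ω < c + 1 := hc.eventually_lt_const (by linarith)
    have hev' : ∀ᶠ n in atTop, ‖(ω n : Plane)‖ < R' := by
      obtain ⟨m0, hm0⟩ := eventually_atTop.1 hev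
      refine eventually_atTop.2 ⟨N + m0, fun n hn => ?_⟩
      obtain ⟨m, rfl⟩ := Nat.exists_eq_add_of_le (show N ≤ n by omega)
      by_contra hcon
      have h1 := hR' _ (not_lt.1 hcon)
      have h2 := hm0 m (by omega)
      rw [hY] at h2
      linarith
    have hfr := frequently_norm_gt_of_limsup_eq_top hω R'
    exact hfr (hev'.mono fun n hn => not_lt.2 hn.le)
  filter_upwards [ae_all_iff.2 fun N => ae_all_iff.2 (key N)] with ω hω
  by_contra hlim
  have hev := eventually_lt_of_lt_liminf (not_le.1 hlim)
  obtain ⟨N, hNn⟩ := eventually_atTop.1 hev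
  obtain ⟨k, hk⟩ := exists_nat_ge (V (ω N))
  refine hω N k hk fun j => ?_
  have := hNn (N + j) (Nat.le_add_right N j)
  rw [← ofReal_norm, ← ENNReal.ofReal_coe_nnreal, ENNReal.ofReal_lt_ofReal_iff'] at this
  exact (Real.le_coe_toNNReal R).trans_lt this.1

/-- A bounded positive function vanishing at infinity which is superharmonic outside a ball
forces transience. -/
theorem isTransient_of_lyapunov {S : Set Plane} (κ : Kernel S S) [IsMarkovKernel κ]
    (hN : NonConfinement κ) {V : S → ℝ} (hVm : Measurable V) (hV1 : ∀ x, V x ≤ 1)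
    (hV0 : ∀ x, 0 < V x)
    (hVinf : ∀ ε : ℝ, 0 < ε → ∃ R : ℝ, ∀ x : S, R ≤ ‖(x : Plane)‖ → V x ≤ ε)
    (hVpos : ∀ R : ℝ, ∃ v : ℝ, 0 < v ∧ ∀ x : S, ‖(x : Plane)‖ ≤ R → v ≤ V x) {R : ℝ}
    (hdrift : ∀ x : S, R ≤ ‖(x : Plane)‖ → ∫ y, V y ∂(κ x) ≤ V x) (x₀ : S) :
    IsTransient κ x₀ := by
  obtain ⟨v, hv, hvR⟩ := hVpos R
  -- Since `V ≥ v` on the ball, the truncation is superharmonic everywhere: either `V x < v` and `x`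
  -- is outside the ball, or `W` is at its maximum.
  let W : S → ℝ := fun x => min (V x) v
  have hWm : Measurable W := hVm.min measurable_const
  have hW0 : ∀ x, 0 ≤ W x := fun x => le_min (hV0 x).le hv.le
  have hint : ∀ x : S, Integrable V (κ x) := fun x =>
    Integrable.of_bound hVm.aestronglyMeasurable 1
      (ae_of_all _ fun y => by rw [Real.norm_eq_abs, abs_of_pos (hV0 y)]; exact hV1 y)
  have hd : ∀ x : S, ∫⁻ y, ENNReal.ofReal (W y) ∂(κ x) ≤ ENNReal.ofReal (W x) := by
    intro x
    have hle : ∫⁻ y, ENNReal.ofReal (W y) ∂(κ x) ≤ ENNReal.ofReal v := by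
      calc _ ≤ ∫⁻ _, ENNReal.ofReal v ∂(κ x) :=
            lintegral_mono fun y => ENNReal.ofReal_le_ofReal (min_le_right _ _)
        _ = _ := by simp
    by_cases hx : V x < v
    · have hxR : R ≤ ‖(x : Plane)‖ := by
        by_contra hcon
        exact absurd (hvR x (not_le.1 hcon).le) (not_le.2 hx)
      have hWx : W x = V x := min_eq_left hx.le
      rw [hWx]
      calc _ ≤ ∫⁻ y, ENNReal.ofReal (V y) ∂(κ x) :=
            lintegral_mono fun y => ENNReal.ofReal_le_ofReal (min_le_left _ _)
        _ = ENNReal.ofReal (∫ y, V y ∂(κ x)) :=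
            (ofReal_integral_eq_lintegral_ofReal (hint x) (ae_of_all _ fun y => (hV0 y).le)).symm
        _ ≤ _ := ENNReal.ofReal_le_ofReal (hdrift x hxR)
    · have hWx : W x = v := min_eq_right (not_lt.1 hx)
      rwa [hWx]
  have hconv := ae_tendsto_of_setLIntegral_succ_le (μ := chainLaw κ x₀)
    (Filtration.piLE (X := fun _ : ℕ => S)) (f := fun n ω => W (ω n)) (fun n ω => hW0 _)
    (fun n => hWm.comp (measurable_piLE_eval le_rfl)) (k := v.toNNReal)
    (by
      calc ∫⁻ ω, ENNReal.ofReal (W (ω 0)) ∂(chainLaw κ x₀)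
          ≤ ∫⁻ _, ENNReal.ofReal v ∂(chainLaw κ x₀) :=
            lintegral_mono fun ω => ENNReal.ofReal_le_ofReal (min_le_right _ _)
        _ = _ := by simp [ENNReal.ofReal])
    (by
      intro n s hs
      rw [setLIntegral_chainLaw_succ κ x₀ n hs hWm.ennreal_ofReal]
      exact lintegral_mono fun ω => hd _)
  filter_upwards [hconv, hN x₀] with ω ⟨c, hc⟩ hω
  -- Non-confinement produces times at which `V` is arbitrarily small, so no positive limit is
  -- possible.
  have hc0 : c = 0 := by
    refine le_antisymm ?_ (ge_of_tendsto' hc fun n => hW0 _)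
    by_contra hcpos
    push Not at hcpos
    obtain ⟨R', hR'⟩ := hVinf (c / 2) (by linarith)
    have hev : ∀ᶠ n in atTop, c / 2 < W (ω n) := hc.eventually_const_lt (by linarith)
    refine frequently_norm_gt_of_limsup_eq_top hω R' (hev.mono fun n hn => ?_)
    intro hlt
    exact absurd ((min_le_left _ _).trans (hR' _ hlt.le)) (not_le.2 hn)
  subst hc0
  refine tendsto_atTop.2 fun R' => ?_
  obtain ⟨v', hv', hvR'⟩ := hVpos R'
  have hev : ∀ᶠ n in atTop, W (ω n) < min v' v := hc.eventually_lt_const (lt_min hv' hv)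
  filter_upwards [hev] with n hn
  by_contra hcon
  have h1 := hvR' (ω n) (not_le.1 hcon).le
  exact absurd hn (not_lt.2 (min_le_min_right _ h1))

/-! ### Moments of the increments. -/

/-- The `q`-th absolute moments of the increments are bounded by `M`. -/
def MomentBound {S : Set Plane} (κ : Kernel S S) (q M : ℝ) : Prop :=
  ∀ x : S, Integrable (fun y : S => ‖(y : Plane) - x‖ ^ q) (κ x) ∧
    ∫ y, ‖(y : Plane) - x‖ ^ q ∂(κ x) ≤ M

lemma rpow_le_one_add_rpow {a s p : ℝ} (ha : 0 ≤ a) (hs : 0 ≤ s) (hsp : s ≤ p) :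
    a ^ s ≤ 1 + a ^ p := by
  rcases le_total a 1 with h | h
  · exact (Real.rpow_le_one ha h hs).trans (le_add_of_nonneg_right (Real.rpow_nonneg ha p))
  · exact (Real.rpow_le_rpow_of_exponent_le h hsp).trans (by linarith)

lemma measurable_norm_sub_rpow {S : Set Plane} (x : S) (q : ℝ) :
    Measurable fun y : S => ‖(y : Plane) - x‖ ^ q :=
  ((measurable_subtype_coe.sub_const _).norm).pow_const q

/-- The exponent is capped at 3 so that cubic Taylor remainders of small relative jumps are bounded
by their `q`-th powers. -/
lemma exists_momentBound {S : Set Plane} {κ : Kernel S S} [IsMarkovKernel κ]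
    (hM : BoundedMoments κ) : ∃ q M : ℝ, 2 < q ∧ q ≤ 3 ∧ 0 ≤ M ∧ MomentBound κ q M := by
  obtain ⟨p, hp, hsup⟩ := hM
  set s := ⨆ x : S, ∫⁻ y, ‖(y : Plane) - (x : Plane)‖ₑ ^ p ∂(κ x) with hs
  refine ⟨min p 3, (1 + s).toReal, by simp [hp]; norm_num, min_le_right _ _,
    ENNReal.toReal_nonneg, fun x => ?_⟩
  have hq0 : 0 ≤ min p 3 := le_min (by linarith) (by norm_num)
  have hle : ∫⁻ y, ENNReal.ofReal (‖(y : Plane) - x‖ ^ min p 3) ∂(κ x) ≤ 1 + s := by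
    calc _ ≤ ∫⁻ y, (1 + ‖(y : Plane) - (x : Plane)‖ₑ ^ p) ∂(κ x) := by
          refine lintegral_mono fun y => ?_
          refine (ENNReal.ofReal_le_ofReal
            (rpow_le_one_add_rpow (norm_nonneg _) hq0 (min_le_left p 3))).trans ?_
          rw [ENNReal.ofReal_add zero_le_one (Real.rpow_nonneg (norm_nonneg _) _),
            ENNReal.ofReal_one, ← ENNReal.ofReal_rpow_of_nonneg (norm_nonneg _) (by linarith),
            ofReal_norm]
      _ = 1 + ∫⁻ y, ‖(y : Plane) - (x : Plane)‖ₑ ^ p ∂(κ x) := by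
          rw [lintegral_add_left measurable_const]; simp
      _ ≤ 1 + s := by
          gcongr
          exact le_iSup (fun x : S => ∫⁻ y, ‖(y : Plane) - (x : Plane)‖ₑ ^ p ∂(κ x)) x
  have htop : 1 + s < ⊤ := ENNReal.add_lt_top.2 ⟨ENNReal.one_lt_top, hsup⟩
  have hnn : 0 ≤ᵐ[κ x] fun y : S => ‖(y : Plane) - x‖ ^ min p 3 :=
    ae_of_all _ fun y => Real.rpow_nonneg (norm_nonneg _) _
  refine ⟨⟨(measurable_norm_sub_rpow x _).aestronglyMeasurable, ?_⟩, ?_⟩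
  · rw [hasFiniteIntegral_iff_ofReal hnn]
    exact hle.trans_lt htop
  · rw [integral_eq_lintegral_of_nonneg_ae hnn
      (measurable_norm_sub_rpow x _).aestronglyMeasurable]
    exact ENNReal.toReal_mono htop.ne hle

section Moments

variable {S : Set Plane} {κ : Kernel S S} [IsMarkovKernel κ] {q M : ℝ}

lemma abs_coord_le_norm (x : Plane) (i : Fin 2) : |x i| ≤ ‖x‖ := by
  simpa using PiLp.norm_apply_le x i

lemma MomentBound.integrable_sq (h : MomentBound κ q M) (hq : 2 < q) (x : S) :
    Integrable (fun y : S => ‖(y : Plane) - x‖ ^ 2) (κ x) := by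
  refine Integrable.mono' ((integrable_const (1 : ℝ)).add (h x).1)
    (by simpa using (measurable_norm_sub_rpow x 2).aestronglyMeasurable) (ae_of_all _ fun y => ?_)
  have := rpow_le_one_add_rpow (norm_nonneg ((y : Plane) - x)) (by norm_num : (0 : ℝ) ≤ 2) hq.le
  rw [Real.norm_of_nonneg (by positivity)]
  simpa using this

lemma MomentBound.integral_sq_le (h : MomentBound κ q M) (hq : 2 < q) (x : S) :
    ∫ y, ‖(y : Plane) - x‖ ^ 2 ∂(κ x) ≤ 1 + M := by
  calc _ ≤ ∫ y, (1 + ‖(y : Plane) - x‖ ^ q) ∂(κ x) := by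
        refine integral_mono (h.integrable_sq hq x) ((integrable_const (1 : ℝ)).add (h x).1)
          fun y => ?_
        simpa using rpow_le_one_add_rpow (norm_nonneg ((y : Plane) - x))
          (by norm_num : (0 : ℝ) ≤ 2) hq.le
    _ ≤ 1 + M := by
        rw [integral_add (integrable_const _) (h x).1]
        simpa using (h x).2

lemma MomentBound.integrable_coord (h : MomentBound κ q M) (hq : 2 < q) (x : S) (i : Fin 2) :
    Integrable (fun y : S => (y : Plane) i - (x : Plane) i) (κ x) := by
  refine Integrable.mono' ((integrable_const (1 : ℝ)).add (h.integrable_sq hq x))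
    (Measurable.aestronglyMeasurable (by fun_prop)) (ae_of_all _ fun y => ?_)
  have h1 := abs_coord_le_norm ((y : Plane) - x) i
  simp only [PiLp.sub_apply, Real.norm_eq_abs, Pi.add_apply] at h1 ⊢
  nlinarith [sq_nonneg (‖(y : Plane) - x‖ - 1)]

lemma MomentBound.integrable_coord_mul (h : MomentBound κ q M) (hq : 2 < q) (x : S)
    (i j : Fin 2) : Integrable (fun y : S => ((y : Plane) i - (x : Plane) i) *
      ((y : Plane) j - (x : Plane) j)) (κ x) := by
  refine Integrable.mono' (h.integrable_sq hq x)
    (Measurable.aestronglyMeasurable (by fun_prop)) (ae_of_all _ fun y => ?_)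
  have h1 := abs_coord_le_norm ((y : Plane) - x) i
  have h2 := abs_coord_le_norm ((y : Plane) - x) j
  simp only [PiLp.sub_apply, Real.norm_eq_abs, abs_mul] at h1 h2 ⊢
  rw [sq]
  exact mul_le_mul h1 h2 (abs_nonneg _) (norm_nonneg _)

lemma MomentBound.integrable_sub (h : MomentBound κ q M) (hq : 2 < q) (x : S) :
    Integrable (fun y : S => (y : Plane) - (x : Plane)) (κ x) := by
  refine Integrable.mono' ((integrable_const (1 : ℝ)).add (h.integrable_sq hq x))
    ((measurable_subtype_coe.sub_const _).aestronglyMeasurable) (ae_of_all _ fun y => ?_)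
  simp only [Pi.add_apply]
  nlinarith [sq_nonneg (‖(y : Plane) - x‖ - 1)]

lemma MomentBound.meanIncrement_apply (h : MomentBound κ q M) (hq : 2 < q) (x : S) (i : Fin 2) :
    meanIncrement κ x i = ∫ y, ((y : Plane) i - (x : Plane) i) ∂(κ x) := by
  have := (EuclideanSpace.proj (𝕜 := ℝ) i).integral_comp_comm (h.integrable_sub hq x)
  simpa [meanIncrement] using this.symm

lemma MomentBound.abs_secondMoment_le (h : MomentBound κ q M) (hq : 2 < q) (x : S)
    (i j : Fin 2) : |secondMoment κ x i j| ≤ 1 + M := by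
  refine le_trans ?_ (h.integral_sq_le hq x)
  simp only [secondMoment, Matrix.of_apply]
  refine (abs_integral_le_integral_abs).trans
    (integral_mono (h.integrable_coord_mul hq x i j).abs (h.integrable_sq hq x) fun y => ?_)
  have h1 := abs_coord_le_norm ((y : Plane) - x) i
  have h2 := abs_coord_le_norm ((y : Plane) - x) j
  simp only [PiLp.sub_apply, abs_mul] at h1 h2 ⊢
  rw [sq]
  exact mul_le_mul h1 h2 (abs_nonneg _) (norm_nonneg _)

end Moments

/-! ### Global second order expansions and their expectations. -/

/-- The size of a point of the plane, bounded away from zero. -/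
def rad (x : Plane) : ℝ := 1 + ‖x‖

lemma one_le_rad (x : Plane) : 1 ≤ rad x := le_add_of_nonneg_right (norm_nonneg x)

lemma rad_pos (x : Plane) : 0 < rad x := one_pos.trans_le (one_le_rad x)

/-- The first order part `D₁ d₁ + D₂ d₂` of an expansion at `x`, evaluated at `y`. -/
def linPart (D1 D2 : Plane → ℝ) (x y : Plane) : ℝ :=
  D1 x * (y 0 - x 0) + D2 x * (y 1 - x 1)

/-- The second order part `q₁₁ d₁² + q₁₂ d₁ d₂ + q₂₂ d₂²` of an expansion at `x`, evaluated
at `y`. -/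
def quadPart (q11 q12 q22 : Plane → ℝ) (x y : Plane) : ℝ :=
  q11 x * (y 0 - x 0) ^ 2 + q12 x * ((y 0 - x 0) * (y 1 - x 1)) + q22 x * (y 1 - x 1) ^ 2

/-- A global second order expansion on `D` whose error is of smaller order than `|d|² / |x|²` up
to a large-jump term of order `|x| ^ η (|d| / |x|) ^ q`. -/
def HasExpansion (D : Set Plane) (η q : ℝ) (f D1 D2 q11 q12 q22 : Plane → ℝ) : Prop :=
  ∃ K : ℝ, 0 ≤ K ∧ ∀ x ∈ D, ∀ y ∈ D,
    |f y - f x - linPart D1 D2 x y - quadPart q11 q12 q22 x y| ≤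
      K * (rad x ^ (-η) * (‖y - x‖ / rad x) ^ 2 + rad x ^ η * (‖y - x‖ / rad x) ^ q)

/-- The expected value of the second order expansion after one step of the chain. -/
def stepDrift {S : Set Plane} (κ : Kernel S S) (D1 D2 q11 q12 q22 : Plane → ℝ) (x : S) : ℝ :=
  (D1 x * meanIncrement κ x 0 + D2 x * meanIncrement κ x 1) +
    (q11 x * secondMoment κ x 0 0 + q12 x * secondMoment κ x 0 1 + q22 x * secondMoment κ x 1 1)

lemma HasExpansion.add {D : Set Plane} {η q : ℝ} {f D1 D2 q11 q12 q22 f' D1' D2' q11' q12' q22' :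
    Plane → ℝ} (h : HasExpansion D η q f D1 D2 q11 q12 q22)
    (h' : HasExpansion D η q f' D1' D2' q11' q12' q22') :
    HasExpansion D η q (fun x => f x + f' x) (fun x => D1 x + D1' x) (fun x => D2 x + D2' x)
      (fun x => q11 x + q11' x) (fun x => q12 x + q12' x) (fun x => q22 x + q22' x) := by
  obtain ⟨K, hK, h⟩ := h
  obtain ⟨K', hK', h'⟩ := h'
  refine ⟨K + K', add_nonneg hK hK', fun x hx y hy => ?_⟩
  rw [add_mul]
  refine le_trans (le_of_eq ?_) ((abs_add_le _ _).trans (add_le_add (h x hx y hy) (h' x hx y hy)))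
  congr 1
  simp only [linPart, quadPart]
  ring

lemma HasExpansion.const_mul {D : Set Plane} {η q : ℝ} {f D1 D2 q11 q12 q22 : Plane → ℝ}
    (h : HasExpansion D η q f D1 D2 q11 q12 q22) (c : ℝ) :
    HasExpansion D η q (fun x => c * f x) (fun x => c * D1 x) (fun x => c * D2 x)
      (fun x => c * q11 x) (fun x => c * q12 x) (fun x => c * q22 x) := by
  obtain ⟨K, hK, h⟩ := h
  refine ⟨|c| * K, by positivity, fun x hx y hy => ?_⟩
  rw [mul_assoc]
  refine le_trans (le_of_eq ?_) (mul_le_mul_of_nonneg_left (h x hx y hy) (abs_nonneg c))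
  rw [← abs_mul]
  congr 1
  simp only [linPart, quadPart]
  ring

section Step

variable {S D : Set Plane} {κ : Kernel S S} [IsMarkovKernel κ] {q M η : ℝ}
  {f D1 D2 q11 q12 q22 : Plane → ℝ}

lemma MomentBound.integrable_linPart (hM : MomentBound κ q M) (hq : 2 < q) (x : S) :
    Integrable (fun y : S => linPart D1 D2 x y) (κ x) :=
  ((hM.integrable_coord hq x 0).const_mul _).add ((hM.integrable_coord hq x 1).const_mul _)

lemma MomentBound.integrable_quadPart (hM : MomentBound κ q M) (hq : 2 < q) (x : S) :
    Integrable (fun y : S => quadPart q11 q12 q22 x y) (κ x) := by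
  simp only [quadPart, sq]
  exact (((hM.integrable_coord_mul hq x 0 0).const_mul _).add
    ((hM.integrable_coord_mul hq x 0 1).const_mul _)).add
    ((hM.integrable_coord_mul hq x 1 1).const_mul _)

lemma MomentBound.integral_expansion (hM : MomentBound κ q M) (hq : 2 < q) (x : S) :
    ∫ y : S, (linPart D1 D2 x y + quadPart q11 q12 q22 x y) ∂(κ x) =
      stepDrift κ D1 D2 q11 q12 q22 x := by
  rw [integral_add (hM.integrable_linPart hq x) (hM.integrable_quadPart hq x), stepDrift]
  congr 1
  · simp only [linPart]
    rw [integral_add ((hM.integrable_coord hq x 0).const_mul _)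
      ((hM.integrable_coord hq x 1).const_mul _), integral_const_mul, integral_const_mul,
      hM.meanIncrement_apply hq, hM.meanIncrement_apply hq]
  · simp only [quadPart, sq]
    have i0 := (hM.integrable_coord_mul hq x 0 0).const_mul (q11 x)
    have i1 := (hM.integrable_coord_mul hq x 0 1).const_mul (q12 x)
    have i2 := (hM.integrable_coord_mul hq x 1 1).const_mul (q22 x)
    have e1 := integral_add (i0.add i1) i2
    have e2 := integral_add i0 i1
    simp only [Pi.add_apply] at e1
    rw [e1, e2, integral_const_mul, integral_const_mul, integral_const_mul]
    rfl

lemma MomentBound.integral_linPart_sq (hM : MomentBound κ q M) (hq : 2 < q) (x : S) :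
    Integrable (fun y : S => linPart D1 D2 x y ^ 2) (κ x) ∧
    ∫ y : S, linPart D1 D2 x y ^ 2 ∂(κ x) = D1 x ^ 2 * secondMoment κ x 0 0 +
      2 * (D1 x * D2 x) * secondMoment κ x 0 1 + D2 x ^ 2 * secondMoment κ x 1 1 := by
  have he : ∀ y : S, linPart D1 D2 x y ^ 2 = quadPart (fun x => D1 x ^ 2)
      (fun x => 2 * (D1 x * D2 x)) (fun x => D2 x ^ 2) x y := fun y => by
    simp only [linPart, quadPart]; ring
  simp only [he]
  refine ⟨hM.integrable_quadPart hq x, ?_⟩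
  have := hM.integral_expansion (D1 := fun _ => 0) (D2 := fun _ => 0) (q11 := fun x => D1 x ^ 2)
    (q12 := fun x => 2 * (D1 x * D2 x)) (q22 := fun x => D2 x ^ 2) hq x
  simpa [linPart, stepDrift] using this

/-- The quadratic part of the error integrates to order rad^(-2-η), the large-jump part to order
rad^(η-q). The condition `2 * η ≤ q - 2` makes the second no larger than the first. -/
lemma HasExpansion.integral_step (h : HasExpansion D η q f D1 D2 q11 q12 q22) (hS : S ⊆ D)
    (hM : MomentBound κ q M) (hq : 2 < q) (hηq : 2 * η ≤ q - 2) (hf : Measurable f)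
    (hM0 : 0 ≤ M) :
    ∃ K : ℝ, 0 ≤ K ∧ ∀ x : S, Integrable (fun y : S => f y) (κ x) ∧
      |∫ y : S, (f y - f x) ∂(κ x) - stepDrift κ D1 D2 q11 q12 q22 x| ≤
        K * rad x ^ (-2 - η) := by
  obtain ⟨K, hK, h⟩ := h
  refine ⟨K * ((1 + M) + M), by positivity, fun x => ?_⟩
  have hr := rad_pos x
  have hr1 := one_le_rad x
  have hEint : Integrable (fun y : S => linPart D1 D2 x y + quadPart q11 q12 q22 x y) (κ x) :=
    (hM.integrable_linPart hq x).add (hM.integrable_quadPart hq x)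
  set g : S → ℝ := fun y => K * (rad x ^ (-2 - η) * ‖(y : Plane) - x‖ ^ 2 +
    rad x ^ (-2 - η) * ‖(y : Plane) - x‖ ^ q) with hg
  have hgint : Integrable g (κ x) :=
    (((hM.integrable_sq hq x).const_mul _).add ((hM x).1.const_mul _)).const_mul _
  have hbound : ∀ y : S, |f y - f x - (linPart D1 D2 x y + quadPart q11 q12 q22 x y)| ≤ g y := by
    intro y
    have h1 := h x (hS x.2) y (hS y.2)
    rw [sub_sub] at h1
    refine h1.trans (mul_le_mul_of_nonneg_left (add_le_add (le_of_eq ?_) ?_) hK)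
    · rw [div_pow, Real.rpow_sub hr, Real.rpow_neg hr.le, Real.rpow_neg hr.le]
      simp only [Real.rpow_ofNat]
      field_simp
    · rw [Real.div_rpow (norm_nonneg _) hr.le]
      have h2 : rad (x : Plane) ^ η * (‖(y : Plane) - x‖ ^ q / rad (x : Plane) ^ q) =
          rad (x : Plane) ^ (η - q) * ‖(y : Plane) - x‖ ^ q := by
        rw [Real.rpow_sub hr]; field_simp
      rw [h2]
      exact mul_le_mul_of_nonneg_right
        (Real.rpow_le_rpow_of_exponent_le hr1 (by linarith)) (by positivity)
  have hfm : Measurable fun y : S => f y := hf.comp measurable_subtype_coe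
  have hrem : Integrable (fun y : S => f y - f x -
      (linPart D1 D2 x y + quadPart q11 q12 q22 x y)) (κ x) :=
    Integrable.mono' hgint (((hfm.sub_const _).aestronglyMeasurable).sub
      hEint.aestronglyMeasurable) (ae_of_all _ hbound)
  have hfx : Integrable (fun y : S => f y - f x) (κ x) := by
    refine (hrem.add hEint).congr (ae_of_all _ fun y => ?_)
    simp only [Pi.add_apply]; ring
  refine ⟨(hfx.add (integrable_const (f x))).congr (ae_of_all _ fun y => ?_), ?_⟩
  · simp only [Pi.add_apply]; ring
  rw [← hM.integral_expansion hq x, ← integral_sub hfx hEint]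
  refine (abs_integral_le_integral_abs).trans ((integral_mono hrem.abs hgint hbound).trans ?_)
  rw [hg, integral_const_mul, integral_add ((hM.integrable_sq hq x).const_mul _)
    ((hM x).1.const_mul _), integral_const_mul, integral_const_mul, mul_assoc, ← mul_add,
    mul_comm (rad (x : Plane) ^ (-2 - η))]
  gcongr
  · exact hM.integral_sq_le hq x
  · exact (hM x).2

end Step

/-! ### Logarithm and reciprocal of an expanding function. -/

/-- Write log(1+s) = 2 log √(1+s) ≤ 2(√(1+s) - 1) and bound the root by 1 + s/2 - s²/12; squaring
turns this into a polynomial inequality valid for s ≤ 1. -/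
lemma log_one_add_le_sub_sq {s : ℝ} (h0 : -1 < s) (h1 : s ≤ 1) :
    Real.log (1 + s) ≤ s - s ^ 2 / 6 := by
  have hs : 0 < 1 + s := by linarith
  have hsq : Real.sqrt (1 + s) ≤ 1 + s / 2 - s ^ 2 / 12 := by
    rw [Real.sqrt_le_left (by nlinarith)]
    nlinarith [mul_nonneg (sq_nonneg s) (show (0 : ℝ) ≤ 1 - s by linarith), sq_nonneg (s ^ 2)]
  have hlog := Real.log_le_sub_one_of_pos (Real.sqrt_pos.2 hs)
  rw [Real.log_sqrt hs.le] at hlog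
  linarith

/-- Concavity is exploited only for jumps of `H` of size at most 1, where the relative jump is at
most 1. The free parameter `G` allows any integrable lower bound of the truncated square, including
0. -/
lemma log_sub_log_le {H H' : ℝ} (hH : 1 ≤ H) (hH' : 1 ≤ H') {G : ℝ}
    (hG : G ≤ if |H' - H| ≤ 1 then (H' - H) ^ 2 else 0) :
    Real.log H' - Real.log H ≤ (H' - H) / H - G / (6 * H ^ 2) := by
  have hHp : 0 < H := by linarith
  have hH'p : 0 < H' := by linarith
  have he : H' / H = 1 + (H' - H) / H := by field_simp; ring
  rw [← Real.log_div hH'p.ne' hHp.ne']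
  have hpos : 0 < H' / H := div_pos hH'p hHp
  split_ifs at hG with hc
  · have hs1 : (H' - H) / H ≤ 1 := by
      rw [div_le_one hHp]; linarith [(abs_le.1 hc).2]
    rw [he]
    refine (log_one_add_le_sub_sq (by linarith [he ▸ hpos]) hs1).trans ?_
    have : G / (6 * H ^ 2) ≤ (H' - H) ^ 2 / (6 * H ^ 2) := by gcongr
    have h2 : ((H' - H) / H) ^ 2 / 6 = (H' - H) ^ 2 / (6 * H ^ 2) := by field_simp
    linarith
  · have h1 := Real.log_le_sub_one_of_pos hpos
    have : G / (6 * H ^ 2) ≤ 0 := div_nonpos_of_nonpos_of_nonneg hG (by positivity)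
    linarith

section Jump

variable {K q η r u e l Q : ℝ}

/-- Here `u` is the relative jump, `l` and `Q` the linear and quadratic parts. The threshold
r^(-(q-2)/(2q)) is chosen so that r^η u^(q-2) ≤ 1, which is where the bound on `η` enters; the
large-jump error then merges with the quadratic one. -/
lemma expansion_of_small_jump (hK : 0 ≤ K) (hq : 2 < q) (hη : η ≤ (q - 2) ^ 2 / (2 * q))
    (hη0 : 0 < η) (hr : 1 ≤ r) (hu : 0 ≤ u)
    (he : |e - l - Q| ≤ K * (r ^ (-η) * u ^ 2 + r ^ η * u ^ q)) (hl : |l| ≤ K * u)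
    (hQ : |Q| ≤ K * u ^ 2) (hur : u ≤ r ^ (-((q - 2) / (2 * q)))) :
    u ≤ 1 ∧ |e - l| ≤ 3 * K * u ^ 2 ∧ |e| ≤ 4 * K * u := by
  have hr0 : 0 < r := by linarith
  have hk0 : 0 < (q - 2) / (2 * q) := div_pos (by linarith) (by linarith)
  have hu1 : u ≤ 1 := hur.trans (Real.rpow_le_one_of_one_le_of_nonpos hr (by linarith))
  have h1 : r ^ (-η) ≤ 1 := Real.rpow_le_one_of_one_le_of_nonpos hr (by linarith)
  have h2 : r ^ η * u ^ q ≤ u ^ 2 := by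
    rcases hu.eq_or_lt with rfl | hu'
    · rw [Real.zero_rpow (by linarith)]; simp
    · have h3 : u ^ q = u ^ (2 : ℕ) * u ^ (q - 2) := by
        rw [← Real.rpow_natCast, ← Real.rpow_add hu']; norm_num
      have h4 : u ^ (q - 2) ≤ r ^ (-η) := by
        calc u ^ (q - 2) ≤ (r ^ (-((q - 2) / (2 * q)))) ^ (q - 2) :=
              Real.rpow_le_rpow hu hur (by linarith)
          _ = r ^ (-((q - 2) ^ 2 / (2 * q))) := by
              rw [← Real.rpow_mul hr0.le]; congr 1; ring
          _ ≤ r ^ (-η) := Real.rpow_le_rpow_of_exponent_le hr (by linarith)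
      calc r ^ η * u ^ q = u ^ 2 * (r ^ η * u ^ (q - 2)) := by rw [h3]; ring
        _ ≤ u ^ 2 * (r ^ η * r ^ (-η)) := by gcongr
        _ = u ^ 2 := by rw [← Real.rpow_add hr0]; simp
  have h5 : |e - l - Q| ≤ K * (2 * u ^ 2) := by
    refine he.trans (mul_le_mul_of_nonneg_left ?_ hK)
    nlinarith [sq_nonneg u]
  have h6 : |e - l| ≤ 3 * K * u ^ 2 := by
    calc |e - l| = |(e - l - Q) + Q| := by ring_nf
      _ ≤ |e - l - Q| + |Q| := abs_add_le _ _
      _ ≤ _ := by linarith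
  refine ⟨hu1, h6, ?_⟩
  calc |e| = |(e - l) + l| := by ring_nf
    _ ≤ |e - l| + |l| := abs_add_le _ _
    _ ≤ 3 * K * u ^ 2 + K * u := add_le_add h6 hl
    _ ≤ _ := by nlinarith [mul_nonneg hK (mul_nonneg hu (sub_nonneg.2 hu1))]

/-- Beyond the threshold w = r^((q-2)/(2q)) u is at least 1, so all powers of `w` up to `q` are at
most w^q = r^((q-2)/2) u^q. The expectation of the latter is of order r^(-2-(q-2)/2), hence
negligible against r⁻². -/
lemma expansion_of_large_jump (hK : 0 ≤ K) (hq : 2 < q) (hη : η ≤ (q - 2) ^ 2 / (2 * q))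
    (hη0 : 0 < η) (hr : 1 ≤ r) (hu : 0 ≤ u)
    (he : |e - l - Q| ≤ K * (r ^ (-η) * u ^ 2 + r ^ η * u ^ q)) (hl : |l| ≤ K * u)
    (hQ : |Q| ≤ K * u ^ 2) (hur : r ^ (-((q - 2) / (2 * q))) < u) :
    1 ≤ r ^ ((q - 2) / 2) * u ^ q ∧ l ^ 2 ≤ K ^ 2 * (r ^ ((q - 2) / 2) * u ^ q) ∧
      |e| ≤ 4 * K * (r ^ ((q - 2) / 2) * u ^ q) := by
  have hr0 : 0 < r := by linarith
  set k := (q - 2) / (2 * q) with hk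
  have hk0 : 0 < k := div_pos (by linarith) (by linarith)
  have hkq : k * q = (q - 2) / 2 := by rw [hk]; field_simp
  set w := r ^ k * u with hw
  have hrk : 1 ≤ r ^ k := Real.one_le_rpow hr hk0.le
  have hw1 : 1 ≤ w := by
    calc (1 : ℝ) = r ^ k * r ^ (-k) := by rw [← Real.rpow_add hr0]; simp
      _ ≤ w := by rw [hw]; gcongr
  have huw : u ≤ w := by rw [hw]; nlinarith
  have hJ : r ^ ((q - 2) / 2) * u ^ q = w ^ q := by
    rw [hw, Real.mul_rpow (by positivity) hu, ← Real.rpow_mul hr0.le, hkq]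
  rw [hJ]
  have hwq : w ^ 2 ≤ w ^ q := by
    have := Real.rpow_le_rpow_of_exponent_le hw1 hq.le
    simpa using this
  have hwq1 : w ≤ w ^ q := by nlinarith
  have hu2 : u ^ 2 ≤ w ^ q := by nlinarith
  refine ⟨by linarith, ?_, ?_⟩
  · calc l ^ 2 = |l| ^ 2 := (sq_abs l).symm
      _ ≤ (K * u) ^ 2 := by gcongr
      _ = K ^ 2 * u ^ 2 := by ring
      _ ≤ _ := by gcongr
  · have h1 : r ^ (-η) * u ^ 2 ≤ w ^ q := by
      have : r ^ (-η) ≤ 1 := Real.rpow_le_one_of_one_le_of_nonpos hr (by linarith)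
      nlinarith [sq_nonneg u]
    have h2 : r ^ η * u ^ q ≤ w ^ q := by
      rw [← hJ]
      refine mul_le_mul_of_nonneg_right (Real.rpow_le_rpow_of_exponent_le hr ?_)
        (Real.rpow_nonneg hu q)
      refine hη.trans ?_
      rw [div_le_div_iff₀ (by linarith) (by norm_num)]
      nlinarith
    have h3 : |e - l - Q| ≤ K * (w ^ q + w ^ q) :=
      he.trans (mul_le_mul_of_nonneg_left (add_le_add h1 h2) hK)
    have h4 : |l| ≤ K * w ^ q := hl.trans (mul_le_mul_of_nonneg_left (by linarith) hK)
    have h5 : |Q| ≤ K * w ^ q := hQ.trans (mul_le_mul_of_nonneg_left (by linarith) hK)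
    calc |e| = |(e - l - Q) + l + Q| := by ring_nf
      _ ≤ |e - l - Q| + |l| + |Q| := abs_add_three _ _ _
      _ ≤ _ := by linarith

/-- From l²/2 ≤ e² + (e - l)². For small jumps e - l is O(u²), so its square is absorbed by the
large-jump quantity (using q ≤ 4); for large jumps l² itself is absorbed. -/
lemma half_sq_linear_le (hK : 0 ≤ K) (hq : 2 < q) (hq3 : q ≤ 3)
    (hη : η ≤ (q - 2) ^ 2 / (2 * q))
    (hη0 : 0 < η) (hr : 1 ≤ r) (hu : 0 ≤ u)
    (he : |e - l - Q| ≤ K * (r ^ (-η) * u ^ 2 + r ^ η * u ^ q)) (hl : |l| ≤ K * u)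
    (hQ : |Q| ≤ K * u ^ 2) (hrK : 4 * K * r ^ (-((q - 2) / (2 * q))) ≤ 1) :
    l ^ 2 / 2 - 9 * K ^ 2 * (r ^ ((q - 2) / 2) * u ^ q) ≤ if |e| ≤ 1 then e ^ 2 else 0 := by
  rcases le_or_gt u (r ^ (-((q - 2) / (2 * q)))) with h | h
  · obtain ⟨hu1, h1, h2⟩ := expansion_of_small_jump hK hq hη hη0 hr hu he hl hQ h
    have hle : |e| ≤ 1 := h2.trans (le_trans (by gcongr) hrK)
    rw [if_pos hle]
    have h3 : (e - l) ^ 2 ≤ 9 * K ^ 2 * (r ^ ((q - 2) / 2) * u ^ q) := by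
      calc (e - l) ^ 2 = |e - l| ^ 2 := (sq_abs _).symm
        _ ≤ (3 * K * u ^ 2) ^ 2 := by gcongr
        _ = 9 * K ^ 2 * (1 * u ^ 4) := by ring
        _ ≤ _ := by
          have h4 : u ^ 4 ≤ u ^ q := by
            rcases hu.eq_or_lt with rfl | hu'
            · rw [Real.zero_rpow (by linarith)]; simp
            · have := Real.rpow_le_rpow_of_exponent_ge hu' hu1 (show q ≤ (4 : ℝ) by linarith)
              simpa using this
          have h5 : 1 ≤ r ^ ((q - 2) / 2) := Real.one_le_rpow hr (by linarith)
          gcongr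
    nlinarith [sq_nonneg (e + (e - l))]
  · obtain ⟨h1, h2, -⟩ := expansion_of_large_jump hK hq hη hη0 hr hu he hl hQ h
    have : l ^ 2 / 2 - 9 * K ^ 2 * (r ^ ((q - 2) / 2) * u ^ q) ≤ 0 := by
      nlinarith [sq_nonneg l, mul_nonneg (sq_nonneg K) (zero_le_one.trans h1)]
    refine this.trans ?_
    split_ifs <;> positivity

/-- The exact remainder is (H' - H)²/(H² H'). For small jumps H' ≥ H/2, giving order H⁻³, one factor
better than the first order term; for large jumps a crude bound suffices. -/
lemma inv_sub_inv_le (hK : 0 ≤ K) (hq : 2 < q)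
    (hη : η ≤ (q - 2) ^ 2 / (2 * q))
    (hη0 : 0 < η) (hr : 1 ≤ r) (hu : 0 ≤ u) {H H' : ℝ} (hH : 2 ≤ H) (hH' : 1 ≤ H')
    (he : |(H' - H) - l - Q| ≤ K * (r ^ (-η) * u ^ 2 + r ^ η * u ^ q)) (hl : |l| ≤ K * u)
    (hQ : |Q| ≤ K * u ^ 2) (hrK : 4 * K * r ^ (-((q - 2) / (2 * q))) ≤ 1) :
    H'⁻¹ - H⁻¹ ≤ -((H' - H) / H ^ 2) + 32 * K ^ 2 / H ^ 3 * u ^ 2 +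
      (1 + 4 * K) * (r ^ ((q - 2) / 2) * u ^ q) := by
  have hHp : 0 < H := by linarith
  have hH'p : 0 < H' := by linarith
  have hid : H'⁻¹ - H⁻¹ = -((H' - H) / H ^ 2) + (H' - H) ^ 2 / (H ^ 2 * H') := by
    field_simp; ring
  have hJ0 : 0 ≤ r ^ ((q - 2) / 2) * u ^ q := by positivity
  rcases le_or_gt u (r ^ (-((q - 2) / (2 * q)))) with h | h
  · obtain ⟨hu1, h1, h2⟩ := expansion_of_small_jump hK hq hη hη0 hr hu he hl hQ h
    have hle : |H' - H| ≤ 1 := h2.trans (le_trans (by gcongr) hrK)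
    have hHH : H / 2 ≤ H' := by linarith [(abs_le.1 hle).1]
    have h3 : (H' - H) ^ 2 ≤ 16 * K ^ 2 * u ^ 2 := by
      calc (H' - H) ^ 2 = |H' - H| ^ 2 := (sq_abs _).symm
        _ ≤ (4 * K * u) ^ 2 := by gcongr
        _ = _ := by ring
    have h4 : (H' - H) ^ 2 / (H ^ 2 * H') ≤ 16 * K ^ 2 * u ^ 2 / (H ^ 2 * (H / 2)) := by gcongr
    have h5 : 16 * K ^ 2 * u ^ 2 / (H ^ 2 * (H / 2)) = 32 * K ^ 2 / H ^ 3 * u ^ 2 := by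
      field_simp; ring
    rw [hid]
    nlinarith
  · obtain ⟨h1, -, h3⟩ := expansion_of_large_jump hK hq hη hη0 hr hu he hl hQ h
    have h4 : H'⁻¹ ≤ 1 := inv_le_one_of_one_le₀ hH'
    have h5 : (H' - H) / H ^ 2 ≤ |H' - H| := by
      refine (div_le_iff₀ (by positivity)).2 ?_
      have hsq : 1 ≤ H ^ 2 := by nlinarith
      exact (le_abs_self _).trans (le_mul_of_one_le_right (abs_nonneg _) hsq)
    have h6 : 0 ≤ H⁻¹ := by positivity
    have h7 : 0 ≤ 32 * K ^ 2 / H ^ 3 * u ^ 2 := by positivity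
    linarith

end Jump

/-! ### Recurrence and transience from the drift of a logarithmic function. -/

section Criteria

variable {S D : Set Plane} {κ : Kernel S S} [IsMarkovKernel κ] {q M η : ℝ}
  {h D1 D2 q11 q12 q22 : Plane → ℝ}

/-- The derivatives of order one and two in an expansion scale like those of the logarithm. -/
def LogScale (D : Set Plane) (D1 D2 q11 q12 q22 : Plane → ℝ) : Prop :=
  ∃ K : ℝ, 0 ≤ K ∧ ∀ x ∈ D, |D1 x| ≤ K / rad x ∧ |D2 x| ≤ K / rad x ∧
    |q11 x| ≤ K / rad x ^ 2 ∧ |q12 x| ≤ K / rad x ^ 2 ∧ |q22 x| ≤ K / rad x ^ 2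

lemma LogScale.parts_le {K : ℝ} (hK : 0 ≤ K) {x : Plane}
    (hb : |D1 x| ≤ K / rad x ∧ |D2 x| ≤ K / rad x ∧
      |q11 x| ≤ K / rad x ^ 2 ∧ |q12 x| ≤ K / rad x ^ 2 ∧ |q22 x| ≤ K / rad x ^ 2) (y : Plane) :
    |linPart D1 D2 x y| ≤ 3 * K * (‖y - x‖ / rad x) ∧
      |quadPart q11 q12 q22 x y| ≤ 3 * K * (‖y - x‖ / rad x) ^ 2 := by
  obtain ⟨h1, h2, h3, h4, h5⟩ := hb
  have hr := rad_pos x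
  have e0 := abs_coord_le_norm (y - x) 0
  have e1 := abs_coord_le_norm (y - x) 1
  simp only [PiLp.sub_apply] at e0 e1
  have hn := norm_nonneg (y - x)
  have e00 : |(y 0 - x 0) ^ 2| ≤ ‖y - x‖ ^ 2 := by rw [abs_pow]; gcongr
  have e11 : |(y 1 - x 1) ^ 2| ≤ ‖y - x‖ ^ 2 := by rw [abs_pow]; gcongr
  have e01 : |(y 0 - x 0) * (y 1 - x 1)| ≤ ‖y - x‖ ^ 2 := by
    rw [abs_mul, sq]; gcongr
  constructor
  · calc |linPart D1 D2 x y| ≤ |D1 x * (y 0 - x 0)| + |D2 x * (y 1 - x 1)| := abs_add_le _ _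
      _ ≤ K / rad x * ‖y - x‖ + K / rad x * ‖y - x‖ := by
          rw [abs_mul, abs_mul]; gcongr
      _ = 2 * (K * (‖y - x‖ / rad x)) := by ring
      _ ≤ _ := by
          have : 0 ≤ K * (‖y - x‖ / rad x) := by positivity
          linarith
  · calc |quadPart q11 q12 q22 x y| ≤ |q11 x * (y 0 - x 0) ^ 2| +
          |q12 x * ((y 0 - x 0) * (y 1 - x 1))| + |q22 x * (y 1 - x 1) ^ 2| := abs_add_three _ _ _
      _ ≤ K / rad x ^ 2 * ‖y - x‖ ^ 2 + K / rad x ^ 2 * ‖y - x‖ ^ 2 +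
          K / rad x ^ 2 * ‖y - x‖ ^ 2 := by
          refine add_le_add_three ?_ ?_ ?_ <;> rw [abs_mul] <;>
            exact mul_le_mul ‹_› ‹_› (abs_nonneg _) (by positivity)
      _ = _ := by rw [div_pow]; ring

lemma tendsto_log_mul_rpow_neg {a : ℝ} (ha : 0 < a) :
    Tendsto (fun r : ℝ => Real.log r * r ^ (-a)) atTop (𝓝 0) := by
  have := (isLittleO_log_rpow_atTop ha).tendsto_div_nhds_zero
  refine this.congr' ?_
  filter_upwards [eventually_gt_atTop 0] with r hr
  rw [Real.rpow_neg hr.le, div_eq_mul_inv]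

/-- Note -(q/2 + 1) = -2 - (q-2)/2: the surplus (q-2)/2 over the critical order is what defeats
powers of the logarithm later. -/
lemma rad_mul_rpow {x : Plane} {d : ℝ} (hd : 0 ≤ d) (q : ℝ) :
    rad x ^ ((q - 2) / 2) * (d / rad x) ^ q = rad x ^ (-(q / 2 + 1)) * d ^ q := by
  have hr := rad_pos x
  rw [Real.div_rpow hd hr.le, show -(q / 2 + 1) = (q - 2) / 2 - q by ring, Real.rpow_sub hr]
  field_simp

/-- Recurrence criterion for a logarithmically growing function which, far away, is strictly
superharmonic, or is almost harmonic with a nondegenerate gradient. -/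
theorem isRecurrent_of_expansion (hN : NonConfinement κ) (hS : S ⊆ D)
    (hM : MomentBound κ q M) (hM0 : 0 ≤ M) (hq : 2 < q) (hq3 : q ≤ 3) (hη0 : 0 < η)
    (hη : η ≤ (q - 2) ^ 2 / (2 * q)) (hηq : 2 * η ≤ q - 2) (hm : Measurable h)
    (hexp : HasExpansion D η q h D1 D2 q11 q12 q22) (hsc : LogScale D D1 D2 q11 q12 q22)
    {lam K₀ : ℝ} (hlam : 0 < lam) (hlog : ∀ x ∈ D, |h x - lam * Real.log (rad x)| ≤ K₀)
    {R C c : ℝ} (hc : 0 < c)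
    (hdrift : ∀ x : S, R ≤ ‖(x : Plane)‖ →
      stepDrift κ D1 D2 q11 q12 q22 x ≤ -(c * rad x ^ (-2 : ℝ)) ∨
      (stepDrift κ D1 D2 q11 q12 q22 x ≤ C * rad x ^ (-2 - η) ∧
        c * rad x ^ (-2 : ℝ) ≤ D1 x ^ 2 * secondMoment κ x 0 0 +
          2 * (D1 x * D2 x) * secondMoment κ x 0 1 + D2 x ^ 2 * secondMoment κ x 1 1))
    (x₀ : S) : IsRecurrent κ x₀ := by
  obtain ⟨K', hK', hstep⟩ := hexp.integral_step hS hM hq hηq hm hM0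
  obtain ⟨Ke, hKe, hexp⟩ := hexp
  obtain ⟨Ks, hKs, hsc⟩ := hsc
  set K := max Ke (3 * Ks) with hK
  have hK0 : 0 ≤ K := hKe.trans (le_max_left _ _)
  -- The shift makes `H ≥ 1` on `D`, so that `log H` is nonnegative; it grows like log log ‖x‖.
  set H : Plane → ℝ := fun x => h x + K₀ + 1 with hHdef
  have hH1 : ∀ x ∈ D, 1 ≤ H x := fun x hx => by
    have h1 := (abs_le.1 (hlog x hx)).1
    have h2 : 0 ≤ lam * Real.log (rad x) := mul_nonneg hlam.le (Real.log_nonneg (one_le_rad x))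
    simp only [hHdef]; linarith
  have hHle : ∀ x ∈ D, H x ≤ lam * Real.log (rad x) + (2 * K₀ + 1) := fun x hx => by
    have h1 := (abs_le.1 (hlog x hx)).2
    simp only [hHdef]; linarith
  have hHge : ∀ x ∈ D, lam * Real.log (rad x) ≤ H x := fun x hx => by
    have h1 := (abs_le.1 (hlog x hx)).1
    simp only [hHdef]; linarith
  have hHm : Measurable H := (hm.add_const _).add_const _
  have t1 : Tendsto (fun r : ℝ => K' * r ^ (-η)) atTop (𝓝 0) := by
    simpa using (tendsto_rpow_neg_atTop hη0).const_mul K'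
  have t2 : Tendsto (fun r : ℝ => 4 * K * r ^ (-((q - 2) / (2 * q)))) atTop (𝓝 0) := by
    simpa using (tendsto_rpow_neg_atTop
      (show 0 < (q - 2) / (2 * q) from div_pos (by linarith) (by linarith))).const_mul (4 * K)
  -- The drift error divided by `H`, compared with the concavity gain divided by `6 H²`, leaves one
  -- factor `H`, that is log r, against negative powers of r.
  have t3 : Tendsto (fun r : ℝ => 6 * (lam * Real.log r + (2 * K₀ + 1)) * (|C| + K') * r ^ (-η) +
      9 * K ^ 2 * M * r ^ (-((q - 2) / 2))) atTop (𝓝 0) := by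
    have a1 := (tendsto_log_mul_rpow_neg hη0).const_mul (6 * lam * (|C| + K'))
    have a2 := (tendsto_rpow_neg_atTop hη0).const_mul (6 * (2 * K₀ + 1) * (|C| + K'))
    have a3 := (tendsto_rpow_neg_atTop (show 0 < (q - 2) / 2 by linarith)).const_mul
      (9 * K ^ 2 * M)
    have := (a1.add a2).add a3
    simp only [mul_zero, add_zero] at this
    refine this.congr fun r => ?_
    ring
  obtain ⟨R', hR'⟩ := eventually_atTop.1 (((t1.eventually_le_const hc).and
    (t2.eventually_le_const one_pos)).and (t3.eventually_le_const (half_pos hc)))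
  have hVint : ∀ x : S, Integrable (fun y : S => Real.log (H y)) (κ x) := fun x => by
    refine Integrable.mono' (((hstep x).1.add (integrable_const K₀)).add (integrable_const 1))
      ((Real.measurable_log.comp (hHm.comp measurable_subtype_coe)).aestronglyMeasurable)
      (ae_of_all _ fun y => ?_)
    have h1 := hH1 y (hS y.2)
    rw [Real.norm_of_nonneg (Real.log_nonneg h1)]
    have := Real.log_le_sub_one_of_pos (show 0 < H y by linarith)
    simp only [Pi.add_apply]
    simp only [hHdef] at this ⊢
    linarith
  refine isRecurrent_of_lyapunov κ hN (V := fun x : S => Real.log (H x))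
    (Real.measurable_log.comp (hHm.comp measurable_subtype_coe))
    (fun x => Real.log_nonneg (hH1 x (hS x.2))) ?_ (R := max R R') (fun x _ => hVint x) ?_ x₀
  · intro B
    refine ⟨Real.exp (Real.exp B / lam), fun x hx => ?_⟩
    have h1 : Real.exp B ≤ H x := by
      refine le_trans ?_ (hHge x (hS x.2))
      rw [← div_le_iff₀' hlam, Real.le_log_iff_exp_le (rad_pos _)]
      exact hx.trans (le_add_of_nonneg_left zero_le_one)
    exact (Real.le_log_iff_exp_le (by linarith [Real.exp_pos B])).2 h1
  · intro x hx
    have hxR := hdrift x ((le_max_left _ _).trans hx)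
    have hr0 := rad_pos (x : Plane)
    have hr1 := one_le_rad (x : Plane)
    obtain ⟨⟨b1, b2⟩, b3⟩ := hR' (rad x) ((le_max_right R R').trans
      (hx.trans (le_add_of_nonneg_left zero_le_one)))
    set r := rad (x : Plane) with hr
    have hHx := hH1 x (hS x.2)
    have hHp : 0 < H x := by linarith
    have hfint : Integrable (fun y : S => H y - H x) (κ x) := by
      refine ((hstep x).1.sub (integrable_const (h x))).congr (ae_of_all _ fun y => ?_)
      simp [hHdef]
    have hEe : ∫ y : S, (H y - H x) ∂(κ x) ≤
        stepDrift κ D1 D2 q11 q12 q22 x + K' * r ^ (-2 - η) := by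
      have h1 := (abs_le.1 (hstep x).2).2
      have h2 : ∀ y : S, H y - H x = h y - h x := fun y => by simp [hHdef]
      simp only [h2]
      linarith
    have hpow : r ^ (-2 - η) = r ^ (-2 : ℝ) * r ^ (-η) := by
      rw [← Real.rpow_add hr0]; ring_nf
    have hr2 : 0 < r ^ (-2 : ℝ) := Real.rpow_pos_of_pos hr0 _
    suffices hsuff : ∫ y : S, (Real.log (H y) - Real.log (H x)) ∂(κ x) ≤ 0 by
      rw [integral_sub (hVint x) (integrable_const _)] at hsuff
      simpa using hsuff
    have hlint : Integrable (fun y : S => Real.log (H y) - Real.log (H x)) (κ x) :=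
      (hVint x).sub (integrable_const _)
    rcases hxR with hA | ⟨hB, hBg⟩
    -- A strictly negative drift needs no second order gain, so `G = 0` is enough.
    · refine (integral_mono hlint (hfint.div_const (H x)) fun y => ?_).trans ?_
      · have := log_sub_log_le hHx (hH1 y (hS y.2)) (G := 0) (by split_ifs <;> positivity)
        simpa using this
      · rw [integral_div]
        refine div_nonpos_of_nonpos_of_nonneg ?_ hHp.le
        refine hEe.trans ?_
        rw [hpow]
        nlinarith
    -- The minorant of the truncated squared jump from `half_sq_linear_le`; the nondegenerate
    -- gradient makes its mean at least (c/2) r⁻² up to a smaller power.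
    · set G : S → ℝ := fun y => linPart D1 D2 x y ^ 2 / 2 -
        9 * K ^ 2 * (r ^ (-(q / 2 + 1)) * ‖(y : Plane) - x‖ ^ q) with hG
      have hl2 := hM.integral_linPart_sq (D1 := D1) (D2 := D2) hq x
      have hGint : Integrable G (κ x) :=
        (hl2.1.div_const 2).sub (((hM x).1.const_mul _).const_mul _)
      have hGE : c * r ^ (-2 : ℝ) / 2 - 9 * K ^ 2 * (r ^ (-(q / 2 + 1)) * M) ≤
          ∫ y, G y ∂(κ x) := by
        rw [hG, integral_sub (hl2.1.div_const 2) (((hM x).1.const_mul _).const_mul _),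
          integral_div, hl2.2, integral_const_mul, integral_const_mul]
        have : r ^ (-(q / 2 + 1)) * ∫ y : S, ‖(y : Plane) - x‖ ^ q ∂(κ x) ≤
          r ^ (-(q / 2 + 1)) * M := by gcongr; exact (hM x).2
        have h9 : 0 ≤ 9 * K ^ 2 := by positivity
        nlinarith [mul_le_mul_of_nonneg_left this h9]
      refine (integral_mono hlint ((hfint.div_const (H x)).sub (hGint.div_const (6 * H x ^ 2)))
        fun y => ?_).trans ?_
      · refine log_sub_log_le hHx (hH1 y (hS y.2)) ?_
        have hparts := LogScale.parts_le hKs (hsc x (hS x.2)) y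
        have hu0 : 0 ≤ ‖(y : Plane) - x‖ / r := by positivity
        rw [hG]
        simp only
        rw [← rad_mul_rpow (norm_nonneg _)]
        refine half_sq_linear_le (e := H y - H x) (Q := quadPart q11 q12 q22 x y) hK0 hq hq3 hη
          hη0 hr1 hu0 ?_ (hparts.1.trans ?_) (hparts.2.trans ?_) b2
        · have h1 := hexp x (hS x.2) y (hS y.2)
          have h2 : H y - H x = h y - h x := by simp [hHdef]
          rw [h2]
          refine h1.trans (mul_le_mul_of_nonneg_right (le_max_left _ _) (by positivity))
        · exact mul_le_mul_of_nonneg_right (le_max_right _ _) hu0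
        · exact mul_le_mul_of_nonneg_right (le_max_right _ _) (by positivity)
      · simp only [Pi.sub_apply]
        rw [integral_sub (hfint.div_const (H x)) (hGint.div_const (6 * H x ^ 2)), integral_div,
          integral_div]
        have hH6 : 0 < 6 * H x ^ 2 := by positivity
        have e1 : (∫ y : S, (H y - H x) ∂(κ x)) / H x ≤ (|C| + K') * r ^ (-2 - η) / H x := by
          gcongr
          have : C * r ^ (-2 - η) ≤ |C| * r ^ (-2 - η) := by gcongr; exact le_abs_self C
          linarith
        have e2 : (c * r ^ (-2 : ℝ) / 2 - 9 * K ^ 2 * (r ^ (-(q / 2 + 1)) * M)) / (6 * H x ^ 2) ≤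
          (∫ y, G y ∂(κ x)) / (6 * H x ^ 2) := by gcongr
        have e3 : (|C| + K') * r ^ (-2 - η) / H x ≤
            (c * r ^ (-2 : ℝ) / 2 - 9 * K ^ 2 * (r ^ (-(q / 2 + 1)) * M)) / (6 * H x ^ 2) := by
          rw [div_le_div_iff₀ hHp hH6]
          have hpow2 : r ^ (-(q / 2 + 1)) = r ^ (-2 : ℝ) * r ^ (-((q - 2) / 2)) := by
            rw [← Real.rpow_add hr0]; ring_nf
          rw [hpow, hpow2]
          have hHl := hHle x (hS x.2)
          have hCK : 0 ≤ (|C| + K') * r ^ (-η) := by positivity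
          have e4 : 6 * H x * ((|C| + K') * r ^ (-η)) ≤
              c / 2 - 9 * K ^ 2 * M * r ^ (-((q - 2) / 2)) := by
            have := mul_le_mul_of_nonneg_right hHl hCK
            linarith
          calc _ = 6 * H x * ((|C| + K') * r ^ (-η)) * (r ^ (-2 : ℝ) * H x) := by ring
            _ ≤ (c / 2 - 9 * K ^ 2 * M * r ^ (-((q - 2) / 2))) * (r ^ (-2 : ℝ) * H x) :=
              mul_le_mul_of_nonneg_right e4 (mul_pos hr2 hHp).le
            _ = _ := by ring
        linarith

/-- Transience criterion for a logarithmically growing function which is strictly subharmonic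
far away. -/
theorem isTransient_of_expansion (hN : NonConfinement κ) (hS : S ⊆ D)
    (hM : MomentBound κ q M) (hM0 : 0 ≤ M) (hq : 2 < q) (hη0 : 0 < η)
    (hη : η ≤ (q - 2) ^ 2 / (2 * q)) (hηq : 2 * η ≤ q - 2) (hm : Measurable h)
    (hexp : HasExpansion D η q h D1 D2 q11 q12 q22) (hsc : LogScale D D1 D2 q11 q12 q22)
    {lam K₀ : ℝ} (hlam : 0 < lam) (hlog : ∀ x ∈ D, |h x - lam * Real.log (rad x)| ≤ K₀)
    {R c : ℝ} (hc : 0 < c)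
    (hdrift : ∀ x : S, R ≤ ‖(x : Plane)‖ →
      c * rad x ^ (-2 : ℝ) ≤ stepDrift κ D1 D2 q11 q12 q22 x)
    (x₀ : S) : IsTransient κ x₀ := by
  obtain ⟨K', hK', hstep⟩ := hexp.integral_step hS hM hq hηq hm hM0
  obtain ⟨Ke, hKe, hexp⟩ := hexp
  obtain ⟨Ks, hKs, hsc⟩ := hsc
  set K := max Ke (3 * Ks) with hK
  have hK0 : 0 ≤ K := hKe.trans (le_max_left _ _)
  set H : Plane → ℝ := fun x => h x + K₀ + 1 with hHdef
  have hH1 : ∀ x ∈ D, 1 ≤ H x := fun x hx => by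
    have h1 := (abs_le.1 (hlog x hx)).1
    have h2 : 0 ≤ lam * Real.log (rad x) := mul_nonneg hlam.le (Real.log_nonneg (one_le_rad x))
    simp only [hHdef]; linarith
  have hHle : ∀ x ∈ D, H x ≤ lam * Real.log (rad x) + (2 * K₀ + 1) := fun x hx => by
    have h1 := (abs_le.1 (hlog x hx)).2
    simp only [hHdef]; linarith
  have hHge : ∀ x ∈ D, lam * Real.log (rad x) ≤ H x := fun x hx => by
    have h1 := (abs_le.1 (hlog x hx)).1
    simp only [hHdef]; linarith
  have hHm : Measurable H := (hm.add_const _).add_const _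
  have t1 : Tendsto (fun r : ℝ => K' * r ^ (-η)) atTop (𝓝 0) := by
    simpa using (tendsto_rpow_neg_atTop hη0).const_mul K'
  have t2 : Tendsto (fun r : ℝ => 4 * K * r ^ (-((q - 2) / (2 * q)))) atTop (𝓝 0) := by
    simpa using (tendsto_rpow_neg_atTop
      (show 0 < (q - 2) / (2 * q) from div_pos (by linarith) (by linarith))).const_mul (4 * K)
  have t3 : Tendsto (fun r : ℝ => (1 + 4 * K) * M *
      ((lam * Real.log r + (2 * K₀ + 1)) ^ 2 * r ^ (-((q - 2) / 2)))) atTop (𝓝 0) := by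
    have hk : 0 < (q - 2) / 4 := by linarith
    have a1 := ((tendsto_log_mul_rpow_neg hk).const_mul lam).add
      ((tendsto_rpow_neg_atTop hk).const_mul (2 * K₀ + 1))
    simp only [mul_zero, add_zero] at a1
    have a2 := ((a1.mul a1).const_mul ((1 + 4 * K) * M))
    simp only [mul_zero] at a2
    refine a2.congr' ?_
    filter_upwards [eventually_gt_atTop 0] with r hr
    have : r ^ (-((q - 2) / 2)) = r ^ (-((q - 2) / 4)) * r ^ (-((q - 2) / 4)) := by
      rw [← Real.rpow_add hr]; ring_nf
    rw [this]; ring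
  have t4 : Tendsto (fun r : ℝ => lam * Real.log r) atTop atTop :=
    Real.tendsto_log_atTop.const_mul_atTop hlam
  -- The drift is c r⁻²/H². The expansion error, the H⁻³ term and the large jumps each consume at
  -- most a quarter of it; the last threshold makes `H` large enough for the H⁻³ term.
  obtain ⟨R', hR'⟩ := eventually_atTop.1 ((((t1.eventually_le_const (show 0 < c / 4 by linarith)).and
    (t2.eventually_le_const one_pos)).and (t3.eventually_le_const (show 0 < c / 4 by linarith))).and
    ((t4.eventually_ge_atTop 2).and (t4.eventually_ge_atTop (32 * K ^ 2 * (1 + M) * (4 / c)))))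
  refine isTransient_of_lyapunov κ hN (V := fun x : S => (H x)⁻¹)
    (hHm.comp measurable_subtype_coe).inv
    (fun x => inv_le_one_of_one_le₀ (hH1 x (hS x.2)))
    (fun x => inv_pos.2 (by linarith [hH1 x (hS x.2)])) ?_ ?_ (R := max R R') ?_ x₀
  · intro ε hε
    refine ⟨Real.exp (ε⁻¹ / lam), fun x hx => ?_⟩
    have h1 : ε⁻¹ ≤ H x := by
      refine le_trans ?_ (hHge x (hS x.2))
      rw [← div_le_iff₀' hlam, Real.le_log_iff_exp_le (rad_pos _)]
      exact hx.trans (le_add_of_nonneg_left zero_le_one)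
    exact inv_le_of_inv_le₀ hε h1
  · intro B
    refine ⟨(lam * Real.log (1 + |B|) + (2 * |K₀| + 1))⁻¹, ?_, fun x hx => ?_⟩
    · have : 0 ≤ lam * Real.log (1 + |B|) :=
        mul_nonneg hlam.le (Real.log_nonneg (by linarith [abs_nonneg B]))
      positivity
    · refine inv_anti₀ (by linarith [hH1 x (hS x.2)]) ((hHle x (hS x.2)).trans ?_)
      have : Real.log (rad x) ≤ Real.log (1 + |B|) :=
        Real.log_le_log (rad_pos _) (add_le_add le_rfl (hx.trans (le_abs_self B)))
      nlinarith [le_abs_self K₀]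
  · intro x hx
    have hxR := hdrift x ((le_max_left _ _).trans hx)
    have hr0 := rad_pos (x : Plane)
    have hr1 := one_le_rad (x : Plane)
    obtain ⟨⟨⟨b1, b2⟩, b3⟩, b4, b5⟩ := hR' (rad x) ((le_max_right R R').trans
      (hx.trans (le_add_of_nonneg_left zero_le_one)))
    set r := rad (x : Plane) with hr
    have hHge' := hHge x (hS x.2)
    have hHx2 : 2 ≤ H x := b4.trans hHge'
    have hHp : 0 < H x := by linarith
    have hfint : Integrable (fun y : S => H y - H x) (κ x) := by
      refine ((hstep x).1.sub (integrable_const (h x))).congr (ae_of_all _ fun y => ?_)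
      simp [hHdef]
    have hEe : stepDrift κ D1 D2 q11 q12 q22 x - K' * r ^ (-2 - η) ≤
        ∫ y : S, (H y - H x) ∂(κ x) := by
      have h1 := (abs_le.1 (hstep x).2).1
      have h2 : ∀ y : S, H y - H x = h y - h x := fun y => by simp [hHdef]
      simp only [h2]
      linarith
    have hpow : r ^ (-2 - η) = r ^ (-2 : ℝ) * r ^ (-η) := by
      rw [← Real.rpow_add hr0]; ring_nf
    have hr2 : 0 < r ^ (-2 : ℝ) := Real.rpow_pos_of_pos hr0 _
    have hVint : Integrable (fun y : S => (H y)⁻¹) (κ x) := by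
      refine Integrable.of_bound (hHm.comp measurable_subtype_coe).inv.aestronglyMeasurable 1
        (ae_of_all _ fun y => ?_)
      have h1 := hH1 y (hS y.2)
      rw [Real.norm_of_nonneg (inv_nonneg.2 (by linarith))]
      exact inv_le_one_of_one_le₀ h1
    suffices hsuff : ∫ y : S, ((H y)⁻¹ - (H x)⁻¹) ∂(κ x) ≤ 0 by
      rw [integral_sub hVint (integrable_const _)] at hsuff
      simpa using hsuff
    have i1 : Integrable (fun y : S => -((H y - H x) / H x ^ 2)) (κ x) :=
      (hfint.div_const _).neg
    have i2 : Integrable (fun y : S => 32 * K ^ 2 / H x ^ 3 * (‖(y : Plane) - x‖ ^ 2 / r ^ 2))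
      (κ x) := ((hM.integrable_sq hq x).div_const _).const_mul _
    have i3 : Integrable (fun y : S => (1 + 4 * K) *
      (r ^ (-(q / 2 + 1)) * ‖(y : Plane) - x‖ ^ q)) (κ x) := (((hM x).1.const_mul _).const_mul _)
    refine (integral_mono (hVint.sub (integrable_const _)) ((i1.add i2).add i3)
      fun y => ?_).trans ?_
    · have hparts := LogScale.parts_le hKs (hsc x (hS x.2)) y
      have hu0 : 0 ≤ ‖(y : Plane) - x‖ / r := by positivity
      simp only [Pi.add_apply]
      rw [← rad_mul_rpow (norm_nonneg _), ← div_pow]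
      refine inv_sub_inv_le (l := linPart D1 D2 x y) (Q := quadPart q11 q12 q22 x y) hK0 hq hη
        hη0 hr1 hu0 hHx2 (hH1 y (hS y.2)) ?_ (hparts.1.trans ?_) (hparts.2.trans ?_) b2
      · have h1 := hexp x (hS x.2) y (hS y.2)
        have h2 : H y - H x = h y - h x := by simp [hHdef]
        rw [h2]
        refine h1.trans (mul_le_mul_of_nonneg_right (le_max_left _ _) (by positivity))
      · exact mul_le_mul_of_nonneg_right (le_max_right _ _) hu0
      · exact mul_le_mul_of_nonneg_right (le_max_right _ _) (by positivity)
    · have e0 := integral_add (i1.add i2) i3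
      have e1 := integral_add i1 i2
      simp only [Pi.add_apply] at e0 e1 ⊢
      rw [e0, e1, integral_neg, integral_div, integral_const_mul, integral_div, integral_const_mul,
        integral_const_mul]
      have hHl := hHle x (hS x.2)
      have f1 : c * r ^ (-2 : ℝ) - K' * r ^ (-2 - η) ≤ ∫ y : S, (H y - H x) ∂(κ x) := by linarith
      have f2 : (3 * c / 4) * r ^ (-2 : ℝ) ≤ ∫ y : S, (H y - H x) ∂(κ x) := by
        rw [hpow] at f1; nlinarith
      have f3 : (3 * c / 4) * r ^ (-2 : ℝ) / H x ^ 2 ≤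
          (∫ y : S, (H y - H x) ∂(κ x)) / H x ^ 2 := by gcongr
      have hrr : r ^ (-2 : ℝ) = (r ^ 2)⁻¹ := by
        rw [Real.rpow_neg hr0.le]; simp
      have f4 : 32 * K ^ 2 / H x ^ 3 * ((∫ y : S, ‖(y : Plane) - x‖ ^ 2 ∂(κ x)) / r ^ 2) ≤
          (c / 4) * r ^ (-2 : ℝ) / H x ^ 2 := by
        have g1 : 32 * K ^ 2 * (1 + M) ≤ (c / 4) * H x := by
          have := b5.trans hHge'
          rw [← mul_div_assoc, div_le_iff₀ hc] at this
          linarith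
        calc _ ≤ 32 * K ^ 2 / H x ^ 3 * ((1 + M) / r ^ 2) := by
              gcongr; exact hM.integral_sq_le hq x
          _ = (32 * K ^ 2 * (1 + M)) * (r ^ 2)⁻¹ / H x ^ 3 := by field_simp
          _ ≤ ((c / 4) * H x) * (r ^ 2)⁻¹ / H x ^ 3 := by gcongr
          _ = _ := by rw [hrr]; field_simp
      have f5 : (1 + 4 * K) * (r ^ (-(q / 2 + 1)) * ∫ y : S, ‖(y : Plane) - x‖ ^ q ∂(κ x)) ≤
          (c / 4) * r ^ (-2 : ℝ) / H x ^ 2 := by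
        have hpow2 : r ^ (-(q / 2 + 1)) = r ^ (-2 : ℝ) * r ^ (-((q - 2) / 2)) := by
          rw [← Real.rpow_add hr0]; ring_nf
        have hle : r ^ (-(q / 2 + 1)) * ∫ y : S, ‖(y : Plane) - x‖ ^ q ∂(κ x) ≤
          r ^ (-(q / 2 + 1)) * M := by gcongr; exact (hM x).2
        rw [le_div_iff₀ (by positivity)]
        have hHsq : H x ^ 2 ≤ (lam * Real.log r + (2 * K₀ + 1)) ^ 2 := by gcongr
        calc _ ≤ (1 + 4 * K) * (r ^ (-(q / 2 + 1)) * M) *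
              (lam * Real.log r + (2 * K₀ + 1)) ^ 2 := by gcongr
          _ = ((1 + 4 * K) * M * ((lam * Real.log r + (2 * K₀ + 1)) ^ 2 *
              r ^ (-((q - 2) / 2)))) * r ^ (-2 : ℝ) := by rw [hpow2]; ring
          _ ≤ _ := by gcongr
      have f6 : (3 * c / 4) * r ^ (-2 : ℝ) / H x ^ 2 = 3 * ((c / 4) * r ^ (-2 : ℝ) / H x ^ 2) := by
        ring
      have f7 : 0 ≤ (c / 4) * r ^ (-2 : ℝ) / H x ^ 2 := by positivity
      linarith

end Criteria

/-! ### Taylor bounds for powers and logarithms. -/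

lemma one_add_rpow_le {b s : ℝ} (hs : |s| ≤ 1 / 2) : (1 + s) ^ b ≤ 2 ^ |b| := by
  obtain ⟨h1, h2⟩ := abs_le.1 hs
  have h0 : 0 < 1 + s := by linarith
  rcases le_total 0 b with hb | hb
  · rw [abs_of_nonneg hb]
    exact Real.rpow_le_rpow h0.le (by linarith) hb
  · rw [abs_of_nonpos hb]
    calc (1 + s) ^ b ≤ (1 / 2 : ℝ) ^ b :=
          Real.rpow_le_rpow_of_nonpos (by norm_num) (by linarith) hb
      _ = 2 ^ (-b) := by
          rw [Real.rpow_neg (by norm_num), one_div, Real.inv_rpow (by norm_num)]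

lemma hasDerivAt_one_add_rpow {b s : ℝ} (hs : 0 < 1 + s) :
    HasDerivAt (fun s : ℝ => (1 + s) ^ b) (b * (1 + s) ^ (b - 1)) s := by
  have := ((hasDerivAt_id s).const_add 1).rpow_const (p := b) (Or.inl hs.ne')
  simpa using this

lemma abs_one_add_rpow_sub_one_le (b : ℝ) {s : ℝ} (hs : |s| ≤ 1 / 2) :
    |(1 + s) ^ b - 1| ≤ |b| * 2 ^ |b - 1| * |s| := by
  have hconv : Convex ℝ (Set.Icc (-(1 / 2) : ℝ) (1 / 2)) := convex_Icc _ _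
  have h := hconv.norm_image_sub_le_of_norm_hasDerivWithin_le
    (f := fun s : ℝ => (1 + s) ^ b) (f' := fun s => b * (1 + s) ^ (b - 1))
    (C := |b| * 2 ^ |b - 1|) (x := 0) (y := s)
    (fun x hx => (hasDerivAt_one_add_rpow (by linarith [hx.1])).hasDerivWithinAt)
    (fun x hx => by
      have h0 : 0 < 1 + x := by linarith [hx.1]
      rw [Real.norm_eq_abs, abs_mul, abs_of_nonneg (Real.rpow_nonneg h0.le _)]
      gcongr
      exact one_add_rpow_le (abs_le.2 hx)) (by norm_num) (abs_le.1 hs)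
  simpa using h

/-- First order Taylor bound for a real power. -/
lemma abs_one_add_rpow_sub_sub_le (a : ℝ) : ∃ K : ℝ, 0 ≤ K ∧ ∀ s : ℝ, |s| ≤ 1 / 2 →
    |(1 + s) ^ a - 1 - a * s| ≤ K * s ^ 2 := by
  refine ⟨|a| * (|a - 1| * 2 ^ |a - 1 - 1|), by positivity, fun s hs => ?_⟩
  have hconv : Convex ℝ (Set.Icc (-|s|) |s|) := convex_Icc _ _
  have hmem : ∀ x ∈ Set.Icc (-|s|) |s|, |x| ≤ 1 / 2 := fun x hx => (abs_le.2 hx).trans hs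
  have h := hconv.norm_image_sub_le_of_norm_hasDerivWithin_le
    (f := fun s : ℝ => (1 + s) ^ a - a * s) (f' := fun s => a * (1 + s) ^ (a - 1) - a * 1)
    (C := |a| * (|a - 1| * 2 ^ |a - 1 - 1| * |s|)) (x := 0) (y := s)
    (fun x hx => ((hasDerivAt_one_add_rpow (by linarith [(abs_le.1 (hmem x hx)).1])).sub
      ((hasDerivAt_id x).const_mul a)).hasDerivWithinAt)
    (fun x hx => by
      rw [← mul_sub, Real.norm_eq_abs, abs_mul]
      gcongr
      exact (abs_one_add_rpow_sub_one_le (a - 1) (hmem x hx)).trans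
        (mul_le_mul_of_nonneg_left (abs_le.2 hx) (by positivity))) (by simp) (abs_le.1 le_rfl)
  simp only [Real.norm_eq_abs, add_zero, Real.one_rpow, mul_zero, sub_zero] at h
  calc |(1 + s) ^ a - 1 - a * s| = |(1 + s) ^ a - a * s - 1| := by ring_nf
    _ ≤ _ := h
    _ = |a| * (|a - 1| * 2 ^ |a - 1 - 1|) * |s| ^ 2 := by ring
    _ = _ := by rw [sq_abs]

lemma abs_add_rpow_sub_sub_le (a : ℝ) : ∃ K : ℝ, 0 ≤ K ∧ ∀ t d : ℝ, 0 < t → |d| ≤ t / 2 →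
    |(t + d) ^ a - t ^ a - a * t ^ (a - 1) * d| ≤ K * t ^ a * (d / t) ^ 2 := by
  obtain ⟨K, hK, h⟩ := abs_one_add_rpow_sub_sub_le a
  refine ⟨K, hK, fun t d ht hd => ?_⟩
  have hs : |d / t| ≤ 1 / 2 := by
    rw [abs_div, abs_of_pos ht, div_le_iff₀ ht]; linarith
  have h0 : 0 ≤ 1 + d / t := by linarith [(abs_le.1 hs).1]
  have h1 : (t + d) ^ a = t ^ a * (1 + d / t) ^ a := by
    rw [← Real.mul_rpow ht.le h0]; congr 1; field_simp
  have h2 : (t + d) ^ a - t ^ a - a * t ^ (a - 1) * d =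
      t ^ a * ((1 + d / t) ^ a - 1 - a * (d / t)) := by
    rw [h1, Real.rpow_sub_one ht.ne']; field_simp
  rw [h2, abs_mul, abs_of_nonneg (Real.rpow_nonneg ht.le a)]
  calc _ ≤ t ^ a * (K * (d / t) ^ 2) := by gcongr; exact h _ hs
    _ = _ := by ring

/-- The tail of the power series is geometric with ratio at most 1/2, hence the factor 2. -/
lemma abs_log_one_add_sub_le {s : ℝ} (hs : |s| ≤ 1 / 2) :
    |Real.log (1 + s) - s + s ^ 2 / 2| ≤ 2 * |s| ^ 3 := by
  have h := Real.abs_log_sub_add_sum_range_le (x := -s) (by rw [abs_neg]; linarith) 2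
  simp only [Finset.sum_range_succ, Finset.sum_range_zero, abs_neg] at h
  have h1 : |s| ^ (2 + 1) / (1 - |s|) ≤ 2 * |s| ^ 3 := by
    rw [div_le_iff₀ (by linarith)]
    norm_num
    nlinarith [mul_nonneg (pow_nonneg (abs_nonneg s) 3) (sub_nonneg.2 hs)]
  refine le_trans (le_of_eq ?_) (h.trans h1)
  congr 1
  norm_num
  ring

lemma pow_le_rpow_of_le_one {u q : ℝ} (hu : 0 ≤ u) (hu1 : u ≤ 1) (hq0 : 0 < q) {n : ℕ}
    (hq : q ≤ n) : u ^ n ≤ u ^ q := by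
  rcases hu.eq_or_lt with rfl | hu'
  · rw [Real.zero_rpow hq0.ne']
    have : n ≠ 0 := by rintro rfl; norm_num at hq; linarith
    simp [this]
  · have := Real.rpow_le_rpow_of_exponent_ge hu' hu1 hq
    simpa using this

/-! ### From local Taylor bounds to global expansions. -/

/-- A Taylor estimate for jumps that are small compared with a scale `τ` and a crude bound for all
jumps give a global expansion. -/
lemma hasExpansion_of_scale {D : Set Plane} {η q : ℝ} {f D1 D2 q11 q12 q22 τ : Plane → ℝ}
    {L k : ℝ} (hL : 1 ≤ L) (hk0 : 0 < k) (hk1 : k ≤ 1)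
    (hτ : ∀ x ∈ D, 1 ≤ τ x ∧ τ x ≤ L * rad x ∧ rad x ≤ L * τ x)
    (hη0 : 0 < η) (hη1 : η ≤ 1) (hq : 2 < q) (hq3 : q ≤ 3)
    (hloc : ∃ K : ℝ, ∀ x ∈ D, ∀ y ∈ D, ‖y - x‖ ≤ k * τ x →
      |f y - f x - linPart D1 D2 x y - quadPart q11 q12 q22 x y| ≤
        K * (τ x ^ (-η) * (‖y - x‖ / τ x) ^ 2 + (‖y - x‖ / τ x) ^ 3))
    (hglob : ∃ K : ℝ, ∀ x ∈ D, ∀ y ∈ D,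
      |f y - f x| ≤ K * (1 + Real.log (τ x) + ‖y - x‖ / τ x))
    (hsc : ∃ K : ℝ, ∀ x ∈ D, |D1 x| ≤ K / τ x ∧ |D2 x| ≤ K / τ x ∧ |q11 x| ≤ K / τ x ^ 2 ∧
      |q12 x| ≤ K / τ x ^ 2 ∧ |q22 x| ≤ K / τ x ^ 2) :
    HasExpansion D η q f D1 D2 q11 q12 q22 ∧ LogScale D D1 D2 q11 q12 q22 := by
  have hL0 : 0 < L := by linarith
  have hscale : LogScale D D1 D2 q11 q12 q22 := by
    obtain ⟨K, hK⟩ := hsc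
    refine ⟨|K| * L ^ 2, by positivity, fun x hx => ?_⟩
    obtain ⟨h1, h2, h3⟩ := hτ x hx
    have hr := rad_pos x
    have ht : 0 < τ x := by linarith
    have e1 : K / τ x ≤ |K| * L ^ 2 / rad x := by
      rw [div_le_div_iff₀ ht hr]
      calc K * rad x ≤ |K| * (L * τ x) :=
            mul_le_mul (le_abs_self K) h3 hr.le (abs_nonneg K)
        _ ≤ |K| * (L ^ 2 * τ x) := by gcongr; nlinarith
        _ = _ := by ring
    have e2 : K / τ x ^ 2 ≤ |K| * L ^ 2 / rad x ^ 2 := by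
      rw [div_le_div_iff₀ (by positivity) (by positivity)]
      calc K * rad x ^ 2 ≤ |K| * (L * τ x) ^ 2 :=
            mul_le_mul (le_abs_self K) (by gcongr) (by positivity) (abs_nonneg K)
        _ = _ := by ring
    obtain ⟨g1, g2, g3, g4, g5⟩ := hK x hx
    exact ⟨g1.trans e1, g2.trans e1, g3.trans e2, g4.trans e2, g5.trans e2⟩
  refine ⟨?_, hscale⟩
  obtain ⟨Kl, hloc⟩ := hloc
  obtain ⟨Kg, hglob⟩ := hglob
  obtain ⟨Ks, hKs, hsc⟩ := hscale
  refine ⟨|Kl| * L ^ 3 + (|Kg| * (1 + (L + η⁻¹) + L) + 3 * Ks + 3 * Ks) * (L / k) ^ q,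
    by positivity, fun x hx y hy => ?_⟩
  obtain ⟨h1, h2, h3⟩ := hτ x hx
  have hr := rad_pos x
  have hr1 := one_le_rad x
  have ht : 0 < τ x := by linarith
  set u := ‖y - x‖ / rad x with hu
  have hu0 : 0 ≤ u := by positivity
  have hsu : ‖y - x‖ / τ x ≤ L * u := by
    rw [hu, ← mul_div_assoc, div_le_div_iff₀ ht hr]
    calc ‖y - x‖ * rad x ≤ ‖y - x‖ * (L * τ x) := by gcongr
      _ = _ := by ring
  have hrη : 1 ≤ rad x ^ η := Real.one_le_rpow hr1 hη0.le
  rcases le_or_gt ‖y - x‖ (k * τ x) with hc | hc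
  · have hs1 : ‖y - x‖ / τ x ≤ 1 := by
      rw [div_le_one ht]; nlinarith
    refine (hloc x hx y hy hc).trans ?_
    have e1 : τ x ^ (-η) ≤ L * rad x ^ (-η) := by
      calc τ x ^ (-η) ≤ (rad x / L) ^ (-η) := by
            refine Real.rpow_le_rpow_of_nonpos (by positivity) ?_ (by linarith)
            rw [div_le_iff₀ hL0]; linarith
        _ = L ^ η * rad x ^ (-η) := by
            rw [Real.div_rpow hr.le hL0.le, Real.rpow_neg hL0.le]; field_simp
        _ ≤ L ^ (1 : ℝ) * rad x ^ (-η) := by gcongr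
        _ = _ := by rw [Real.rpow_one]
    -- The relative jump is at most 1 here, so `q ≤ 3` lets the cubic remainder pass into the
    -- large-jump term.
    have e2 : (‖y - x‖ / τ x) ^ 3 ≤ L ^ 3 * (rad x ^ η * u ^ q) := by
      calc (‖y - x‖ / τ x) ^ 3 ≤ (‖y - x‖ / τ x) ^ q :=
            pow_le_rpow_of_le_one (by positivity) hs1 (by linarith) (by exact_mod_cast hq3)
        _ ≤ (L * u) ^ q := Real.rpow_le_rpow (by positivity) hsu (by linarith)
        _ = L ^ q * u ^ q := Real.mul_rpow hL0.le hu0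
        _ ≤ L ^ (3 : ℝ) * (1 * u ^ q) := by rw [one_mul]; gcongr
        _ ≤ L ^ 3 * (rad x ^ η * u ^ q) := by
            rw [show ((3 : ℝ)) = ((3 : ℕ) : ℝ) by norm_num, Real.rpow_natCast]; gcongr
    have e3 : τ x ^ (-η) * (‖y - x‖ / τ x) ^ 2 ≤ L ^ 3 * (rad x ^ (-η) * u ^ 2) := by
      calc _ ≤ (L * rad x ^ (-η)) * (L * u) ^ 2 := by gcongr
        _ = _ := by ring
    calc _ ≤ |Kl| * (L ^ 3 * (rad x ^ (-η) * u ^ 2) + L ^ 3 * (rad x ^ η * u ^ q)) :=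
          mul_le_mul (le_abs_self Kl) (add_le_add e3 e2) (by positivity) (abs_nonneg Kl)
      _ = |Kl| * L ^ 3 * (rad x ^ (-η) * u ^ 2 + rad x ^ η * u ^ q) := by ring
      _ ≤ _ := by
          refine mul_le_mul_of_nonneg_right (le_add_of_nonneg_right ?_) (by positivity)
          positivity
  -- Past the Taylor range `w ≥ 1`, and the increment of `f`, the linear part and the quadratic part
  -- are each bounded separately by rad^η w^q.
  · set w := L / k * u with hw
    have hLk : 1 ≤ L / k := by rw [le_div_iff₀ hk0]; linarith
    have hw1 : 1 ≤ w := by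
      have e1 : k ≤ L * u := by
        refine le_trans ?_ hsu
        rw [le_div_iff₀ ht]; exact hc.le
      rw [hw, div_mul_eq_mul_div, le_div_iff₀ hk0]; linarith
    have huw : u ≤ w := by rw [hw]; nlinarith
    have hwq : w ^ 2 ≤ w ^ q := by
      have := Real.rpow_le_rpow_of_exponent_le hw1 hq.le
      simpa using this
    have hwq1 : w ≤ w ^ q := by nlinarith
    have hX : w ^ q ≤ rad x ^ η * w ^ q := le_mul_of_one_le_left (by positivity) hrη
    have hwqe : w ^ q = (L / k) ^ q * u ^ q := Real.mul_rpow (by positivity) hu0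
    have hparts := LogScale.parts_le hKs (hsc x hx) y
    rw [← hu] at hparts
    have e1 : |linPart D1 D2 x y| ≤ 3 * Ks * (rad x ^ η * w ^ q) :=
      hparts.1.trans (mul_le_mul_of_nonneg_left (by linarith) (by positivity))
    have e2 : |quadPart q11 q12 q22 x y| ≤ 3 * Ks * (rad x ^ η * w ^ q) :=
      hparts.2.trans (mul_le_mul_of_nonneg_left (by nlinarith) (by positivity))
    -- The logarithm in the crude bound is what the factor rad^η in the error term is for: log r ≤
    -- r^η/η.
    have elog : Real.log (τ x) ≤ (L + η⁻¹) * (rad x ^ η * w ^ q) := by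
      have g1 : Real.log (τ x) ≤ Real.log L + Real.log (rad x) := by
        rw [← Real.log_mul hL0.ne' hr.ne']; exact Real.log_le_log ht h2
      have g2 : Real.log L ≤ L := (Real.log_le_sub_one_of_pos hL0).trans (by linarith)
      have g3 : Real.log (rad x) ≤ rad x ^ η / η := Real.log_le_rpow_div hr.le hη0
      have g4 : L ≤ L * (rad x ^ η * w ^ q) := le_mul_of_one_le_right hL0.le (by nlinarith)
      have g5 : rad x ^ η / η ≤ η⁻¹ * (rad x ^ η * w ^ q) := by
        rw [div_eq_inv_mul]
        gcongr
        exact le_mul_of_one_le_right (by positivity) (by linarith)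
      linarith
    have e3 : |f y - f x| ≤ |Kg| * (1 + (L + η⁻¹) + L) * (rad x ^ η * w ^ q) := by
      have hlog0 := Real.log_nonneg h1
      calc |f y - f x| ≤ |Kg| * (1 + Real.log (τ x) + ‖y - x‖ / τ x) :=
            (hglob x hx y hy).trans
              (mul_le_mul_of_nonneg_right (le_abs_self Kg) (by positivity))
        _ ≤ |Kg| * (1 * (rad x ^ η * w ^ q) + (L + η⁻¹) * (rad x ^ η * w ^ q) +
              L * (rad x ^ η * w ^ q)) := by
            gcongr
            · linarith
            · refine hsu.trans ?_
              gcongr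
              linarith
        _ = _ := by ring
    calc _ ≤ |f y - f x| + |linPart D1 D2 x y| + |quadPart q11 q12 q22 x y| := by
          refine (abs_sub _ _).trans (add_le_add (abs_sub _ _) le_rfl)
      _ ≤ (|Kg| * (1 + (L + η⁻¹) + L) + 3 * Ks + 3 * Ks) * (rad x ^ η * w ^ q) := by
          linarith
      _ = (|Kg| * (1 + (L + η⁻¹) + L) + 3 * Ks + 3 * Ks) * (L / k) ^ q *
            (rad x ^ η * u ^ q) := by rw [hwqe]; ring
      _ ≤ _ := by
          refine mul_le_mul (le_add_of_nonneg_left (by positivity))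
            (le_add_of_nonneg_left (by positivity)) (by positivity) (by positivity)

lemma LogScale.add {D : Set Plane} {D1 D2 q11 q12 q22 D1' D2' q11' q12' q22' : Plane → ℝ}
    (h : LogScale D D1 D2 q11 q12 q22) (h' : LogScale D D1' D2' q11' q12' q22') :
    LogScale D (fun x => D1 x + D1' x) (fun x => D2 x + D2' x)
      (fun x => q11 x + q11' x) (fun x => q12 x + q12' x) (fun x => q22 x + q22' x) := by
  obtain ⟨K, hK, h⟩ := h
  obtain ⟨K', hK', h'⟩ := h'
  refine ⟨K + K', add_nonneg hK hK', fun x hx => ?_⟩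
  obtain ⟨a1, a2, a3, a4, a5⟩ := h x hx
  obtain ⟨b1, b2, b3, b4, b5⟩ := h' x hx
  simp only [add_div]
  exact ⟨(abs_add_le _ _).trans (add_le_add a1 b1), (abs_add_le _ _).trans (add_le_add a2 b2),
    (abs_add_le _ _).trans (add_le_add a3 b3), (abs_add_le _ _).trans (add_le_add a4 b4),
    (abs_add_le _ _).trans (add_le_add a5 b5)⟩

lemma LogScale.const_mul {D : Set Plane} {D1 D2 q11 q12 q22 : Plane → ℝ}
    (h : LogScale D D1 D2 q11 q12 q22) (c : ℝ) :
    LogScale D (fun x => c * D1 x) (fun x => c * D2 x)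
      (fun x => c * q11 x) (fun x => c * q12 x) (fun x => c * q22 x) := by
  obtain ⟨K, hK, h⟩ := h
  refine ⟨|c| * K, by positivity, fun x hx => ?_⟩
  obtain ⟨a1, a2, a3, a4, a5⟩ := h x hx
  simp only [mul_div_assoc, abs_mul]
  exact ⟨by gcongr, by gcongr, by gcongr, by gcongr, by gcongr⟩

/-! ### Expansions on thin regions. -/

/-- A region containing the part of the plane between two parabolic curves of exponent `β`. -/
def thin (A β : ℝ) : Set Plane := {x | 0 ≤ x 0 ∧ |x 1| ≤ A * (1 + x 0) ^ β}

section Thin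

variable {A β η q : ℝ}

/-- As β ≤ 1 the vertical coordinate is at most A(1 + x 0), so the horizontal one alone measures the
distance to the origin. -/
lemma thin_scale (hA : 0 ≤ A) (hβ : β ≤ 1) : ∀ x ∈ thin A β,
    1 ≤ 1 + x 0 ∧ 1 + x 0 ≤ (1 + A) * rad x ∧ rad x ≤ (1 + A) * (1 + x 0) := by
  rintro x ⟨h0, h1⟩
  have ht : 1 ≤ 1 + x 0 := by linarith
  have h2 : (1 + x 0) ^ β ≤ 1 + x 0 := by
    simpa using Real.rpow_le_rpow_of_exponent_le ht hβ
  have h3 : ‖x‖ ≤ |x 0| + |x 1| := by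
    rw [EuclideanSpace.norm_eq, Fin.sum_univ_two, Real.sqrt_le_left (by positivity)]
    simp only [Real.norm_eq_abs]
    nlinarith [abs_nonneg (x 0), abs_nonneg (x 1)]
  have h4 := abs_coord_le_norm x 0
  rw [abs_of_nonneg h0] at h3 h4
  refine ⟨ht, ?_, ?_⟩
  · have := rad_pos x
    unfold rad at *
    nlinarith
  · unfold rad
    nlinarith

lemma thin_abs_le (hA : 0 ≤ A) (hβ : β ≤ 1) {x : Plane} (hx : x ∈ thin A β) :
    |x 1| ≤ A * (1 + x 0) := by
  refine hx.2.trans (mul_le_mul_of_nonneg_left ?_ hA)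
  simpa using Real.rpow_le_rpow_of_exponent_le
    (show 1 ≤ 1 + x 0 by linarith [hx.1]) hβ

lemma hasExpansion_log (hA : 0 ≤ A) (hβ : β ≤ 1) (hη0 : 0 < η) (hη1 : η ≤ 1) (hq : 2 < q)
    (hq3 : q ≤ 3) :
    HasExpansion (thin A β) η q (fun x => Real.log (1 + x 0)) (fun x => (1 + x 0)⁻¹) (fun _ => 0)
      (fun x => -(1 / 2) * ((1 + x 0) ^ 2)⁻¹) (fun _ => 0) (fun _ => 0) ∧
    LogScale (thin A β) (fun x => (1 + x 0)⁻¹) (fun _ => 0)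
      (fun x => -(1 / 2) * ((1 + x 0) ^ 2)⁻¹) (fun _ => 0) (fun _ => 0) := by
  refine hasExpansion_of_scale (τ := fun x => 1 + x 0) (L := 1 + A) (k := 1 / 2)
    (by linarith) (by norm_num) (by norm_num) (thin_scale hA hβ) hη0 hη1 hq hq3
    ⟨2, fun x hx y hy hd => ?_⟩ ⟨1, fun x hx y hy => ?_⟩ ⟨1, fun x hx => ?_⟩
  · have ht : 0 < 1 + x 0 := by linarith [hx.1]
    have hd0 := abs_coord_le_norm (y - x) 0
    simp only [PiLp.sub_apply] at hd0
    have hs : |(y 0 - x 0) / (1 + x 0)| ≤ ‖y - x‖ / (1 + x 0) := by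
      rw [abs_div, abs_of_pos ht]; gcongr
    have hs2 : |(y 0 - x 0) / (1 + x 0)| ≤ 1 / 2 := by
      refine hs.trans ?_
      rw [div_le_iff₀ ht]; exact hd
    have hy' : 1 + y 0 = (1 + x 0) * (1 + (y 0 - x 0) / (1 + x 0)) := by field_simp; ring
    have hpos : 0 < 1 + (y 0 - x 0) / (1 + x 0) := by linarith [(abs_le.1 hs2).1]
    have h := abs_log_one_add_sub_le hs2
    simp only [linPart, quadPart]
    rw [hy', Real.log_mul ht.ne' hpos.ne']
    have e : Real.log (1 + x 0) + Real.log (1 + (y 0 - x 0) / (1 + x 0)) - Real.log (1 + x 0) -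
        ((1 + x 0)⁻¹ * (y 0 - x 0) + 0 * (y 1 - x 1)) -
        (-(1 / 2) * ((1 + x 0) ^ 2)⁻¹ * (y 0 - x 0) ^ 2 + 0 * ((y 0 - x 0) * (y 1 - x 1)) +
          0 * (y 1 - x 1) ^ 2) = Real.log (1 + (y 0 - x 0) / (1 + x 0)) -
        (y 0 - x 0) / (1 + x 0) + ((y 0 - x 0) / (1 + x 0)) ^ 2 / 2 := by
      field_simp; ring
    rw [e]
    refine h.trans (mul_le_mul_of_nonneg_left ?_ (by norm_num))
    calc _ ≤ (‖y - x‖ / (1 + x 0)) ^ 3 := by gcongr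
      _ ≤ _ := le_add_of_nonneg_left (by positivity)
  · have ht : 1 ≤ 1 + x 0 := by linarith [hx.1]
    have ht' : 1 ≤ 1 + y 0 := by linarith [hy.1]
    have hd0 := abs_coord_le_norm (y - x) 0
    simp only [PiLp.sub_apply] at hd0
    have h0 := Real.log_nonneg ht
    have h1 := Real.log_nonneg ht'
    have h2 : Real.log (1 + y 0) - Real.log (1 + x 0) ≤ ‖y - x‖ / (1 + x 0) := by
      rw [← Real.log_div (by linarith) (by linarith)]
      refine (Real.log_le_sub_one_of_pos (div_pos (by linarith) (by linarith))).trans ?_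
      rw [div_sub_one (by linarith)]
      gcongr
      linarith [le_abs_self (y 0 - x 0)]
    have h3 : 0 ≤ ‖y - x‖ / (1 + x 0) := by positivity
    rw [abs_le]
    constructor <;> linarith
  · have ht : 0 < 1 + x 0 := by linarith [hx.1]
    simp only [abs_zero]
    refine ⟨?_, by positivity, ?_, by positivity, by positivity⟩
    · rw [abs_of_pos (by positivity)]; simp
    · rw [abs_mul, abs_of_pos (show 0 < ((1 + x 0) ^ 2)⁻¹ by positivity), one_div]
      norm_num
      have : 0 ≤ ((1 + x 0) ^ 2)⁻¹ := by positivity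
      linarith

/-- The terms dropped when t^a X² is expanded, with s the relative jump and `R` the remainder of the
power. Each is at least quadratic in s and carries another small factor: z from the size of X, or a
further s. -/
lemma abs_sq_remainder_le {a A K t z p d₀ d₁ X R s : ℝ} (hA : 0 ≤ A) (hK : 0 ≤ K) (ht : 0 < t)
    (hp0 : 0 ≤ p) (hp : p ≤ (t ^ 3)⁻¹) (hR : |R| ≤ K * ((t ^ 2)⁻¹ * s ^ 2))
    (hX : |X| ≤ A * z * t) (hd₀ : |d₀| ≤ s * t) (hd₁ : |d₁| ≤ s * t) (hz0 : 0 ≤ z) (hz1 : z ≤ 1)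
    (hs0 : 0 ≤ s) (hs1 : s ≤ 1) :
    |a * p * d₀ * (2 * X * d₁ + d₁ ^ 2) + R * (X + d₁) ^ 2| ≤
      (|a| * (2 * A + 1) + K * (2 * A ^ 2 + 2)) * (z * s ^ 2 + s ^ 3) := by
  have n1 : 0 ≤ z * s ^ 2 := by positivity
  have n2 : 0 ≤ A * s ^ 3 := by positivity
  have n3 : 0 ≤ A ^ 2 * s ^ 3 := by positivity
  have hc : |2 * X * d₁ + d₁ ^ 2| ≤ 2 * (A * z * t) * (s * t) + (s * t) ^ 2 := by
    refine (abs_add_le _ _).trans (add_le_add ?_ ?_)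
    · rw [abs_mul, abs_mul, abs_two]; gcongr
    · rw [abs_pow]; gcongr
  have b1 : |a * p * d₀ * (2 * X * d₁ + d₁ ^ 2)| ≤ |a| * ((2 * A + 1) * (z * s ^ 2 + s ^ 3)) := by
    rw [abs_mul, abs_mul, abs_mul, abs_of_nonneg hp0]
    calc |a| * p * |d₀| * |2 * X * d₁ + d₁ ^ 2|
        ≤ |a| * (t ^ 3)⁻¹ * (s * t) * (2 * (A * z * t) * (s * t) + (s * t) ^ 2) := by gcongr
      _ = |a| * (2 * A * (z * s ^ 2) + s ^ 3) := by field_simp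
      _ ≤ _ := by
          gcongr
          linarith
  have hsq : (X + d₁) ^ 2 ≤ (2 * A ^ 2 * z + 2 * s ^ 2) * t ^ 2 := by
    have g1 : |X + d₁| ≤ (A * z + s) * t := by
      refine (abs_add_le _ _).trans ?_
      rw [add_mul]; exact add_le_add hX hd₁
    calc (X + d₁) ^ 2 = |X + d₁| ^ 2 := (sq_abs _).symm
      _ ≤ ((A * z + s) * t) ^ 2 := by gcongr
      _ = (A * z + s) ^ 2 * t ^ 2 := by ring
      _ ≤ _ := by
        gcongr
        have g2 : (A * z) ^ 2 ≤ A ^ 2 * z := by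
          rw [mul_pow]
          exact mul_le_mul_of_nonneg_left (by nlinarith) (sq_nonneg A)
        nlinarith [sq_nonneg (A * z - s)]
  have b2 : |R * (X + d₁) ^ 2| ≤ K * (2 * A ^ 2 * (z * s ^ 2) + 2 * s ^ 4) := by
    rw [abs_mul, abs_of_nonneg (sq_nonneg (X + d₁))]
    calc |R| * (X + d₁) ^ 2 ≤
          K * ((t ^ 2)⁻¹ * s ^ 2) * ((2 * A ^ 2 * z + 2 * s ^ 2) * t ^ 2) := by gcongr
      _ = _ := by field_simp
  have b3 : K * (2 * A ^ 2 * (z * s ^ 2) + 2 * s ^ 4) ≤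
      K * ((2 * A ^ 2 + 2) * (z * s ^ 2 + s ^ 3)) := by
    have : s ^ 4 ≤ s ^ 3 := by nlinarith [pow_nonneg hs0 3]
    gcongr
    linarith
  calc _ ≤ _ := abs_add_le _ _
    _ ≤ _ := add_le_add b1 (b2.trans b3)
    _ = _ := by ring

/-- Thinness gives |x 1| ≤ A t^(1-η) since η ≤ 1 - β. Every second derivative that still contains x
1 is therefore o(t⁻²), and only the purely vertical one has to be kept. -/
lemma hasExpansion_rpow_mul_sq {a : ℝ} (hA : 0 ≤ A) (hβ : β ≤ 1) (hη0 : 0 < η) (hηβ : η ≤ 1 - β)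
    (hη1 : η ≤ 1) (hq : 2 < q) (hq3 : q ≤ 3) (ha : a ≤ -2) :
    HasExpansion (thin A β) η q (fun x => (1 + x 0) ^ a * x 1 ^ 2)
      (fun x => a * (1 + x 0) ^ (a - 1) * x 1 ^ 2) (fun x => 2 * ((1 + x 0) ^ a * x 1))
      (fun _ => 0) (fun _ => 0) (fun x => (1 + x 0) ^ a) ∧
    LogScale (thin A β)
      (fun x => a * (1 + x 0) ^ (a - 1) * x 1 ^ 2) (fun x => 2 * ((1 + x 0) ^ a * x 1))
      (fun _ => 0) (fun _ => 0) (fun x => (1 + x 0) ^ a) := by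
  obtain ⟨K, hK, hT⟩ := abs_add_rpow_sub_sub_le a
  have hta : ∀ x ∈ thin A β, (1 + x 0) ^ a ≤ ((1 + x 0) ^ 2)⁻¹ := fun x hx => by
    have ht : 1 ≤ 1 + x 0 := by linarith [hx.1]
    refine (Real.rpow_le_rpow_of_exponent_le ht ha).trans (le_of_eq ?_)
    rw [Real.rpow_neg (by linarith)]; simp
  have hf : ∀ x ∈ thin A β, |(1 + x 0) ^ a * x 1 ^ 2| ≤ A ^ 2 := fun x hx => by
    have ht : 0 < 1 + x 0 := by linarith [hx.1]
    rw [abs_of_nonneg (by positivity)]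
    calc (1 + x 0) ^ a * x 1 ^ 2 = (1 + x 0) ^ a * |x 1| ^ 2 := by rw [sq_abs]
      _ ≤ ((1 + x 0) ^ 2)⁻¹ * (A * (1 + x 0)) ^ 2 := by
          gcongr
          · exact hta x hx
          · exact thin_abs_le hA hβ hx
      _ = A ^ 2 := by field_simp
  refine hasExpansion_of_scale (τ := fun x => 1 + x 0) (L := 1 + A) (k := 1 / 2)
    (by linarith) (by norm_num) (by norm_num) (thin_scale hA hβ) hη0 hη1 hq hq3
    ⟨|a| * (2 * A + 1) + K * (2 * A ^ 2 + 2), fun x hx y hy hd => ?_⟩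
    ⟨2 * A ^ 2, fun x hx y hy => ?_⟩ ⟨|a| * A ^ 2 + 2 * A + 1, fun x hx => ?_⟩
  · have ht1 : 1 ≤ 1 + x 0 := by linarith [hx.1]
    have ht : 0 < 1 + x 0 := by linarith
    have hd0 := abs_coord_le_norm (y - x) 0
    have hd1 := abs_coord_le_norm (y - x) 1
    simp only [PiLp.sub_apply] at hd0 hd1
    have h := hT (1 + x 0) (y 0 - x 0) ht (by linarith)
    rw [show 1 + x 0 + (y 0 - x 0) = 1 + y 0 by ring] at h
    set t := 1 + x 0 with htdef
    set R := (1 + y 0) ^ a - t ^ a - a * t ^ (a - 1) * (y 0 - x 0) with hR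
    have e : (1 + y 0) ^ a * y 1 ^ 2 - t ^ a * x 1 ^ 2 -
        linPart (fun x => a * (1 + x 0) ^ (a - 1) * x 1 ^ 2) (fun x => 2 * ((1 + x 0) ^ a * x 1))
          x y - quadPart (fun _ => 0) (fun _ => 0) (fun x => (1 + x 0) ^ a) x y =
        a * t ^ (a - 1) * (y 0 - x 0) * (2 * x 1 * (y 1 - x 1) + (y 1 - x 1) ^ 2) +
          R * (x 1 + (y 1 - x 1)) ^ 2 := by
      simp only [linPart, quadPart, hR, ← htdef]; ring
    rw [e]
    set δ := ‖y - x‖ with hδ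
    have hδ0 : 0 ≤ δ := norm_nonneg _
    set s := δ / t with hs
    have hs0 : 0 ≤ s := by positivity
    have hs1 : s ≤ 1 / 2 := by rw [hs, div_le_iff₀ ht]; exact hd
    have hδs : δ = s * t := by rw [hs]; field_simp
    have hXb : |x 1| ≤ A * t ^ β := hx.2
    have htβ : t ^ β = t ^ (β - 1) * t := by
      rw [← Real.rpow_add_one ht.ne']; ring_nf
    have hz1 : t ^ (β - 1) ≤ t ^ (-η) := Real.rpow_le_rpow_of_exponent_le ht1 (by linarith)
    have hz2 : t ^ (-η) ≤ 1 := Real.rpow_le_one_of_one_le_of_nonpos ht1 (by linarith)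
    set z := t ^ (-η) with hz
    have hz0 : 0 ≤ z := by positivity
    have hX : |x 1| ≤ A * z * t := by
      refine hXb.trans ?_
      rw [htβ, mul_assoc]; gcongr
    have hta' := hta x hx
    rw [← htdef] at hta'
    have htm : t ^ (a - 1) ≤ (t ^ 3)⁻¹ := by
      rw [Real.rpow_sub_one ht.ne']
      calc t ^ a / t ≤ (t ^ 2)⁻¹ / t := by gcongr
        _ = _ := by field_simp
    have hRb : |R| ≤ K * ((t ^ 2)⁻¹ * s ^ 2) := by
      refine h.trans ?_
      rw [mul_assoc, ← sq_abs ((y 0 - x 0) / t), abs_div, abs_of_pos ht, hs]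
      gcongr
    exact abs_sq_remainder_le hA hK ht (Real.rpow_nonneg ht.le _) htm hRb hX (hδs ▸ hd0)
      (hδs ▸ hd1) hz0 hz2 hs0 (by linarith)
  · have ht1 : 1 ≤ 1 + x 0 := by linarith [hx.1]
    have := Real.log_nonneg ht1
    calc _ ≤ |(1 + y 0) ^ a * y 1 ^ 2| + |(1 + x 0) ^ a * x 1 ^ 2| := abs_sub _ _
      _ ≤ 2 * A ^ 2 * 1 := by linarith [hf x hx, hf y hy]
      _ ≤ _ := by
          gcongr
          have : 0 ≤ ‖y - x‖ / (1 + x 0) := by positivity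
          linarith
  · have ht : 0 < 1 + x 0 := by linarith [hx.1]
    have hX := thin_abs_le hA hβ hx
    have htx := hta x hx
    set t := 1 + x 0 with htdef
    simp only [abs_zero]
    refine ⟨?_, ?_, by positivity, by positivity, ?_⟩
    · rw [abs_mul, abs_mul, abs_of_nonneg (Real.rpow_nonneg ht.le _), abs_pow,
        Real.rpow_sub_one ht.ne']
      calc |a| * (t ^ a / t) * |x 1| ^ 2 ≤ |a| * ((t ^ 2)⁻¹ / t) * (A * t) ^ 2 := by gcongr
        _ = |a| * A ^ 2 / t := by field_simp
        _ ≤ _ := by gcongr; linarith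
    · rw [abs_mul, abs_mul, abs_of_nonneg (Real.rpow_nonneg ht.le _), abs_two]
      calc 2 * (t ^ a * |x 1|) ≤ 2 * ((t ^ 2)⁻¹ * (A * t)) := by gcongr
        _ = 2 * A / t := by field_simp
        _ ≤ _ := by gcongr; nlinarith [mul_nonneg (abs_nonneg a) (sq_nonneg A)]
    · rw [abs_of_nonneg (Real.rpow_nonneg ht.le _)]
      refine htx.trans ?_
      rw [inv_eq_one_div]; gcongr
      nlinarith [mul_nonneg (abs_nonneg a) (sq_nonneg A)]

/-- With a ≤ -1 - η all second derivatives are O(t^(-2-η)), so the quadratic part can be taken to be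
zero. -/
lemma hasExpansion_rpow_mul {a : ℝ} (hA : 0 ≤ A) (hβ : β ≤ 1) (hη0 : 0 < η)
    (hη1 : η ≤ 1) (hq : 2 < q) (hq3 : q ≤ 3) (ha : a ≤ -1 - η) :
    HasExpansion (thin A β) η q (fun x => (1 + x 0) ^ a * x 1)
      (fun x => a * (1 + x 0) ^ (a - 1) * x 1) (fun x => (1 + x 0) ^ a)
      (fun _ => 0) (fun _ => 0) (fun _ => 0) ∧
    LogScale (thin A β)
      (fun x => a * (1 + x 0) ^ (a - 1) * x 1) (fun x => (1 + x 0) ^ a)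
      (fun _ => 0) (fun _ => 0) (fun _ => 0) := by
  obtain ⟨K, hK, hT⟩ := abs_add_rpow_sub_sub_le a
  have hta' : ∀ x ∈ thin A β, (1 + x 0) ^ a ≤ (1 + x 0) ^ (-η) * (1 + x 0)⁻¹ := fun x hx => by
    have ht : 1 ≤ 1 + x 0 := by linarith [hx.1]
    have ht0 : 0 < 1 + x 0 := by linarith
    refine (Real.rpow_le_rpow_of_exponent_le ht ha).trans (le_of_eq ?_)
    rw [← Real.rpow_neg_one, ← Real.rpow_add ht0]; ring_nf
  have hta : ∀ x ∈ thin A β, (1 + x 0) ^ a ≤ (1 + x 0)⁻¹ := fun x hx => by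
    have ht : 1 ≤ 1 + x 0 := by linarith [hx.1]
    refine (hta' x hx).trans (mul_le_of_le_one_left (by positivity)
      (Real.rpow_le_one_of_one_le_of_nonpos ht (by linarith)))
  have hf : ∀ x ∈ thin A β, |(1 + x 0) ^ a * x 1| ≤ A := fun x hx => by
    have ht : 0 < 1 + x 0 := by linarith [hx.1]
    rw [abs_mul, abs_of_nonneg (Real.rpow_nonneg ht.le _)]
    calc (1 + x 0) ^ a * |x 1| ≤ (1 + x 0)⁻¹ * (A * (1 + x 0)) := by
          gcongr
          · exact hta x hx
          · exact thin_abs_le hA hβ hx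
      _ = A := by field_simp
  refine hasExpansion_of_scale (τ := fun x => 1 + x 0) (L := 1 + A) (k := 1 / 2)
    (by linarith) (by norm_num) (by norm_num) (thin_scale hA hβ) hη0 hη1 hq hq3
    ⟨|a| + K * (A + 1), fun x hx y hy hd => ?_⟩
    ⟨2 * A, fun x hx y hy => ?_⟩ ⟨|a| * A + 1, fun x hx => ?_⟩
  · have ht1 : 1 ≤ 1 + x 0 := by linarith [hx.1]
    have ht : 0 < 1 + x 0 := by linarith
    have hd0 := abs_coord_le_norm (y - x) 0
    have hd1 := abs_coord_le_norm (y - x) 1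
    simp only [PiLp.sub_apply] at hd0 hd1
    have h := hT (1 + x 0) (y 0 - x 0) ht (by linarith)
    rw [show 1 + x 0 + (y 0 - x 0) = 1 + y 0 by ring] at h
    have hta' := hta' x hx
    set t := 1 + x 0 with htdef
    set R := (1 + y 0) ^ a - t ^ a - a * t ^ (a - 1) * (y 0 - x 0) with hR
    have e : (1 + y 0) ^ a * y 1 - t ^ a * x 1 -
        linPart (fun x => a * (1 + x 0) ^ (a - 1) * x 1) (fun x => (1 + x 0) ^ a)
          x y - quadPart (fun _ => 0) (fun _ => 0) (fun _ => 0) x y =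
        a * t ^ (a - 1) * (y 0 - x 0) * (y 1 - x 1) + R * (x 1 + (y 1 - x 1)) := by
      simp only [linPart, quadPart, hR, ← htdef]; ring
    rw [e]
    set δ := ‖y - x‖ with hδ
    have hδ0 : 0 ≤ δ := norm_nonneg _
    set s := δ / t with hs
    have hs0 : 0 ≤ s := by positivity
    have hs1 : s ≤ 1 / 2 := by rw [hs, div_le_iff₀ ht]; exact hd
    have hδs : δ = s * t := by rw [hs]; field_simp
    have hX : |x 1| ≤ A * t := thin_abs_le hA hβ hx
    set z := t ^ (-η) with hz
    have hz0 : 0 ≤ z := by positivity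
    have b1 : |a * t ^ (a - 1) * (y 0 - x 0) * (y 1 - x 1)| ≤ |a| * (z * s ^ 2) := by
      rw [abs_mul, abs_mul, abs_mul, abs_of_nonneg (Real.rpow_nonneg ht.le _),
        Real.rpow_sub_one ht.ne']
      calc |a| * (t ^ a / t) * |y 0 - x 0| * |y 1 - x 1|
          ≤ |a| * (z * t⁻¹ / t) * (s * t) * (s * t) := by
            rw [← hδs]; gcongr
        _ = _ := by field_simp
    have b2 : |R * (x 1 + (y 1 - x 1))| ≤ K * (A + 1) * (z * s ^ 2) := by
      have g1 : |x 1 + (y 1 - x 1)| ≤ (A + 1) * t := by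
        refine (abs_add_le _ _).trans ?_
        have : δ ≤ t := by linarith
        linarith
      have hRb : |R| ≤ K * ((z * t⁻¹) * s ^ 2) := by
        refine h.trans ?_
        rw [mul_assoc, ← sq_abs ((y 0 - x 0) / t), abs_div, abs_of_pos ht, hs]
        gcongr
      calc _ = |R| * |x 1 + (y 1 - x 1)| := abs_mul _ _
        _ ≤ K * ((z * t⁻¹) * s ^ 2) * ((A + 1) * t) := by gcongr
        _ = _ := by field_simp
    calc _ ≤ _ := abs_add_le _ _
      _ ≤ _ := add_le_add b1 b2
      _ = (|a| + K * (A + 1)) * (z * s ^ 2) := by ring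
      _ ≤ _ := by
          gcongr
          exact le_add_of_nonneg_right (by positivity)
  · have ht1 : 1 ≤ 1 + x 0 := by linarith [hx.1]
    have := Real.log_nonneg ht1
    calc _ ≤ |(1 + y 0) ^ a * y 1| + |(1 + x 0) ^ a * x 1| := abs_sub _ _
      _ ≤ 2 * A * 1 := by linarith [hf x hx, hf y hy]
      _ ≤ _ := by
          gcongr
          have : 0 ≤ ‖y - x‖ / (1 + x 0) := by positivity
          linarith
  · have ht : 0 < 1 + x 0 := by linarith [hx.1]
    have hX := thin_abs_le hA hβ hx
    have htx := hta x hx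
    set t := 1 + x 0 with htdef
    simp only [abs_zero]
    refine ⟨?_, ?_, by positivity, by positivity, by positivity⟩
    · rw [abs_mul, abs_mul, abs_of_nonneg (Real.rpow_nonneg ht.le _), Real.rpow_sub_one ht.ne']
      calc |a| * (t ^ a / t) * |x 1| ≤ |a| * (t⁻¹ / t) * (A * t) := by gcongr
        _ = |a| * A / t := by field_simp
        _ ≤ _ := by gcongr; linarith
    · rw [abs_of_nonneg (Real.rpow_nonneg ht.le _)]
      refine htx.trans ?_
      rw [inv_eq_one_div]; gcongr
      nlinarith [mul_nonneg (abs_nonneg a) hA]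

end Thin

lemma abs_apply_le_opNorm (N : Matrix (Fin 2) (Fin 2) ℝ) (i j : Fin 2) : |N i j| ≤ opNorm N := by
  have h := (Matrix.toEuclideanCLM (n := Fin 2) (𝕜 := ℝ) N).le_opNorm (EuclideanSpace.single j 1)
  have h2 := abs_coord_le_norm
    (Matrix.toEuclideanCLM (n := Fin 2) (𝕜 := ℝ) N (EuclideanSpace.single j 1)) i
  have h3 : (Matrix.toEuclideanCLM (n := Fin 2) (𝕜 := ℝ) N (EuclideanSpace.single j 1)) i =
      N i j := by
    simp [Matrix.ofLp_toEuclideanCLM]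
  rw [h3] at h2
  refine h2.trans (h.trans (le_of_eq ?_))
  simp [opNorm]

lemma eventually_rpow_le (K : ℝ) {ε a b : ℝ} (hε : 0 < ε) (hab : a < b) :
    ∀ᶠ t : ℝ in atTop, K * t ^ a ≤ ε * t ^ b := by
  have h := (tendsto_rpow_neg_atTop (show 0 < b - a by linarith)).const_mul K
  rw [mul_zero] at h
  filter_upwards [h.eventually_le_const hε, eventually_gt_atTop 0] with t ht h0
  have : t ^ a = t ^ (-(b - a)) * t ^ b := by rw [← Real.rpow_add h0]; ring_nf
  rw [this, ← mul_assoc]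
  exact mul_le_mul_of_nonneg_right ht (Real.rpow_nonneg h0.le b)

/-! ### The Lyapunov function for thin domains. -/

section ThinFunction

variable (c g b ν θ : ℝ)

/-- The Lyapunov function for thin domains, growing like the logarithm. -/
def thinFn (x : Plane) : ℝ :=
  Real.log (1 + x 0) + c * ((1 + x 0) ^ (-2 : ℝ) * x 1 ^ 2) +
    g * ((1 + x 0) ^ (-2 - ν) * x 1 ^ 2) + b * ((1 + x 0) ^ (θ - 2) * x 1)

/-- The first partial derivative of `thinFn`. -/
def thinD1 (x : Plane) : ℝ :=
  (1 + x 0)⁻¹ + c * (-2 * (1 + x 0) ^ (-2 - 1 : ℝ) * x 1 ^ 2) +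
    g * ((-2 - ν) * (1 + x 0) ^ (-2 - ν - 1) * x 1 ^ 2) +
    b * ((θ - 2) * (1 + x 0) ^ (θ - 2 - 1) * x 1)

/-- The second partial derivative of `thinFn`. -/
def thinD2 (x : Plane) : ℝ :=
  0 + c * (2 * ((1 + x 0) ^ (-2 : ℝ) * x 1)) + g * (2 * ((1 + x 0) ^ (-2 - ν) * x 1)) +
    b * (1 + x 0) ^ (θ - 2)

/-- The leading part of half the second derivative of `thinFn` in the first variable. -/
def thinQ11 (x : Plane) : ℝ :=
  -(1 / 2) * ((1 + x 0) ^ 2)⁻¹ + c * 0 + g * 0 + b * 0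

/-- The leading part of the mixed second derivative of `thinFn`. -/
def thinQ12 (_ : Plane) : ℝ := 0 + c * 0 + g * 0 + b * 0

/-- Half the second derivative of `thinFn` in the second variable. -/
def thinQ22 (x : Plane) : ℝ :=
  0 + c * (1 + x 0) ^ (-2 : ℝ) + g * (1 + x 0) ^ (-2 - ν) + b * 0

lemma measurable_thinFn : Measurable (thinFn c g b ν θ) := by
  have h0 : Measurable fun x : Plane => 1 + x 0 := by fun_prop
  have h1 : Measurable fun x : Plane => x 1 := by fun_prop
  exact (((Real.measurable_log.comp h0).add (((h0.pow_const _).mul (h1.pow_const 2)).const_mul c)).add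
    (((h0.pow_const _).mul (h1.pow_const 2)).const_mul g)).add
    (((h0.pow_const _).mul h1).const_mul b)

variable {A β η q : ℝ} {c g b ν θ}

/-- `η ≤ 1 - β` serves the quadratic terms, `η ≤ 1 - θ` the linear one. -/
lemma hasExpansion_thinFn (hA : 0 ≤ A) (hβ : β ≤ 1) (hη0 : 0 < η) (hη1 : η ≤ 1)
    (hηβ : η ≤ 1 - β) (hηθ : η ≤ 1 - θ) (hν : 0 ≤ ν) (hq : 2 < q) (hq3 : q ≤ 3) :
    HasExpansion (thin A β) η q (thinFn c g b ν θ) (thinD1 c g b ν θ) (thinD2 c g b ν θ)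
      (thinQ11 c g b) (thinQ12 c g b) (thinQ22 c g b ν) ∧
    LogScale (thin A β) (thinD1 c g b ν θ) (thinD2 c g b ν θ)
      (thinQ11 c g b) (thinQ12 c g b) (thinQ22 c g b ν) := by
  have e1 := hasExpansion_log (A := A) hA hβ hη0 hη1 hq hq3
  have e2 := hasExpansion_rpow_mul_sq (A := A) hA hβ hη0 hηβ hη1 hq hq3
    (show (-2 : ℝ) ≤ -2 by norm_num)
  have e3 := hasExpansion_rpow_mul_sq (A := A) hA hβ hη0 hηβ hη1 hq hq3
    (show -2 - ν ≤ -2 by linarith)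
  have e4 := hasExpansion_rpow_mul (A := A) hA hβ hη0 hη1 hq hq3
    (show θ - 2 ≤ -1 - η by linarith)
  exact ⟨((e1.1.add (e2.1.const_mul c)).add (e3.1.const_mul g)).add (e4.1.const_mul b),
    ((e1.2.add (e2.2.const_mul c)).add (e3.2.const_mul g)).add (e4.2.const_mul b)⟩

/-- The three corrections are bounded because |x 1| ≤ A t and their powers of t are at most -2, -2
and -1. -/
lemma thinFn_sub_log_le (hA : 0 ≤ A) (hβ : β ≤ 1) (hθ : θ ≤ 1) (hν : 0 ≤ ν) : ∀ x ∈ thin A β,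
    |thinFn c g b ν θ x - 1 * Real.log (rad x)| ≤
      (1 + A) + |c| * A ^ 2 + |g| * A ^ 2 + |b| * A := by
  intro x hx
  obtain ⟨h1, h2, h3⟩ := thin_scale hA hβ x hx
  have hX := thin_abs_le hA hβ hx
  set t := 1 + x 0 with ht
  have ht0 : 0 < t := by linarith
  have hr := rad_pos x
  have hsq : ∀ a : ℝ, a ≤ -2 → |t ^ a * x 1 ^ 2| ≤ A ^ 2 := fun a ha => by
    have : t ^ a ≤ (t ^ 2)⁻¹ := by
      refine (Real.rpow_le_rpow_of_exponent_le h1 ha).trans (le_of_eq ?_)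
      rw [Real.rpow_neg ht0.le]; simp
    rw [abs_mul, abs_of_nonneg (Real.rpow_nonneg ht0.le a), abs_pow]
    calc t ^ a * |x 1| ^ 2 ≤ (t ^ 2)⁻¹ * (A * t) ^ 2 := by gcongr
      _ = A ^ 2 := by field_simp
  have hlin : |t ^ (θ - 2) * x 1| ≤ A := by
    have : t ^ (θ - 2) ≤ t⁻¹ := by
      rw [← Real.rpow_neg_one]
      exact Real.rpow_le_rpow_of_exponent_le h1 (by linarith)
    rw [abs_mul, abs_of_nonneg (Real.rpow_nonneg ht0.le _)]
    calc t ^ (θ - 2) * |x 1| ≤ t⁻¹ * (A * t) := by gcongr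
      _ = A := by field_simp
  have hlog : |Real.log t - Real.log (rad x)| ≤ 1 + A := by
    have hA1 : (0 : ℝ) < 1 + A := by linarith
    have g1 : Real.log (1 + A) ≤ 1 + A := (Real.log_le_sub_one_of_pos hA1).trans (by linarith)
    have g2 : Real.log t ≤ Real.log (1 + A) + Real.log (rad x) := by
      rw [← Real.log_mul hA1.ne' hr.ne']; exact Real.log_le_log ht0 h2
    have g3 : Real.log (rad x) ≤ Real.log (1 + A) + Real.log t := by
      rw [← Real.log_mul hA1.ne' ht0.ne']; exact Real.log_le_log hr h3
    rw [abs_le]; constructor <;> linarith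
  have e : thinFn c g b ν θ x - 1 * Real.log (rad x) = (Real.log t - Real.log (rad x)) +
      c * (t ^ (-2 : ℝ) * x 1 ^ 2) + g * (t ^ (-2 - ν) * x 1 ^ 2) + b * (t ^ (θ - 2) * x 1) := by
    simp only [thinFn, ← ht]; ring
  rw [e]
  refine (abs_add_le _ _).trans (add_le_add ((abs_add_le _ _).trans (add_le_add
    ((abs_add_le _ _).trans (add_le_add hlog ?_)) ?_)) ?_) <;> rw [abs_mul]
  · exact mul_le_mul_of_nonneg_left (hsq _ le_rfl) (abs_nonneg c)
  · exact mul_le_mul_of_nonneg_left (hsq _ (by linarith)) (abs_nonneg g)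
  · exact mul_le_mul_of_nonneg_left hlin (abs_nonneg b)

/-- In the interior the drift of `thinFn` is governed by the covariance matrix. -/
lemma abs_stepDrift_thinFn_sub_le {S : Set Plane} {κ : Kernel S S} [IsMarkovKernel κ] {M : ℝ}
    (hM : MomentBound κ q M) (hq : 2 < q) {K : ℝ} (Sig : Matrix (Fin 2) (Fin 2) ℝ) (x : S)
    (hx : (x : Plane) ∈ thin A β)
    (hK1 : |thinD1 c g b ν θ x| ≤ K / rad x) (hK2 : |thinD2 c g b ν θ x| ≤ K / rad x) :
    |stepDrift κ (thinD1 c g b ν θ) (thinD2 c g b ν θ) (thinQ11 c g b) (thinQ12 c g b)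
        (thinQ22 c g b ν) x - (-(1 / 2) * Sig 0 0 + c * Sig 1 1) * ((1 + (x : Plane) 0) ^ 2)⁻¹| ≤
      2 * (K / rad x) * ‖meanIncrement κ x‖ +
        (1 + |c|) * opNorm (secondMoment κ x - Sig) * ((1 + (x : Plane) 0) ^ 2)⁻¹ +
        |g| * (1 + M) * (1 + (x : Plane) 0) ^ (-2 - ν) := by
  have ht : 0 < 1 + (x : Plane) 0 := by linarith [hx.1]
  have e2 : (1 + (x : Plane) 0) ^ (-2 : ℝ) = ((1 + (x : Plane) 0) ^ 2)⁻¹ := by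
    rw [Real.rpow_neg ht.le]; simp
  have hm0 := abs_coord_le_norm (meanIncrement κ x) 0
  have hm1 := abs_coord_le_norm (meanIncrement κ x) 1
  have hM11 := hM.abs_secondMoment_le hq x 1 1
  have hN0 := abs_apply_le_opNorm (secondMoment κ x - Sig) 0 0
  have hN1 := abs_apply_le_opNorm (secondMoment κ x - Sig) 1 1
  simp only [Matrix.sub_apply] at hN0 hN1
  set N := opNorm (secondMoment κ x - Sig)
  have hN : 0 ≤ N := (abs_nonneg _).trans hN0
  set w := ((1 + (x : Plane) 0) ^ 2)⁻¹ with hw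
  have hw0 : 0 ≤ w := by positivity
  set w' := (1 + (x : Plane) 0) ^ (-2 - ν) with hw'
  have hw0' : 0 ≤ w' := Real.rpow_nonneg ht.le _
  have e : stepDrift κ (thinD1 c g b ν θ) (thinD2 c g b ν θ) (thinQ11 c g b) (thinQ12 c g b)
        (thinQ22 c g b ν) x - (-(1 / 2) * Sig 0 0 + c * Sig 1 1) * w =
      (thinD1 c g b ν θ x * meanIncrement κ x 0 + thinD2 c g b ν θ x * meanIncrement κ x 1) +
      (-(1 / 2) * (secondMoment κ x 0 0 - Sig 0 0) + c * (secondMoment κ x 1 1 - Sig 1 1)) * w +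
      g * secondMoment κ x 1 1 * w' := by
    simp only [stepDrift, thinQ11, thinQ12, thinQ22, e2, ← hw, ← hw']
    ring
  rw [e]
  refine (abs_add_three _ _ _).trans (add_le_add_three ?_ ?_ ?_)
  · refine (abs_add_le _ _).trans ?_
    rw [abs_mul, abs_mul, two_mul, add_mul]
    exact add_le_add (mul_le_mul hK1 hm0 (abs_nonneg _) ((abs_nonneg _).trans hK1))
      (mul_le_mul hK2 hm1 (abs_nonneg _) ((abs_nonneg _).trans hK2))
  · rw [abs_mul, abs_of_nonneg hw0]
    refine mul_le_mul_of_nonneg_right ((abs_add_le _ _).trans ?_) hw0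
    rw [abs_mul, abs_mul, add_mul]
    refine add_le_add ?_ (mul_le_mul_of_nonneg_left hN1 (abs_nonneg c))
    have : |(-(1 / 2) : ℝ)| = 1 / 2 := by norm_num
    rw [this]
    linarith [abs_nonneg (secondMoment κ x 0 0 - Sig 0 0)]
  · rw [abs_mul, abs_mul, abs_of_nonneg hw0']
    gcongr

end ThinFunction

/-! ### Drift at the boundary of thin domains. -/

/-- This is the competition in the normal derivative after multiplication by t², with p = (x 0)^β'
and X = s x 1. On a curve with β' = β the term -2Xt^(-ν), of size t^(β-ν), wins; on a curve of
smaller exponent -t^θ wins because β' < θ. -/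
lemma eventually_boundary_terms_le {a β β' C c g b s ν θ K2 K3 : ℝ} (ha : 0 < a)
    (hβ1 : β < 1) (hK3 : 0 ≤ K3) (hg : |g| = 1) (hb : |b| = 1) (hs : |s| = 1)
    (hν : 0 < ν) (hν1 : ν < 2 - 2 * β) (hθ : θ = β - 2 * ν) (hθ0 : 0 < θ)
    (hcase : (β' = β ∧ g * (β - 2 * c) ≤ 0) ∨ (β' < θ ∧ g * s * b = 1)) :
    ∀ᶠ t : ℝ in atTop, ∀ p X : ℝ, 0 ≤ p → p ≤ t ^ β' → t ^ β' / 2 ≤ p →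
      |X - a * p| ≤ C →
      g * a * (β' - 2 * c) * p - 2 * X * t ^ (-ν) - g * s * b * t ^ θ + K2 +
        K3 * t ^ (β' + 2 * β - 2) ≤ -(1 / 2 * t ^ θ) := by
  rcases hcase with ⟨rfl, hneg⟩ | ⟨hlt, hone⟩
  -- The gain a t^(β-ν) is split into three thirds. The constant 3/2 pays for a linear correction of
  -- the wrong sign (1) and for the claimed bound (1/2); the last third needs ν < 2 - 2β.
  · filter_upwards [eventually_rpow_le (2 * C + K2) (show 0 < a / 3 by positivity)
        (show (0 : ℝ) < β' - ν by linarith),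
      eventually_rpow_le (3 / 2) (show 0 < a / 3 by positivity) (show θ < β' - ν by linarith),
      eventually_rpow_le K3 (show 0 < a / 3 by positivity)
        (show β' + 2 * β' - 2 < β' - ν by linarith),
      eventually_ge_atTop 1] with t h1 h2 h3 ht p X hp0 hp hp2 hX
    have hC0 : 0 ≤ C := (abs_nonneg _).trans hX
    have ht0 : 0 < t := by linarith
    have hz0 : 0 ≤ t ^ (-ν) := Real.rpow_nonneg ht0.le _
    have hz1 : t ^ (-ν) ≤ 1 := Real.rpow_le_one_of_one_le_of_nonpos ht (by linarith)
    have hsplit : t ^ (β' - ν) = t ^ β' * t ^ (-ν) := by rw [← Real.rpow_add ht0]; ring_nf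
    rw [Real.rpow_zero, mul_one] at h1
    have g1 : g * a * (β' - 2 * c) * p ≤ 0 := by
      have : g * a * (β' - 2 * c) * p = (a * p) * (g * (β' - 2 * c)) := by ring
      rw [this]
      exact mul_nonpos_of_nonneg_of_nonpos (by positivity) hneg
    have g2 : a * t ^ (β' - ν) - 2 * C ≤ 2 * X * t ^ (-ν) := by
      have := (abs_le.1 hX).1
      rw [hsplit]
      have q0 : a * (t ^ β' / 2) ≤ a * p := by gcongr
      have q1 : (a * t ^ β' - 2 * C) * t ^ (-ν) ≤ 2 * X * t ^ (-ν) :=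
        mul_le_mul_of_nonneg_right (by linarith) hz0
      have q2 : 2 * C * t ^ (-ν) ≤ 2 * C * 1 := by gcongr
      linarith
    have g3 : -(g * s * b) * t ^ θ ≤ 1 * t ^ θ := by
      refine mul_le_mul_of_nonneg_right ((neg_le_abs _).trans (le_of_eq ?_))
        (Real.rpow_nonneg ht0.le _)
      rw [abs_mul, abs_mul, hg, hs, hb]; norm_num
    linarith
  -- Half of the gain t^θ absorbs the other terms, a quarter each for the constants and for order
  -- t^β'; the other half is the claim.
  · filter_upwards [eventually_rpow_le (2 * C + K2) (show (0 : ℝ) < 1 / 4 by norm_num) hθ0,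
      eventually_rpow_le (a * (|β'| + 2 * |c|) + K3) (show (0 : ℝ) < 1 / 4 by norm_num) hlt,
      eventually_ge_atTop 1] with t h1 h2 ht p X hp0 hp hp2 hX
    have hC0 : 0 ≤ C := (abs_nonneg _).trans hX
    have ht0 : 0 < t := by linarith
    have hz0 : 0 ≤ t ^ (-ν) := Real.rpow_nonneg ht0.le _
    have hz1 : t ^ (-ν) ≤ 1 := Real.rpow_le_one_of_one_le_of_nonpos ht (by linarith)
    rw [Real.rpow_zero, mul_one] at h1
    have g1 : g * a * (β' - 2 * c) * p ≤ a * (|β'| + 2 * |c|) * t ^ β' := by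
      calc _ ≤ |g * a * (β' - 2 * c)| * p := mul_le_mul_of_nonneg_right (le_abs_self _) hp0
        _ = a * |β' - 2 * c| * p := by rw [abs_mul, abs_mul, hg, abs_of_pos ha, one_mul]
        _ ≤ a * (|β'| + 2 * |c|) * t ^ β' := by
            gcongr
            refine (abs_sub _ _).trans ?_
            rw [abs_mul, abs_two]
    have g2 : -(2 * X * t ^ (-ν)) ≤ 2 * C := by
      have h3 : -C ≤ X := by
        have := (abs_le.1 hX).1
        have : 0 ≤ a * p := by positivity
        linarith
      have q1 : -C * t ^ (-ν) ≤ X * t ^ (-ν) := mul_le_mul_of_nonneg_right h3 hz0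
      have q2 : C * t ^ (-ν) ≤ C * 1 := by gcongr
      linarith
    have g3 : K3 * t ^ (β' + 2 * β - 2) ≤ K3 * t ^ β' :=
      mul_le_mul_of_nonneg_left (Real.rpow_le_rpow_of_exponent_le ht (by linarith)) hK3
    rw [hone]
    linarith

/-- These are the corrections' contributions to the horizontal derivative, evaluated with x 1 = sX.
As β < 1 in the applications, they are negligible against the 1/t coming from the logarithm. -/
lemma abs_lower_order_le {β A c g b s ν θ t X : ℝ} (hg : |g| = 1) (hb : |b| = 1)
    (hs : |s| = 1) (hν : 0 ≤ ν) (hθβ : θ ≤ β) (ht1 : 1 ≤ t) (hXA : |X| ≤ A * t ^ β) :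
    |-2 * c * t ^ (-2 - 1 : ℝ) * X ^ 2 + g * (-2 - ν) * t ^ (-2 - ν - 1) * X ^ 2 +
      b * (θ - 2) * t ^ (θ - 2 - 1) * (s * X)| ≤
    (2 * |c| * A ^ 2 + (2 + ν) * A ^ 2 + |θ - 2| * A) * t ^ (2 * β - 3) := by
  have ht0 : 0 < t := by linarith
  have hXsq : X ^ 2 ≤ A ^ 2 * t ^ (2 * β) := by
    have h2 : (t ^ β) ^ 2 = t ^ (2 * β) := by
      rw [sq, ← Real.rpow_add ht0]; ring_nf
    calc X ^ 2 = |X| ^ 2 := (sq_abs X).symm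
      _ ≤ (A * t ^ β) ^ 2 := by gcongr
      _ = A ^ 2 * t ^ (2 * β) := by rw [mul_pow, h2]
  have r1 : |-2 * c * t ^ (-2 - 1 : ℝ) * X ^ 2| ≤ 2 * |c| * A ^ 2 * t ^ (2 * β - 3) := by
    rw [abs_mul, abs_mul, abs_mul, abs_of_nonneg (sq_nonneg X),
      abs_of_nonneg (Real.rpow_nonneg ht0.le _), abs_neg, abs_two]
    calc 2 * |c| * t ^ (-2 - 1 : ℝ) * X ^ 2 ≤
          2 * |c| * t ^ (-2 - 1 : ℝ) * (A ^ 2 * t ^ (2 * β)) := by gcongr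
      _ = 2 * |c| * A ^ 2 * (t ^ (2 * β) * t ^ (-2 - 1 : ℝ)) := by ring
      _ = _ := by rw [← Real.rpow_add ht0]; ring_nf
  have r2 : |g * (-2 - ν) * t ^ (-2 - ν - 1) * X ^ 2| ≤
      (2 + ν) * A ^ 2 * t ^ (2 * β - 3) := by
    have q : t ^ (-2 - ν - 1) ≤ t ^ (-3 : ℝ) :=
      Real.rpow_le_rpow_of_exponent_le ht1 (by linarith)
    rw [abs_mul, abs_mul, abs_mul, abs_of_nonneg (sq_nonneg X),
      abs_of_nonneg (Real.rpow_nonneg ht0.le _), hg, abs_of_nonpos (show -2 - ν ≤ 0 by linarith)]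
    calc 1 * -(-2 - ν) * t ^ (-2 - ν - 1) * X ^ 2 = (2 + ν) * (t ^ (-2 - ν - 1) * X ^ 2) := by ring
      _ ≤ (2 + ν) * (t ^ (-3 : ℝ) * (A ^ 2 * t ^ (2 * β))) := by gcongr
      _ = (2 + ν) * A ^ 2 * (t ^ (2 * β) * t ^ (-3 : ℝ)) := by ring
      _ = _ := by rw [← Real.rpow_add ht0]; ring_nf
  have r3 : |b * (θ - 2) * t ^ (θ - 2 - 1) * (s * X)| ≤ |θ - 2| * A * t ^ (2 * β - 3) := by
    have q : t ^ (θ - 2 - 1) ≤ t ^ (β - 3) :=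
      Real.rpow_le_rpow_of_exponent_le ht1 (by linarith)
    rw [abs_mul, abs_mul, abs_mul, abs_mul s X, hb, hs,
      abs_of_nonneg (Real.rpow_nonneg ht0.le _), one_mul, one_mul]
    calc |θ - 2| * t ^ (θ - 2 - 1) * |X| ≤ |θ - 2| * t ^ (β - 3) * (A * t ^ β) := by gcongr
      _ = |θ - 2| * A * (t ^ β * t ^ (β - 3)) := by ring
      _ = _ := by rw [← Real.rpow_add ht0]; ring_nf
  refine (abs_add_three _ _ _).trans ?_
  rw [add_mul, add_mul]
  exact add_le_add_three r1 r2 r3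

/-- The derivative of `thinFn` along the inward normal of a boundary curve `x₂ = ± a x₁ ^ β'`. -/
lemma normal_derivative_thinFn_le {a β β' A C c g b s ν θ : ℝ} (ha : 0 < a) (hβ'0 : 0 ≤ β')
    (hβ' : β' ≤ β) (hβ1 : β < 1) (hA : 0 ≤ A) (hg : g ^ 2 = 1) (hb : b ^ 2 = 1) (hs : s ^ 2 = 1)
    (hν : 0 < ν) (hν1 : ν < 2 - 2 * β) (hθ : θ = β - 2 * ν) (hθ0 : 0 < θ)
    (hcase : (β' = β ∧ g * (β - 2 * c) ≤ 0) ∨ (β' < θ ∧ g * s * b = 1)) :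
    ∃ T : ℝ, ∀ x ∈ thin A β, T ≤ x 0 → |s * x 1 - a * x 0 ^ β'| ≤ C →
      g * (a * β' * x 0 ^ (β' - 1) * thinD1 c g b ν θ x - s * thinD2 c g b ν θ x) ≤
        -(1 / 2 * (1 + x 0) ^ (θ - 2)) := by
  have habs : ∀ y : ℝ, y ^ 2 = 1 → |y| = 1 := fun y hy => by
    rwa [← sq_eq_sq₀ (abs_nonneg y) zero_le_one, sq_abs, one_pow]
  have hgabs := habs g hg
  obtain ⟨K1, hK10, hK1⟩ : ∃ K1 : ℝ, 0 ≤ K1 ∧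
      K1 = 2 * |c| * A ^ 2 + (2 + ν) * A ^ 2 + |θ - 2| * A := ⟨_, by positivity, rfl⟩
  obtain ⟨T, hT⟩ := eventually_atTop.1 (eventually_boundary_terms_le (C := C)
    (K2 := a + 2 * |c| * C) (K3 := 2 * a * K1) ha hβ1 (by positivity) hgabs (habs b hb) (habs s hs)
    hν hν1 hθ hθ0 hcase)
  refine ⟨max T 1, fun x hx hxT hXC => ?_⟩
  have hu1 : 1 ≤ x 0 := (le_max_right _ _).trans hxT
  obtain ⟨u, hu⟩ : ∃ u, u = x 0 := ⟨_, rfl⟩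
  obtain ⟨t, ht⟩ : ∃ t, t = 1 + u := ⟨_, rfl⟩
  obtain ⟨p, hp⟩ : ∃ p, p = u ^ β' := ⟨_, rfl⟩
  obtain ⟨X, hXdef⟩ : ∃ X, X = s * x 1 := ⟨_, rfl⟩
  rw [← hu, ← hXdef, ← hp] at hXC
  rw [← hu] at hu1
  have hu0 : 0 < u := by linarith
  have ht1 : 1 ≤ t := by linarith
  have ht0 : 0 < t := by linarith
  have htu : t ≤ 2 * u := by linarith
  have hp0 : 0 ≤ p := hp ▸ Real.rpow_nonneg hu0.le _
  have hpt : p ≤ t ^ β' := hp ▸ Real.rpow_le_rpow hu0.le (by linarith) hβ'0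
  have hpu : p ≤ u := by
    simpa [hp] using Real.rpow_le_rpow_of_exponent_le hu1 (show β' ≤ 1 by linarith)
  have hp2 : t ^ β' / 2 ≤ p := by
    have h2 : (2 : ℝ) ^ β' ≤ 2 := by
      simpa using Real.rpow_le_rpow_of_exponent_le (show (1 : ℝ) ≤ 2 by norm_num)
        (show β' ≤ 1 by linarith)
    have h3 : t ^ β' ≤ 2 ^ β' * p := by
      rw [hp, ← Real.mul_rpow (by norm_num) hu0.le]
      exact Real.rpow_le_rpow ht0.le htu hβ'0
    nlinarith
  have hx1 : x 1 = s * X := by rw [hXdef, ← mul_assoc, ← sq, hs, one_mul]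
  have hXA : |X| ≤ A * t ^ β := by
    rw [hXdef, abs_mul, habs s hs, one_mul, ht, hu]; exact hx.2
  have hmain := hT t ((le_max_left T 1).trans (hxT.trans (by linarith))) p X hp0 hpt hp2 hXC
  obtain ⟨rest, hrest⟩ : ∃ r, r = -2 * c * t ^ (-2 - 1 : ℝ) * X ^ 2 +
    g * (-2 - ν) * t ^ (-2 - ν - 1) * X ^ 2 + b * (θ - 2) * t ^ (θ - 2 - 1) * (s * X) := ⟨_, rfl⟩
  have hrestle : |rest| ≤ K1 * t ^ (2 * β - 3) := by
    rw [hrest, hK1]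
    exact abs_lower_order_le hgabs (habs b hb) (habs s hs) hν.le (by linarith) ht1 hXA
  have hpu0 : 0 ≤ p / u := by positivity
  have hcoef : |g * a * β' * (p / u)| ≤ a * (p / u) := by
    rw [abs_mul, abs_mul, abs_mul, hgabs, abs_of_pos ha, abs_of_nonneg hβ'0,
      abs_of_nonneg hpu0, one_mul]
    have : a * β' ≤ a * 1 := by gcongr; linarith
    exact mul_le_mul_of_nonneg_right (by linarith) hpu0
  have hrestp : g * a * β' * (p / u) * rest ≤
      (t ^ 2)⁻¹ * (2 * a * K1 * t ^ (β' + 2 * β - 2)) := by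
    have q1 : p / u ≤ 2 * t ^ β' / t := by
      rw [div_le_div_iff₀ hu0 ht0]
      calc p * t ≤ t ^ β' * (2 * u) := by gcongr
        _ = _ := by ring
    have q2 : t ^ β' * t ^ (2 * β - 3) = t ^ (β' + 2 * β - 2) / t := by
      rw [← Real.rpow_add ht0, ← Real.rpow_sub_one ht0.ne']; ring_nf
    calc g * a * β' * (p / u) * rest ≤ |g * a * β' * (p / u)| * |rest| := by
          rw [← abs_mul]; exact le_abs_self _
      _ ≤ a * (2 * t ^ β' / t) * (K1 * t ^ (2 * β - 3)) := by
          refine mul_le_mul (hcoef.trans ?_) hrestle (abs_nonneg _) (by positivity)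
          gcongr
      _ = 2 * a * K1 * (t ^ β' * t ^ (2 * β - 3)) / t := by ring
      _ = _ := by rw [q2]; field_simp
  -- Replacing u = x 0 by t = u + 1 in the denominator costs p/u ≤ 1, whence the additive `a`.
  have hfirst : g * a * β' * (p / u) * t⁻¹ ≤ (t ^ 2)⁻¹ * (g * a * β' * p + a) := by
    have q1 : (p / u) * t⁻¹ = (t ^ 2)⁻¹ * (p + p / u) := by
      have : u + 1 = t := by rw [ht]; ring
      field_simp
      rw [← this]
    have q2 : g * a * β' * (p / u) ≤ a := by
      refine (le_abs_self _).trans (hcoef.trans ?_)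
      have : p / u ≤ 1 := by rw [div_le_one hu0]; exact hpu
      exact mul_le_of_le_one_right ha.le this
    calc g * a * β' * (p / u) * t⁻¹ = g * a * β' * ((p / u) * t⁻¹) := by ring
      _ = (t ^ 2)⁻¹ * (g * a * β' * p + g * a * β' * (p / u)) := by rw [q1]; ring
      _ ≤ _ := by gcongr
  -- Near the curve X may be replaced by a p up to `C`; this exposes the factor β' - 2c.
  have hcX : -(2 * g * c * X) ≤ -(2 * g * c * (a * p)) + 2 * |c| * C := by
    have q1 : 2 * g * c * (a * p - X) ≤ |2 * g * c * (a * p - X)| := le_abs_self _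
    rw [abs_mul, abs_mul, abs_mul, abs_two, hgabs, abs_sub_comm] at q1
    have q2 : 2 * 1 * |c| * |X - a * p| ≤ 2 * 1 * |c| * C := by gcongr
    linarith
  have e2 : t ^ (-2 : ℝ) = (t ^ 2)⁻¹ := by rw [Real.rpow_neg ht0.le]; simp
  have e3 : t ^ (-2 - ν) = (t ^ 2)⁻¹ * t ^ (-ν) := by
    rw [← e2, ← Real.rpow_add ht0]; ring_nf
  have e4 : t ^ (θ - 2) = (t ^ 2)⁻¹ * t ^ θ := by
    rw [← e2, ← Real.rpow_add ht0]; ring_nf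
  have hid : g * (a * β' * u ^ (β' - 1) * thinD1 c g b ν θ x - s * thinD2 c g b ν θ x) =
      g * a * β' * (p / u) * t⁻¹ + g * a * β' * (p / u) * rest +
        (t ^ 2)⁻¹ * (-(2 * g * c * X) - 2 * X * t ^ (-ν) - g * s * b * t ^ θ) := by
    have hs2 : s * (s * X) = X := by rw [← mul_assoc, ← sq, hs, one_mul]
    have hsX : (s * X) ^ 2 = X ^ 2 := by rw [mul_pow, hs, one_mul]
    simp only [thinD1, thinD2, ← hu, ← ht]
    rw [hx1, hsX, e2, e3, e4, Real.rpow_sub_one hu0.ne', hrest, ← hp]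
    linear_combination (-(2 * g * c * (t ^ 2)⁻¹) - 2 * g ^ 2 * ((t ^ 2)⁻¹ * t ^ (-ν))) * hs2 -
      2 * ((t ^ 2)⁻¹ * t ^ (-ν)) * X * hg
  rw [← hu, ← ht, hid, e4]
  have hw0 : 0 ≤ (t ^ 2)⁻¹ := by positivity
  calc _ ≤ (t ^ 2)⁻¹ * (g * a * β' * p + a) + (t ^ 2)⁻¹ * (2 * a * K1 * t ^ (β' + 2 * β - 2)) +
        (t ^ 2)⁻¹ * (-(2 * g * c * (a * p)) + 2 * |c| * C - 2 * X * t ^ (-ν) -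
          g * s * b * t ^ θ) :=
        add_le_add_three hfirst hrestp (mul_le_mul_of_nonneg_left (by linarith) hw0)
    _ = (t ^ 2)⁻¹ * (g * a * (β' - 2 * c) * p - 2 * X * t ^ (-ν) - g * s * b * t ^ θ +
        (a + 2 * |c| * C) + 2 * a * K1 * t ^ (β' + 2 * β - 2)) := by ring
    _ ≤ (t ^ 2)⁻¹ * (-(1 / 2 * t ^ θ)) := mul_le_mul_of_nonneg_left hmain hw0
    _ = _ := by ring

lemma posDef_entries {Sig : Matrix (Fin 2) (Fin 2) ℝ} (hSig : Sig.PosDef) :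
    0 < Sig 0 0 ∧ 0 < Sig 1 1 ∧ Sig 1 0 = Sig 0 1 ∧ 0 < Sig 0 0 * Sig 1 1 - Sig 0 1 ^ 2 := by
  have h10 : Sig 1 0 = Sig 0 1 := by
    have := congrFun (congrFun hSig.1 0) 1
    simpa using this
  have hdet := hSig.det_pos
  rw [Matrix.det_fin_two, h10, ← sq] at hdet
  exact ⟨hSig.diag_pos, hSig.diag_pos, h10, hdet⟩

/-- Matrices close to a positive definite one have a common lower bound as quadratic forms. -/
lemma exists_quadratic_lower_bound {Sig : Matrix (Fin 2) (Fin 2) ℝ} (hSig : Sig.PosDef) :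
    ∃ lam : ℝ, 0 < lam ∧ ∀ N : Matrix (Fin 2) (Fin 2) ℝ, opNorm (N - Sig) ≤ lam →
      ∀ a b : ℝ, lam * (a ^ 2 + b ^ 2) ≤
        a ^ 2 * N 0 0 + 2 * (a * b) * N 0 1 + b ^ 2 * N 1 1 := by
  obtain ⟨h0, h1, -, hdet⟩ := posDef_entries hSig
  set T := Sig 0 0 + Sig 1 1 with hT
  have hT0 : 0 < T := by linarith
  set lam := (Sig 0 0 * Sig 1 1 - Sig 0 1 ^ 2) / T with hlam
  have hl0 : 0 < lam := div_pos hdet hT0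
  -- Determinant over trace bounds the smallest eigenvalue of `Sig` from below. A perturbation of
  -- size lam/3 loses at most a third through the diagonal and a third through the cross term.
  refine ⟨lam / 3, by positivity, fun N hN a b => ?_⟩
  have hlow : lam * (a ^ 2 + b ^ 2) ≤
      a ^ 2 * Sig 0 0 + 2 * (a * b) * Sig 0 1 + b ^ 2 * Sig 1 1 := by
    rw [hlam, div_mul_eq_mul_div, div_le_iff₀ hT0, hT]
    nlinarith [sq_nonneg (Sig 0 0 * a + Sig 0 1 * b), sq_nonneg (Sig 0 1 * a + Sig 1 1 * b)]
  have e0 := (abs_le.1 ((abs_apply_le_opNorm (N - Sig) 0 0).trans hN)).1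
  have e1 := (abs_apply_le_opNorm (N - Sig) 0 1).trans hN
  have e2 := (abs_le.1 ((abs_apply_le_opNorm (N - Sig) 1 1).trans hN)).1
  simp only [Matrix.sub_apply] at e0 e1 e2
  have f0 := mul_le_mul_of_nonneg_left e0 (sq_nonneg a)
  have f2 := mul_le_mul_of_nonneg_left e2 (sq_nonneg b)
  have f1 : -(lam / 3 * (a ^ 2 + b ^ 2)) ≤ 2 * (a * b) * (N 0 1 - Sig 0 1) := by
    have g1 : |2 * (a * b) * (N 0 1 - Sig 0 1)| ≤ (a ^ 2 + b ^ 2) * (lam / 3) := by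
      rw [abs_mul]
      refine mul_le_mul ?_ e1 (abs_nonneg _) (by positivity)
      rw [abs_le]
      constructor <;> nlinarith [sq_nonneg (a - b), sq_nonneg (a + b)]
    linarith [(abs_le.1 g1).1]
  linarith

lemma abs_quad_le {S : Set Plane} {κ : Kernel S S} [IsMarkovKernel κ] {q M K : ℝ}
    (hM : MomentBound κ q M) (hq : 2 < q) {q11 q12 q22 : Plane → ℝ} (x : S)
    (h1 : |q11 x| ≤ K) (h2 : |q12 x| ≤ K) (h3 : |q22 x| ≤ K) :
    |q11 x * secondMoment κ x 0 0 + q12 x * secondMoment κ x 0 1 + q22 x * secondMoment κ x 1 1| ≤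
      3 * K * (1 + M) := by
  have hK : 0 ≤ K := (abs_nonneg _).trans h1
  calc _ ≤ K * (1 + M) + K * (1 + M) + K * (1 + M) := by
        refine (abs_add_three _ _ _).trans (add_le_add_three ?_ ?_ ?_) <;> rw [abs_mul]
        · exact mul_le_mul h1 (hM.abs_secondMoment_le hq x 0 0) (abs_nonneg _) hK
        · exact mul_le_mul h2 (hM.abs_secondMoment_le hq x 0 1) (abs_nonneg _) hK
        · exact mul_le_mul h3 (hM.abs_secondMoment_le hq x 1 1) (abs_nonneg _) hK
    _ = _ := by ring

lemma rad_le_two_mul_norm {x : Plane} (hx : 1 ≤ ‖x‖) : rad x ≤ 2 * ‖x‖ := by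
  unfold rad; linarith

lemma rpow_neg_two {r : ℝ} (hr : 0 < r) : r ^ (-2 : ℝ) = (r ^ 2)⁻¹ := by
  rw [Real.rpow_neg hr.le]; simp

/-- Under normal reflection the mean increment is a multiple of the normal, up to an error of
order `1 / rad`. -/
lemma ReflectsAlong.exists_decomposition {S T : Set Plane} {κ : Kernel S S} {n : Plane → Plane}
    (hR : ReflectsAlong κ T n) : ∃ c C R : ℝ, 0 < c ∧ 0 ≤ C ∧ ∀ x : S, (x : Plane) ∈ T →
      R ≤ ‖(x : Plane)‖ → ∃ μ ρ₀ ρ₁ : ℝ, c ≤ μ ∧ |ρ₀| ≤ C / rad x ∧ |ρ₁| ≤ C / rad x ∧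
        meanIncrement κ x 0 = μ * n x 0 + ρ₀ ∧ meanIncrement κ x 1 = μ * n x 1 + ρ₁ := by
  obtain ⟨μ, ⟨c₀, R₁, hc₀, hμ⟩, Cr, R₂, -, hmean⟩ := hR
  refine ⟨c₀, 2 * |Cr|, max (max R₁ R₂) 1, hc₀, by positivity, fun x hx hxR => ?_⟩
  have hx1 : R₁ ≤ ‖(x : Plane)‖ := ((le_max_left _ _).trans (le_max_left _ _)).trans hxR
  have hx2 : R₂ ≤ ‖(x : Plane)‖ := ((le_max_right _ _).trans (le_max_left _ _)).trans hxR
  have hx4 : 1 ≤ ‖(x : Plane)‖ := (le_max_right _ _).trans hxR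
  have hr := rad_pos (x : Plane)
  have hρn : ‖meanIncrement κ x - μ x • n x‖ ≤ 2 * |Cr| / rad x := by
    refine (hmean _ hx2 x hx le_rfl).trans ?_
    rw [← div_eq_mul_inv, div_le_div_iff₀ (by linarith) hr]
    calc Cr * rad x ≤ |Cr| * (2 * ‖(x : Plane)‖) :=
          mul_le_mul (le_abs_self _) (rad_le_two_mul_norm hx4) hr.le (abs_nonneg _)
      _ = _ := by ring
  refine ⟨μ x, _, _, hμ x hx hx1, (abs_coord_le_norm _ 0).trans hρn,
    (abs_coord_le_norm _ 1).trans hρn, ?_, ?_⟩ <;> simp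

set_option maxHeartbeats 1000000 in
/-- Near a boundary curve `x₂ = ± a x₁ ^ β'` with reflection along the normal, the drift of
`thinFn` has the sign opposite to `g` and dominates the second order terms. -/
lemma boundary_stepDrift_thinFn_le {S T : Set Plane} {κ : Kernel S S} [IsMarkovKernel κ]
    {q M a β β' A C c g b s ν θ : ℝ} (hM : MomentBound κ q M) (hq : 2 < q)
    (ha : 0 < a) (hβ'0 : 0 ≤ β')
    (hβ' : β' ≤ β) (hβ1 : β < 1) (hA : 0 ≤ A) (hg : g ^ 2 = 1) (hb : b ^ 2 = 1) (hs : s ^ 2 = 1)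
    (hν : 0 < ν) (hν1 : ν < 2 - 2 * β) (hθ : θ = β - 2 * ν) (hθ0 : 0 < θ)
    (hcase : (β' = β ∧ g * (β - 2 * c) ≤ 0) ∨ (β' < θ ∧ g * s * b = 1))
    (hsc : LogScale (thin A β) (thinD1 c g b ν θ) (thinD2 c g b ν θ)
      (thinQ11 c g b) (thinQ12 c g b) (thinQ22 c g b ν))
    {n : Plane → Plane} (hR : ReflectsAlong κ T n) (hT : T ⊆ thin A β)
    (hn : ∀ x, n x = (Real.sqrt (1 + (a * β' * x 0 ^ (β' - 1)) ^ 2))⁻¹ •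
      !₂[a * β' * x 0 ^ (β' - 1), -s])
    {R₀ : ℝ} (hnear : ∀ x ∈ T, R₀ ≤ x 0 → |s * x 1 - a * x 0 ^ β'| ≤ C) :
    ∃ R : ℝ, ∀ x : S, (x : Plane) ∈ T → R ≤ ‖(x : Plane)‖ →
      g * stepDrift κ (thinD1 c g b ν θ) (thinD2 c g b ν θ) (thinQ11 c g b) (thinQ12 c g b)
        (thinQ22 c g b ν) x ≤ -(1 * rad x ^ (-2 : ℝ)) := by
  obtain ⟨T₁, hT₁⟩ := normal_derivative_thinFn_le (c := c) (C := C) ha hβ'0 hβ' hβ1 hA hg hb hs hν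
    hν1 hθ hθ0 hcase
  obtain ⟨K, hK, hsc⟩ := hsc
  obtain ⟨c₀, Cr, R₁, hc₀, hCr, hmean⟩ := hR.exists_decomposition
  have hgabs : |g| = 1 := by rwa [← sq_eq_sq₀ (abs_nonneg g) zero_le_one, sq_abs, one_pow]
  -- The factors of `k` bound below, in order, the reflection strength, the normalization of the
  -- normal, the coefficient of the normal derivative, and the loss in passing from 1 + x 0 to
  -- `rad`.
  obtain ⟨k, hk0, hk⟩ : ∃ k : ℝ, 0 < k ∧ k = c₀ * (1 + a)⁻¹ * (1 / 2) *
    ((1 + A) ^ (2 - θ))⁻¹ := ⟨_, by positivity, rfl⟩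
  obtain ⟨K4, hK4⟩ : ∃ K4 : ℝ, K4 = 2 * K * Cr + 3 * K * (1 + M) := ⟨_, rfl⟩
  -- The reflection term has order rad^(θ-2) and θ > 0, so it beats all terms of order rad⁻²,
  -- collected in `K4`, with rad⁻² to spare.
  obtain ⟨R₃, hR₃⟩ := eventually_atTop.1 (eventually_rpow_le (K4 + 1) hk0 hθ0)
  refine ⟨max (max R₁ R₃) ((1 + A) * (1 + max (max R₀ T₁) 1)), fun x hx hxR => ?_⟩
  have hx1 : R₁ ≤ ‖(x : Plane)‖ := ((le_max_left _ _).trans (le_max_left _ _)).trans hxR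
  have hx3 : R₃ ≤ ‖(x : Plane)‖ := ((le_max_right _ _).trans (le_max_left _ _)).trans hxR
  have hx5 := (le_max_right _ _).trans hxR
  have hxT := hT hx
  obtain ⟨s1, s2, s3⟩ := thin_scale hA hβ1.le x hxT
  have hA1 : 0 < 1 + A := by linarith
  have hx0 : max (max R₀ T₁) 1 ≤ (x : Plane) 0 := by
    have h1 : (1 + A) * (1 + max (max R₀ T₁) 1) ≤ (1 + A) * (1 + (x : Plane) 0) :=
      hx5.trans ((le_add_of_nonneg_left zero_le_one).trans s3)
    linarith [le_of_mul_le_mul_left h1 hA1]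
  have hxR0 := ((le_max_left _ _).trans (le_max_left _ _)).trans hx0
  have hxT1 := ((le_max_right _ _).trans (le_max_left _ _)).trans hx0
  have hxone : 1 ≤ (x : Plane) 0 := (le_max_right _ _).trans hx0
  have hder := hT₁ x hxT hxT1 (hnear x hx hxR0)
  obtain ⟨μ, ρ₀, ρ₁, hμx, hρ0, hρ1, hm0, hm1⟩ := hmean x hx hx1
  obtain ⟨d1, d2, d3, d4, d5⟩ := hsc x hxT
  have hr := rad_pos (x : Plane)
  have hlarge := hR₃ (rad x) (hx3.trans (le_add_of_nonneg_left zero_le_one))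
  rw [Real.rpow_zero, mul_one] at hlarge
  have hquad := abs_quad_le hM hq x d3 d4 d5
  obtain ⟨w, hw⟩ : ∃ w, w = a * β' * (x : Plane) 0 ^ (β' - 1) := ⟨_, rfl⟩
  have hw0 : 0 ≤ w := by
    rw [hw]; exact mul_nonneg (mul_nonneg ha.le hβ'0) (Real.rpow_nonneg (by linarith) _)
  have hwa : w ≤ a := by
    rw [hw]
    have p1 : (x : Plane) 0 ^ (β' - 1) ≤ 1 :=
      Real.rpow_le_one_of_one_le_of_nonpos hxone (by linarith)
    calc a * β' * (x : Plane) 0 ^ (β' - 1) ≤ a * 1 * 1 :=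
          mul_le_mul (mul_le_mul_of_nonneg_left (by linarith) ha.le) p1
            (Real.rpow_nonneg (by linarith) _) (by linarith)
      _ = a := by ring
  obtain ⟨N, hN⟩ : ∃ N, N = (Real.sqrt (1 + w ^ 2))⁻¹ := ⟨_, rfl⟩
  have hNlow : (1 + a)⁻¹ ≤ N := by
    rw [hN]
    refine inv_anti₀ (Real.sqrt_pos.2 (by positivity)) ?_
    rw [Real.sqrt_le_left (by positivity)]
    nlinarith
  rw [hn, ← hw, ← hN] at hm0 hm1
  simp only [PiLp.smul_apply, smul_eq_mul, Matrix.cons_val_zero, Matrix.cons_val_one] at hm0 hm1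
  rw [← hw] at hder
  obtain ⟨E1, hE1⟩ : ∃ E1, E1 = thinD1 c g b ν θ x := ⟨_, rfl⟩
  obtain ⟨E2, hE2⟩ : ∃ E2, E2 = thinD2 c g b ν θ x := ⟨_, rfl⟩
  rw [← hE1] at hder d1
  rw [← hE2] at hder d2
  obtain ⟨Y, hY⟩ : ∃ Y, Y = thinQ11 c g b x * secondMoment κ x 0 0 +
    thinQ12 c g b x * secondMoment κ x 0 1 + thinQ22 c g b ν x * secondMoment κ x 1 1 := ⟨_, rfl⟩
  rw [← hY] at hquad
  have hid : g * stepDrift κ (thinD1 c g b ν θ) (thinD2 c g b ν θ) (thinQ11 c g b) (thinQ12 c g b)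
      (thinQ22 c g b ν) x = μ * N * (g * (w * E1 - s * E2)) + g * (E1 * ρ₀ + E2 * ρ₁) +
        g * Y := by
    simp only [stepDrift, ← hE1, ← hE2, ← hY, hm0, hm1]
    ring
  have b2 : g * (E1 * ρ₀ + E2 * ρ₁) ≤ 2 * K * Cr * (rad x ^ 2)⁻¹ := by
    calc _ ≤ |g * (E1 * ρ₀ + E2 * ρ₁)| := le_abs_self _
      _ ≤ |E1| * |ρ₀| + |E2| * |ρ₁| := by
          rw [abs_mul, hgabs, one_mul, ← abs_mul, ← abs_mul]; exact abs_add_le _ _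
      _ ≤ K / rad x * (Cr / rad x) + K / rad x * (Cr / rad x) :=
          add_le_add (mul_le_mul d1 hρ0 (abs_nonneg _) (by positivity))
            (mul_le_mul d2 hρ1 (abs_nonneg _) (by positivity))
      _ = _ := by field_simp; ring
  have b3 : g * Y ≤ 3 * K * (1 + M) * (rad x ^ 2)⁻¹ := by
    calc g * Y ≤ |g * Y| := le_abs_self _
      _ ≤ 3 * (K / rad x ^ 2) * (1 + M) := by rw [abs_mul, hgabs, one_mul]; exact hquad
      _ = _ := by ring
  obtain ⟨P, hP⟩ : ∃ P, P = (1 + (x : Plane) 0) ^ (θ - 2) := ⟨_, rfl⟩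
  rw [← hP] at hder
  have hpow : ((1 + A) ^ (2 - θ))⁻¹ * (rad x ^ θ * (rad x ^ 2)⁻¹) ≤ P := by
    calc _ = ((1 + A) * rad x) ^ (θ - 2) := by
          rw [Real.mul_rpow hA1.le hr.le, ← rpow_neg_two hr, ← Real.rpow_add hr,
            ← Real.rpow_neg hA1.le]
          ring_nf
      _ ≤ _ := by
          rw [hP]; exact Real.rpow_le_rpow_of_nonpos (by linarith) s2 (by linarith)
  have b1 : μ * N * (g * (w * E1 - s * E2)) ≤ -(k * rad x ^ θ * (rad x ^ 2)⁻¹) := by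
    have p0 : 0 < (1 + a)⁻¹ := by positivity
    have p1 : c₀ * (1 + a)⁻¹ ≤ μ * N := mul_le_mul hμx hNlow p0.le (hc₀.le.trans hμx)
    have p2 : 0 ≤ P := by rw [hP]; exact Real.rpow_nonneg (by linarith) _
    have p3 := mul_pos hc₀ p0
    have p4 := mul_le_mul_of_nonneg_left hder (p3.le.trans p1)
    have p5 := mul_le_mul_of_nonneg_right p1 p2
    have p6 := mul_le_mul_of_nonneg_left hpow p3.le
    have p7 : k * rad x ^ θ * (rad x ^ 2)⁻¹ = 1 / 2 * (c₀ * (1 + a)⁻¹ *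
        (((1 + A) ^ (2 - θ))⁻¹ * (rad x ^ θ * (rad x ^ 2)⁻¹))) := by rw [hk]; ring
    linarith only [p4, p5, p6, p7]
  rw [hid, rpow_neg_two hr]
  have hri : 0 ≤ (rad (x : Plane) ^ 2)⁻¹ := by positivity
  have hfin := mul_le_mul_of_nonneg_right hlarge hri
  rw [hK4] at hfin
  linarith only [hfin, b1, b2, b3]

/-! ### Geometry of the boundary layer for exponents at most one. -/

section Layer

lemma exists_dist_lt_of_infDist_le {E : Set Plane} (hE : E.Nonempty) {x : Plane} {B : ℝ}
    (h : Metric.infDist x E ≤ B) : ∃ y ∈ E, dist x y < B + 1 :=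
  (Metric.infDist_lt_iff hE).1 (lt_of_le_of_lt h (lt_add_one B))

/-- For exponents in [0, 1] the power is subadditive, so a bounded horizontal shift changes the
height of the curve by a bounded amount. -/
lemma curve_sub_le_of_dist_lt {a γ B s : ℝ} (ha : 0 ≤ a) (hγ0 : 0 ≤ γ) (hγ1 : γ ≤ 1)
    (hs : |s| = 1) {x y : Plane} (hd : dist x y < B) (hx : B ≤ x 0)
    (hy : a * y 0 ^ γ < s * y 1) : a * x 0 ^ γ - (a * B ^ γ + B) ≤ s * x 1 := by
  rw [dist_eq_norm] at hd
  have h0 := (abs_coord_le_norm (x - y) 0).trans_lt hd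
  have h1 := (abs_coord_le_norm (x - y) 1).trans_lt hd
  simp only [PiLp.sub_apply] at h0 h1
  have hB : 0 < B := (norm_nonneg _).trans_lt hd
  have hy0 : 0 ≤ y 0 := by linarith [(abs_lt.1 h0).2]
  have hpow : x 0 ^ γ ≤ y 0 ^ γ + B ^ γ := by
    calc x 0 ^ γ ≤ (y 0 + B) ^ γ :=
          Real.rpow_le_rpow (by linarith) (by linarith [(abs_lt.1 h0).2]) hγ0
      _ ≤ _ := Real.rpow_add_le_add_rpow hy0 hB.le hγ0 hγ1
  have h2 : |s * (x 1 - y 1)| < B := by rwa [abs_mul, hs, one_mul]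
  have h3 := (abs_lt.1 h2).1
  have h4 := mul_le_mul_of_nonneg_left hpow ha
  linarith

/-- Points of the boundary layer on one side of the axis are close to the boundary curve on that
side. -/
lemma layer_near_curve {D DB : Set Plane} {a a' γ γ' s B : ℝ} (ha : 0 ≤ a) (ha' : 0 < a')
    (hγ0 : 0 ≤ γ) (hγ1 : γ ≤ 1) (hγ'0 : 0 ≤ γ') (hγ'1 : γ' ≤ 1) (hs : |s| = 1)
    (hD : ∀ x, x ∈ D ↔ 0 ≤ x 0 ∧ s * x 1 ≤ a * x 0 ^ γ ∧ -(s * x 1) ≤ a' * x 0 ^ γ')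
    (hDB : IsBoundaryLayer D DB B)
    (hflat : γ' = 0 → ∀ x ∈ DB, 0 ≤ s * x 1 → Metric.infDist x (Dᶜ ∩ {y | 0 < s * y 1}) ≤ B) :
    ∃ C R : ℝ, ∀ x ∈ DB, R ≤ x 0 → 0 ≤ s * x 1 → |s * x 1 - a * x 0 ^ γ| ≤ C := by
  have hss : s * s = 1 := by
    rw [← abs_mul_abs_self, hs, one_mul]
  -- Extracting a near point from `Metric.infDist` requires a nonempty set. The second coordinate
  -- `s` gives s · s = 1 > 0, as needed when the opposite boundary is flat.
  have hw : (!₂[-1, s] : Plane) ∈ Dᶜ := fun h => by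
    have := ((hD _).1 h).1
    norm_num at this
  obtain ⟨R₁, hR₁⟩ : ∃ R₁ : ℝ, ∀ u, R₁ ≤ u → γ' ≠ 0 →
      a' * (B + 1) ^ γ' + (B + 1) < a' * u ^ γ' := by
    by_cases h : γ' = 0
    · exact ⟨0, fun u _ h' => absurd h h'⟩
    · have hlim : Tendsto (fun u : ℝ => a' * u ^ γ') atTop atTop :=
        (tendsto_rpow_atTop (lt_of_le_of_ne hγ'0 (Ne.symm h))).const_mul_atTop ha'
      obtain ⟨R₁, h₁⟩ := eventually_atTop.1
        (hlim.eventually_gt_atTop (a' * (B + 1) ^ γ' + (B + 1)))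
      exact ⟨R₁, fun u hu _ => h₁ u hu⟩
  refine ⟨|a * (B + 1) ^ γ + (B + 1)|, max R₁ (B + 1), fun x hx hxR hx1 => ?_⟩
  have hxB : B + 1 ≤ x 0 := (le_max_right _ _).trans hxR
  have hup := ((hD x).1 (hDB.1 hx)).2.1
  suffices h : a * x 0 ^ γ - (a * (B + 1) ^ γ + (B + 1)) ≤ s * x 1 by
    rw [abs_le]
    constructor <;> linarith [le_abs_self (a * (B + 1) ^ γ + (B + 1)),
      abs_nonneg (a * (B + 1) ^ γ + (B + 1))]
  have hout : ∃ y ∈ Dᶜ, dist x y < B + 1 ∧ (γ' = 0 → 0 < s * y 1) := by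
    by_cases h : γ' = 0
    · obtain ⟨y, hy, hd⟩ := exists_dist_lt_of_infDist_le
        (⟨!₂[-1, s], hw, by simp [hss]⟩ : (Dᶜ ∩ {y : Plane | 0 < s * y 1}).Nonempty)
        (hflat h x hx hx1)
      exact ⟨y, hy.1, hd, fun _ => hy.2⟩
    · obtain ⟨y, hy, hd⟩ := exists_dist_lt_of_infDist_le ⟨_, hw⟩ (hDB.2 x hx)
      exact ⟨y, hy, hd, fun h' => absurd h' h⟩
  obtain ⟨y, hy, hd, hy1⟩ := hout
  have hy0 : 0 ≤ y 0 := by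
    have h0 := (abs_coord_le_norm (x - y) 0).trans_lt (by rwa [← dist_eq_norm])
    simp only [PiLp.sub_apply] at h0
    linarith [(abs_lt.1 h0).2]
  by_cases hc : a * y 0 ^ γ < s * y 1
  · exact curve_sub_le_of_dist_lt ha hγ0 hγ1 hs hd hxB hc
  -- Otherwise `y` lies beyond the opposite curve. If γ' > 0 that curve is too far from `x`; if γ' =
  -- 0 the point was chosen with 0 < s y 1.
  · exfalso
    have hlow : a' * y 0 ^ γ' < -(s * y 1) := by
      by_contra hcon
      exact hy ((hD y).2 ⟨hy0, not_lt.1 hc, not_lt.1 hcon⟩)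
    have hpos : 0 ≤ a' * y 0 ^ γ' := mul_nonneg ha'.le (Real.rpow_nonneg hy0 _)
    by_cases h : γ' = 0
    · linarith [hy1 h]
    · have h1 := curve_sub_le_of_dist_lt (s := -s) ha'.le hγ'0 hγ'1 (by rwa [abs_neg]) hd hxB
        (by linarith)
      have h2 := hR₁ (x 0) ((le_max_left _ _).trans hxR) h
      linarith

end Layer

/-! ### Interior drift of the thin Lyapunov function. -/

section InteriorRates

variable {S : Set Plane} {κ : Kernel S S} {I : Set Plane} {Sig : Matrix (Fin 2) (Fin 2) ℝ}

lemma exists_interior_error_le (hZ : ZeroDrift κ I) (hC : Covariance κ I Sig) {ε : ℝ}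
    (hε : 0 < ε) : ∃ R : ℝ, ∀ x : S, (x : Plane) ∈ I → R ≤ ‖(x : Plane)‖ →
      ‖meanIncrement κ x‖ ≤ ε * (rad x)⁻¹ ∧ opNorm (secondMoment κ x - Sig) ≤ ε := by
  obtain ⟨R₁, -, h₁⟩ := hZ (ε / 2) (half_pos hε)
  obtain ⟨R₂, h₂⟩ := hC ε hε
  refine ⟨max (max R₁ R₂) 1, fun x hx hR => ?_⟩
  have hR1 : R₁ ≤ ‖(x : Plane)‖ := ((le_max_left _ _).trans (le_max_left _ _)).trans hR
  have hR2 : R₂ ≤ ‖(x : Plane)‖ := ((le_max_right _ _).trans (le_max_left _ _)).trans hR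
  have hx1 : 1 ≤ ‖(x : Plane)‖ := (le_max_right _ _).trans hR
  refine ⟨(h₁ _ hR1 x hx le_rfl).trans ?_, h₂ _ hR2 x hx le_rfl⟩
  have := rad_pos (x : Plane)
  rw [← div_eq_mul_inv, ← div_eq_mul_inv, div_le_div_iff₀ (by linarith) this]
  nlinarith [rad_le_two_mul_norm hx1]

lemma rpow_norm_le_rad {x : Plane} (hx : 1 ≤ ‖x‖) {a : ℝ} (ha : 0 ≤ a) :
    ‖x‖ ^ (-a) ≤ 2 ^ a * rad x ^ (-a) := by
  have hr := rad_pos x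
  have h := Real.rpow_le_rpow_of_nonpos (by linarith : 0 < rad x / 2)
    (by linarith [rad_le_two_mul_norm hx] : rad x / 2 ≤ ‖x‖) (neg_nonpos.2 ha)
  refine h.trans (le_of_eq ?_)
  rw [Real.div_rpow hr.le (by norm_num), Real.rpow_neg (by norm_num : (0 : ℝ) ≤ 2)]
  field_simp

/-- A single rate, the smaller of the two, serves both the drift and the covariance, so that they
can enter as one error parameter. -/
lemma exists_interior_error_rate (hZ : ZeroDriftPlus κ I) (hC : CovariancePlus κ I Sig) :
    ∃ ε C R : ℝ, 0 < ε ∧ 0 ≤ C ∧ ∀ x : S, (x : Plane) ∈ I → R ≤ ‖(x : Plane)‖ →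
      ‖meanIncrement κ x‖ ≤ C * rad x ^ (-ε) * (rad x)⁻¹ ∧
        opNorm (secondMoment κ x - Sig) ≤ C * rad x ^ (-ε) := by
  obtain ⟨ε₁, hε₁, C₁, R₁, -, h₁⟩ := hZ
  obtain ⟨ε₂, hε₂, C₂, R₂, -, h₂⟩ := hC
  refine ⟨min ε₁ ε₂, max (|C₁| * 2 ^ (1 + ε₁)) (|C₂| * 2 ^ ε₂), max (max R₁ R₂) 1,
    lt_min hε₁ hε₂, le_max_of_le_left (by positivity), fun x hx hR => ?_⟩
  have hR1 : R₁ ≤ ‖(x : Plane)‖ := ((le_max_left _ _).trans (le_max_left _ _)).trans hR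
  have hR2 : R₂ ≤ ‖(x : Plane)‖ := ((le_max_right _ _).trans (le_max_left _ _)).trans hR
  have hx1 : 1 ≤ ‖(x : Plane)‖ := (le_max_right _ _).trans hR
  have hr := rad_pos (x : Plane)
  have hr1 := one_le_rad (x : Plane)
  constructor
  · refine (h₁ _ hR1 x hx le_rfl).trans ?_
    calc C₁ * ‖(x : Plane)‖ ^ (-1 - ε₁) ≤ |C₁| * (2 ^ (1 + ε₁) * rad x ^ (-(1 + ε₁))) := by
          rw [show -1 - ε₁ = -(1 + ε₁) by ring]
          exact mul_le_mul (le_abs_self _) (rpow_norm_le_rad hx1 (by linarith))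
            (Real.rpow_nonneg (norm_nonneg _) _) (abs_nonneg _)
      _ = |C₁| * 2 ^ (1 + ε₁) * rad x ^ (-ε₁) * (rad x)⁻¹ := by
          rw [show -(1 + ε₁) = -ε₁ - 1 by ring, Real.rpow_sub_one hr.ne']; ring
      _ ≤ _ := by
          gcongr ?_ * ?_ * _
          · exact le_max_left _ _
          · exact Real.rpow_le_rpow_of_exponent_le hr1 (neg_le_neg (min_le_left _ _))
  · refine (h₂ _ hR2 x hx le_rfl).trans ?_
    calc C₂ * ‖(x : Plane)‖ ^ (-ε₂) ≤ |C₂| * (2 ^ ε₂ * rad x ^ (-ε₂)) :=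
          mul_le_mul (le_abs_self _) (rpow_norm_le_rad hx1 hε₂.le)
            (Real.rpow_nonneg (norm_nonneg _) _) (abs_nonneg _)
      _ = |C₂| * 2 ^ ε₂ * rad x ^ (-ε₂) := by ring
      _ ≤ _ := by
          gcongr ?_ * ?_
          · exact le_max_right _ _
          · exact Real.rpow_le_rpow_of_exponent_le hr1 (neg_le_neg (min_le_right _ _))

end InteriorRates

section ThinInterior

variable {S : Set Plane} {κ : Kernel S S} [IsMarkovKernel κ] {q M A β c g b ν θ : ℝ}

lemma thin_inv_sq_bounds (hA : 0 ≤ A) (hβ : β ≤ 1) {x : Plane} (hx : x ∈ thin A β) :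
    ((1 + x 0) ^ 2)⁻¹ ≤ (1 + A) ^ 2 * rad x ^ (-2 : ℝ) ∧
      ((1 + A) ^ 2)⁻¹ * rad x ^ (-2 : ℝ) ≤ ((1 + x 0) ^ 2)⁻¹ := by
  obtain ⟨h1, h2, h3⟩ := thin_scale hA hβ x hx
  have hr := rad_pos x
  have ht : 0 < 1 + x 0 := by linarith
  rw [rpow_neg_two hr]
  constructor
  · rw [← div_eq_mul_inv, inv_eq_one_div, div_le_div_iff₀ (by positivity) (by positivity), one_mul,
      ← mul_pow]
    gcongr
  · rw [← mul_inv, ← mul_pow]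
    gcongr

/-- Leaving `δ` free lets one estimate serve both regimes: a small constant off criticality, a
negative power of `rad` at criticality. -/
lemma exists_interior_stepDrift_thinFn_le (hM : MomentBound κ q M) (hM0 : 0 ≤ M) (hq : 2 < q)
    (hA : 0 ≤ A) (hβ : β ≤ 1) (hν : 0 ≤ ν) (hS : S ⊆ thin A β)
    (hsc : LogScale (thin A β) (thinD1 c g b ν θ) (thinD2 c g b ν θ)
      (thinQ11 c g b) (thinQ12 c g b) (thinQ22 c g b ν)) (Sig : Matrix (Fin 2) (Fin 2) ℝ) :
    ∃ C : ℝ, 0 ≤ C ∧ ∀ (x : S) (δ : ℝ), ‖meanIncrement κ x‖ ≤ δ * (rad x)⁻¹ →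
      opNorm (secondMoment κ x - Sig) ≤ δ →
      |stepDrift κ (thinD1 c g b ν θ) (thinD2 c g b ν θ) (thinQ11 c g b) (thinQ12 c g b)
        (thinQ22 c g b ν) x - (-(1 / 2) * Sig 0 0 + c * Sig 1 1) * ((1 + (x : Plane) 0) ^ 2)⁻¹| ≤
      C * (δ * rad x ^ (-2 : ℝ) + rad x ^ (-2 - ν)) := by
  obtain ⟨K, hK, hsc⟩ := hsc
  obtain ⟨C₁, hC₁⟩ : ∃ C₁, C₁ = 2 * K + (1 + |c|) * (1 + A) ^ 2 := ⟨_, rfl⟩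
  obtain ⟨C₂, hC₂⟩ : ∃ C₂, C₂ = |g| * (1 + M) * (1 + A) ^ (2 + ν) := ⟨_, rfl⟩
  have hC₁0 : 0 ≤ C₁ := by rw [hC₁]; positivity
  have hC₂0 : 0 ≤ C₂ := by rw [hC₂]; positivity
  refine ⟨C₁ + C₂, by positivity, fun x δ hm hN => ?_⟩
  have hxT := hS x.2
  obtain ⟨s1, s2, s3⟩ := thin_scale hA hβ x hxT
  have hr := rad_pos (x : Plane)
  have hδ : 0 ≤ δ := by
    have := (norm_nonneg _).trans hm
    exact nonneg_of_mul_nonneg_left this (inv_pos.2 hr)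
  have h := abs_stepDrift_thinFn_sub_le (g := g) (b := b) (ν := ν) (θ := θ) (c := c) hM hq Sig x hxT
    (hsc x hxT).1 (hsc x hxT).2.1
  refine h.trans ?_
  have hA1 : 0 < 1 + A := by linarith
  have p1 : 2 * (K / rad x) * ‖meanIncrement κ x‖ ≤ 2 * K * (δ * rad x ^ (-2 : ℝ)) := by
    calc _ ≤ 2 * (K / rad x) * (δ * (rad x)⁻¹) := by gcongr
      _ = _ := by rw [rpow_neg_two hr]; field_simp
  have p2 : (1 + |c|) * opNorm (secondMoment κ x - Sig) * ((1 + (x : Plane) 0) ^ 2)⁻¹ ≤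
      (1 + |c|) * (1 + A) ^ 2 * (δ * rad x ^ (-2 : ℝ)) := by
    calc _ ≤ (1 + |c|) * δ * ((1 + A) ^ 2 * rad x ^ (-2 : ℝ)) := by
          gcongr
          exact (thin_inv_sq_bounds hA hβ hxT).1
      _ = _ := by ring
  have p3 : |g| * (1 + M) * (1 + (x : Plane) 0) ^ (-2 - ν) ≤
      |g| * (1 + M) * (1 + A) ^ (2 + ν) * rad x ^ (-2 - ν) := by
    have ht : rad x / (1 + A) ≤ 1 + (x : Plane) 0 := by
      rw [div_le_iff₀ hA1]; linarith
    have := Real.rpow_le_rpow_of_nonpos (by positivity) ht (show -2 - ν ≤ 0 by linarith)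
    calc _ ≤ |g| * (1 + M) * (rad x / (1 + A)) ^ (-2 - ν) := by gcongr
      _ = _ := by
        rw [Real.div_rpow hr.le hA1.le, show -2 - ν = -(2 + ν) by ring, Real.rpow_neg hA1.le]
        field_simp
  have e1 : 0 ≤ δ * rad x ^ (-2 : ℝ) := mul_nonneg hδ (Real.rpow_nonneg hr.le _)
  have e2 : 0 ≤ rad (x : Plane) ^ (-2 - ν) := Real.rpow_nonneg hr.le _
  rw [← hC₂] at p3
  have p4 := mul_nonneg hC₂0 e1
  have p5 := mul_nonneg hC₁0 e2
  have p6 : C₁ * (δ * rad x ^ (-2 : ℝ)) = 2 * K * (δ * rad x ^ (-2 : ℝ)) +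
    (1 + |c|) * (1 + A) ^ 2 * (δ * rad x ^ (-2 : ℝ)) := by rw [hC₁]; ring
  linarith only [p1, p2, p3, p4, p5, p6]

/-- Far away in the thin domain the gradient of `thinFn` is of exact order `1 / rad`. -/
lemma exists_thinD1_lower_bound (hA : 0 ≤ A) (hβ : β < 1) (hg : g ^ 2 = 1) (hb : b ^ 2 = 1)
    (hν : 0 ≤ ν) (hθ : θ ≤ β) : ∃ R : ℝ, ∀ x ∈ thin A β, R ≤ ‖x‖ →
      (2 * (1 + A))⁻¹ * (rad x)⁻¹ ≤ thinD1 c g b ν θ x := by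
  have habs : ∀ y : ℝ, y ^ 2 = 1 → |y| = 1 := fun y hy => by
    rwa [← sq_eq_sq₀ (abs_nonneg y) zero_le_one, sq_abs, one_pow]
  obtain ⟨T, hT⟩ := eventually_atTop.1 (eventually_rpow_le
    (2 * |c| * A ^ 2 + (2 + ν) * A ^ 2 + |θ - 2| * A) (half_pos one_pos)
    (show 2 * β - 3 < -1 by linarith))
  have hA1 : 0 < 1 + A := by linarith
  refine ⟨(1 + A) * T, fun x hx hR => ?_⟩
  obtain ⟨s1, s2, s3⟩ := thin_scale hA hβ.le x hx
  have hr := rad_pos x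
  have ht : 0 < 1 + x 0 := by linarith
  have hTt : T ≤ 1 + x 0 := le_of_mul_le_mul_left
    ((hR.trans (le_add_of_nonneg_left zero_le_one)).trans s3) hA1
  have h1 := (abs_le.1 (abs_lower_order_le (c := c) (s := 1) (X := x 1) (habs g hg) (habs b hb)
    abs_one hν hθ s1 hx.2)).1
  have h2 := hT _ hTt
  rw [Real.rpow_neg_one] at h2
  have e : -2 * c * (1 + x 0) ^ (-2 - 1 : ℝ) * x 1 ^ 2 +
      g * (-2 - ν) * (1 + x 0) ^ (-2 - ν - 1) * x 1 ^ 2 +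
      b * (θ - 2) * (1 + x 0) ^ (θ - 2 - 1) * (1 * x 1) = thinD1 c g b ν θ x - (1 + x 0)⁻¹ := by
    simp only [thinD1]; ring
  rw [e] at h1
  have h3 : (2 * (1 + A))⁻¹ * (rad x)⁻¹ ≤ 1 / 2 * (1 + x 0)⁻¹ := by
    rw [← mul_inv, ← one_div, ← div_eq_mul_inv, div_div, div_le_div_iff₀ (by positivity)
      (by positivity)]
    linarith
  linarith only [h1, h2, h3]

end ThinInterior

/-- The base 1 + x 0 ≥ 1 makes powers monotone in the exponent, so a single curve with the larger
exponent contains both boundaries. -/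
lemma domain_subset_thin {aP aM βP βM : ℝ} (haP : 0 < aP) (haM : 0 < aM) (hβP : 0 ≤ βP)
    (hβM : 0 ≤ βM) : domain aP aM βP βM ⊆ thin (max aP aM) (max βP βM) := by
  rintro x ⟨h0, h1, h2⟩
  have key : ∀ a γ : ℝ, 0 < a → 0 ≤ γ → a ≤ max aP aM → γ ≤ max βP βM →
      a * x 0 ^ γ ≤ max aP aM * (1 + x 0) ^ max βP βM := fun a γ ha hγ ha' hγ' =>
    mul_le_mul ha' ((Real.rpow_le_rpow h0 (by linarith) hγ).trans
      (Real.rpow_le_rpow_of_exponent_le (by linarith) hγ')) (Real.rpow_nonneg h0 _) (ha.le.trans ha')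
  have k1 := key aP βP haP hβP (le_max_left _ _) (le_max_left _ _)
  have k2 := key aM βM haM hβM (le_max_right _ _) (le_max_right _ _)
  exact ⟨h0, abs_le.2 ⟨by linarith, by linarith⟩⟩

/-! ### The three regimes for exponents below one. -/

section Thin

variable {aP aM βP βM B : ℝ} {DB S : Set Plane} {κ : Kernel S S} [IsMarkovKernel κ] {q M : ℝ}

/-- Far away every point of the boundary layer is close to one of the two boundary curves, and not
on the axis. -/
lemma thin_layer_geometry (haP : 0 < aP) (haM : 0 < aM) (hβP : 0 ≤ βP) (hβM : 0 ≤ βM)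
    (hβP1 : βP < 1) (hβM1 : βM < 1) (hβ0 : 0 < max βP βM)
    (hDB : IsBoundaryLayer (domain aP aM βP βM) DB B)
    (hflatP : βP = 0 → ∀ x ∈ DB, x 1 ≤ 0 →
      Metric.infDist x ((domain aP aM βP βM)ᶜ ∩ {y | y 1 < 0}) ≤ B)
    (hflatM : βM = 0 → ∀ x ∈ DB, 0 ≤ x 1 →
      Metric.infDist x ((domain aP aM βP βM)ᶜ ∩ {y | 0 < y 1}) ≤ B) :
    ∃ CP CM R : ℝ, ∀ x ∈ DB, R ≤ x 0 → x 1 ≠ 0 ∧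
      (0 < x 1 → |1 * x 1 - aP * x 0 ^ βP| ≤ CP) ∧
      (x 1 < 0 → |-1 * x 1 - aM * x 0 ^ βM| ≤ CM) := by
  obtain ⟨CP, R₁, h₁⟩ := layer_near_curve (a := aP) (a' := aM) (γ := βP) (γ' := βM) (s := 1) haP.le
    haM hβP hβP1.le hβM hβM1.le abs_one
    (fun x => by
      simp only [domain, Set.mem_ofPred_eq, one_mul]
      exact ⟨fun h => ⟨h.1, h.2.2, by linarith [h.2.1]⟩, fun h => ⟨h.1, by linarith [h.2.2], h.2.1⟩⟩)
    hDB (by simpa only [one_mul] using hflatM)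
  obtain ⟨CM, R₂, h₂⟩ := layer_near_curve (a := aM) (a' := aP) (γ := βM) (γ' := βP) (s := -1) haM.le
    haP hβM hβM1.le hβP hβP1.le (by simp)
    (fun x => by
      simp only [domain, Set.mem_ofPred_eq, neg_one_mul, neg_neg]
      exact ⟨fun h => ⟨h.1, by linarith [h.2.1], h.2.2⟩, fun h => ⟨h.1, by linarith [h.2.1], h.2.2⟩⟩)
    hDB (by simpa only [neg_one_mul, Left.neg_pos_iff, Left.nonneg_neg_iff] using hflatP)
  have hgrow : ∀ a γ C : ℝ, 0 < a → 0 < γ → ∀ᶠ t : ℝ in atTop, C < a * t ^ γ := fun a γ C ha hγ =>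
    ((tendsto_rpow_atTop hγ).const_mul_atTop ha).eventually_gt_atTop C
  -- A far point of the layer on the axis would be close to both curves, but the one with positive
  -- exponent has run away from the axis.
  obtain ⟨R₃, h₃⟩ : ∃ R₃ : ℝ, ∀ t, R₃ ≤ t → CP < aP * t ^ βP ∨ CM < aM * t ^ βM := by
    rcases lt_max_iff.1 hβ0 with h | h
    · obtain ⟨R, hR⟩ := eventually_atTop.1 (hgrow aP βP CP haP h)
      exact ⟨R, fun t ht => Or.inl (hR t ht)⟩
    · obtain ⟨R, hR⟩ := eventually_atTop.1 (hgrow aM βM CM haM h)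
      exact ⟨R, fun t ht => Or.inr (hR t ht)⟩
  refine ⟨CP, CM, max (max R₁ R₂) R₃, fun x hx hR => ?_⟩
  have hR1 : R₁ ≤ x 0 := ((le_max_left _ _).trans (le_max_left _ _)).trans hR
  have hR2 : R₂ ≤ x 0 := ((le_max_right _ _).trans (le_max_left _ _)).trans hR
  have hR3 : R₃ ≤ x 0 := (le_max_right _ _).trans hR
  refine ⟨fun h0 => ?_, fun h => h₁ x hx hR1 (by linarith), fun h => h₂ x hx hR2 (by linarith)⟩
  have e1 := (abs_le.1 (h₁ x hx hR1 (by rw [h0, mul_zero]))).1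
  have e2 := (abs_le.1 (h₂ x hx hR2 (by rw [h0, mul_zero]))).1
  rw [h0, mul_zero] at e1 e2
  rcases h₃ _ hR3 with h | h <;> linarith

lemma upperNormal_zero (a β t : ℝ) : upperNormal a β t 0 =
    (Real.sqrt (1 + (a * β * t ^ (β - 1)) ^ 2))⁻¹ • !₂[a * β * t ^ (β - 1), -1] := by
  simp [upperNormal, rotated]

lemma lowerNormal_zero (a β t : ℝ) : lowerNormal a β t 0 =
    (Real.sqrt (1 + (a * β * t ^ (β - 1)) ^ 2))⁻¹ • !₂[a * β * t ^ (β - 1), - -1] := by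
  simp [lowerNormal, rotated]

/-- The sign `g` selects the direction: `g = 1` makes the boundary drift negative, `g = -1`
positive. The coefficient β/2 cancels the leading normal derivative at a curve of maximal exponent.
-/
lemma exists_boundary_stepDrift_thinFn_le (haP : 0 < aP) (haM : 0 < aM) (hβP : 0 ≤ βP)
    (hβM : 0 ≤ βM) (hβP1 : βP < 1) (hβM1 : βM < 1) (hβ0 : 0 < max βP βM)
    (hDB : IsBoundaryLayer (domain aP aM βP βM) DB B)
    (hflatP : βP = 0 → ∀ x ∈ DB, x 1 ≤ 0 →
      Metric.infDist x ((domain aP aM βP βM)ᶜ ∩ {y | y 1 < 0}) ≤ B)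
    (hflatM : βM = 0 → ∀ x ∈ DB, 0 ≤ x 1 →
      Metric.infDist x ((domain aP aM βP βM)ᶜ ∩ {y | 0 < y 1}) ≤ B)
    (hS : S ⊆ domain aP aM βP βM) (hR : Reflection κ DB aP aM βP βM 0 0)
    (hM : MomentBound κ q M) (hq : 2 < q) (hq3 : q ≤ 3) {g : ℝ} (hg : g ^ 2 = 1) :
    ∃ b ν θ R : ℝ, b ^ 2 = 1 ∧ 0 < ν ∧ θ = max βP βM - 2 * ν ∧ ∀ x : S, (x : Plane) ∈ DB →
      R ≤ ‖(x : Plane)‖ → g * stepDrift κ (thinD1 (max βP βM / 2) g b ν θ)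
        (thinD2 (max βP βM / 2) g b ν θ) (thinQ11 (max βP βM / 2) g b)
        (thinQ12 (max βP βM / 2) g b) (thinQ22 (max βP βM / 2) g b ν) x ≤
        -(1 * rad x ^ (-2 : ℝ)) := by
  obtain ⟨CP, CM, R₀, hgeo⟩ := thin_layer_geometry haP haM hβP hβM hβP1 hβM1 hβ0 hDB hflatP hflatM
  have hβ1 : max βP βM < 1 := max_lt hβP1 hβM1
  have hST := hS.trans (domain_subset_thin haP haM hβP hβM)
  have hPle := le_max_left βP βM
  have hMle := le_max_right βP βM
  have hcases : βP = max βP βM ∨ βM = max βP βM := by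
    rcases le_total βP βM with h | h
    · exact Or.inr (max_eq_right h).symm
    · exact Or.inl (max_eq_left h).symm
  obtain ⟨β, hβ⟩ : ∃ β, β = max βP βM := ⟨_, rfl⟩
  obtain ⟨A, hA⟩ : ∃ A, A = max aP aM := ⟨_, rfl⟩
  have hA0 : 0 ≤ A := hA ▸ haP.le.trans (le_max_left _ _)
  rw [← hβ] at hβ1 hPle hMle hcases hβ0 ⊢
  rw [← hβ, ← hA] at hST
  obtain ⟨ν, hν, hν1, hν2, hνP, hνM⟩ : ∃ ν : ℝ, 0 < ν ∧ ν < 2 - 2 * β ∧ 2 * ν < β ∧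
      (βP ≠ β → βP < β - 2 * ν) ∧ (βM ≠ β → βM < β - 2 * ν) := by
    have hsub : ∀ γ : ℝ, γ ≤ β → ∃ d : ℝ, 0 < d ∧ (γ ≠ β → γ < β - 2 * d) := fun γ hγ => by
      by_cases h : γ = β
      -- A curve of maximal exponent puts no constraint here; the value 1 is arbitrary.
      · exact ⟨1, one_pos, fun h' => absurd h h'⟩
      · have := lt_of_le_of_ne hγ h
        exact ⟨(β - γ) / 4, by linarith, fun _ => by linarith⟩
    obtain ⟨d1, hd1, h1⟩ := hsub βP hPle
    obtain ⟨d2, hd2, h2⟩ := hsub βM hMle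
    refine ⟨min (min (1 - β) (β / 4)) (min d1 d2), lt_min (lt_min (by linarith) (by linarith))
      (lt_min hd1 hd2), ?_, ?_, fun h => ?_, fun h => ?_⟩
    · have := (min_le_left (min (1 - β) (β / 4)) (min d1 d2)).trans (min_le_left _ _); linarith
    · have := (min_le_left (min (1 - β) (β / 4)) (min d1 d2)).trans (min_le_right _ _); linarith
    · have := (min_le_right (min (1 - β) (β / 4)) (min d1 d2)).trans (min_le_left _ _)
      linarith [h1 h]
    · have := (min_le_right (min (1 - β) (β / 4)) (min d1 d2)).trans (min_le_right _ _)
      linarith [h2 h]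
  -- At most one curve has non-maximal exponent, and the sign of `b` is adapted to that one. If both
  -- are maximal, either sign works.
  have hgb : ∃ b : ℝ, b ^ 2 = 1 ∧ (βP ≠ β → g * 1 * b = 1) ∧ (βM ≠ β → g * (-1) * b = 1) := by
    rw [sq] at hg
    by_cases h : βP = β
    · exact ⟨-g, by rw [neg_sq, sq, hg], fun h' => absurd h h', fun _ => by linarith⟩
    · exact ⟨g, by rw [sq, hg], fun _ => by linarith, fun h' => absurd (hcases.resolve_left h) h'⟩
  obtain ⟨b, hb, hbP, hbM⟩ := hgb
  obtain ⟨θ, hθ⟩ : ∃ θ, θ = β - 2 * ν := ⟨_, rfl⟩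
  have hθ0 : 0 < θ := by linarith
  have hc0 : g * (β - 2 * (β / 2)) ≤ 0 := by
    rw [show β - 2 * (β / 2) = 0 by ring, mul_zero]
  have hsc := (hasExpansion_thinFn (A := A) (c := β / 2) (g := g) (b := b) hA0 hβ1.le
    (show 0 < 1 - β by linarith) (by linarith) le_rfl (show 1 - β ≤ 1 - θ by linarith) hν.le hq
    hq3).2
  obtain ⟨R₁, h₁⟩ := boundary_stepDrift_thinFn_le (s := 1) (C := CP) (R₀ := R₀) hM hq haP hβP hPle hβ1
    hA0 hg hb (one_pow 2) hν hν1 hθ hθ0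
    (by
      by_cases h : βP = β
      · exact Or.inl ⟨h, hc0⟩
      · exact Or.inr ⟨by rw [hθ]; exact hνP h, hbP h⟩)
    hsc hR.1 (Set.inter_subset_left.trans hST) (fun x => upperNormal_zero _ _ _)
    (fun x hx hxR => (hgeo x hx.2.1 hxR).2.1 hx.2.2)
  obtain ⟨R₂, h₂⟩ := boundary_stepDrift_thinFn_le (s := -1) (C := CM) (R₀ := R₀) hM hq haM hβM hMle
    hβ1 hA0 hg hb (by norm_num) hν hν1 hθ hθ0
    (by
      by_cases h : βM = β
      · exact Or.inl ⟨h, hc0⟩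
      · exact Or.inr ⟨by rw [hθ]; exact hνM h, hbM h⟩)
    hsc hR.2 (Set.inter_subset_left.trans hST) (fun x => lowerNormal_zero _ _ _)
    (fun x hx hxR => (hgeo x hx.2.1 hxR).2.2 hx.2.2)
  refine ⟨b, ν, θ, max (max R₁ R₂) ((1 + A) * (1 + R₀)), hb, hν, hθ, fun x hx hxR => ?_⟩
  have hR1 : R₁ ≤ ‖(x : Plane)‖ := ((le_max_left _ _).trans (le_max_left _ _)).trans hxR
  have hR2 : R₂ ≤ ‖(x : Plane)‖ := ((le_max_right _ _).trans (le_max_left _ _)).trans hxR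
  have hx0 : R₀ ≤ (x : Plane) 0 := by
    have h3 := (thin_scale hA0 hβ1.le x (hST x.2)).2.2
    have h4 := (((le_max_right _ _).trans hxR).trans (le_add_of_nonneg_left zero_le_one)).trans h3
    linarith [le_of_mul_le_mul_left h4 (by linarith)]
  rcases lt_or_gt_of_ne (hgeo x hx hx0).1 with h | h
  · exact h₂ x ⟨x.2, hx, h⟩ hR2
  · exact h₁ x ⟨x.2, hx, h⟩ hR1

/-- With β below the variance ratio the interior drift of `thinFn` has the negative leading
coefficient (βσ₂² - σ₁²)/2, matching the negative boundary drift for `g = 1`. -/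
theorem isRecurrent_thin_subcritical (haP : 0 < aP) (haM : 0 < aM) (hβP : 0 ≤ βP)
    (hβM : 0 ≤ βM) (hβP1 : βP < 1) (hβM1 : βM < 1) (hβ0 : 0 < max βP βM)
    (hDB : IsBoundaryLayer (domain aP aM βP βM) DB B)
    (hflatP : βP = 0 → ∀ x ∈ DB, x 1 ≤ 0 →
      Metric.infDist x ((domain aP aM βP βM)ᶜ ∩ {y | y 1 < 0}) ≤ B)
    (hflatM : βM = 0 → ∀ x ∈ DB, 0 ≤ x 1 →
      Metric.infDist x ((domain aP aM βP βM)ᶜ ∩ {y | 0 < y 1}) ≤ B)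
    (hS : S ⊆ domain aP aM βP βM) (hR : Reflection κ DB aP aM βP βM 0 0)
    (hN : NonConfinement κ) (hMp : BoundedMoments κ) {Sig : Matrix (Fin 2) (Fin 2) ℝ}
    (hSig : Sig.PosDef) (hβ : max βP βM < Sig 0 0 / Sig 1 1)
    (hZ : ZeroDrift κ (interiorPart S (domain aP aM βP βM) DB))
    (hC : Covariance κ (interiorPart S (domain aP aM βP βM) DB) Sig) (x₀ : S) :
    IsRecurrent κ x₀ := by
  obtain ⟨q, M, hq, hq3, hM0, hM⟩ := exists_momentBound hMp
  obtain ⟨b, ν, θ, R₁, hb, hν, hθ, hbd⟩ := exists_boundary_stepDrift_thinFn_le haP haM hβP hβM hβP1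
    hβM1 hβ0 hDB hflatP hflatM hS hR hM hq hq3 (one_pow 2)
  have hβ1 : max βP βM < 1 := max_lt hβP1 hβM1
  have hST := hS.trans (domain_subset_thin haP haM hβP hβM)
  obtain ⟨β, hβe⟩ : ∃ β, β = max βP βM := ⟨_, rfl⟩
  obtain ⟨A, hA⟩ : ∃ A, A = max aP aM := ⟨_, rfl⟩
  have hA0 : 0 ≤ A := hA ▸ haP.le.trans (le_max_left _ _)
  rw [← hβe] at hβ1 hθ hbd hβ hβ0
  rw [← hβe, ← hA] at hST
  -- The three bounds come from thinness, from the small-jump threshold, and from integrating the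
  -- large-jump error.
  obtain ⟨η, hη0, hη1, hη2, hη3⟩ : ∃ η : ℝ, 0 < η ∧ η ≤ 1 - β ∧ η ≤ (q - 2) ^ 2 / (2 * q) ∧
      2 * η ≤ q - 2 :=
    ⟨min (1 - β) (min ((q - 2) ^ 2 / (2 * q)) ((q - 2) / 2)),
      lt_min (by linarith) (lt_min (div_pos (pow_pos (by linarith) 2) (by linarith)) (by linarith)),
      min_le_left _ _, (min_le_right _ _).trans (min_le_left _ _), by
        linarith [(min_le_right (1 - β) _).trans
          (min_le_right ((q - 2) ^ 2 / (2 * q)) ((q - 2) / 2))]⟩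
  have hexp := hasExpansion_thinFn (A := A) (c := β / 2) (g := 1) (b := b) hA0 hβ1.le hη0
    (by linarith) hη1 (show η ≤ 1 - θ by linarith) hν.le hq hq3
  obtain ⟨C, hC0, hint⟩ := exists_interior_stepDrift_thinFn_le hM hM0 hq hA0 hβ1.le hν.le hST hexp.2
    Sig
  obtain ⟨-, hS1, -, -⟩ := posDef_entries hSig
  rw [lt_div_iff₀ hS1] at hβ
  obtain ⟨k, hk0, hk⟩ : ∃ k : ℝ, 0 < k ∧
      k = (1 / 2 * Sig 0 0 - β / 2 * Sig 1 1) * ((1 + A) ^ 2)⁻¹ :=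
    ⟨_, mul_pos (by linarith) (by positivity), rfl⟩
  -- A quarter of the leading coefficient goes to the interior error and a quarter to the rad^(-2-ν)
  -- correction, leaving k/2.
  obtain ⟨ε, hε, hCε⟩ : ∃ ε : ℝ, 0 < ε ∧ C * ε ≤ k / 4 := by
    refine ⟨k / (4 * (C + 1)), by positivity, ?_⟩
    rw [mul_div_assoc', div_le_div_iff₀ (by positivity) (by norm_num)]
    nlinarith
  obtain ⟨R₂, hR₂⟩ := exists_interior_error_le hZ hC hε
  obtain ⟨R₃, hR₃⟩ := eventually_atTop.1 (eventually_rpow_le C (show 0 < k / 4 by linarith)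
    (show -2 - ν < -2 by linarith))
  -- Only the strict alternative of the criterion occurs, so the value of `C` plays no role.
  refine isRecurrent_of_expansion (η := η) (C := 0) (lam := 1) (c := min 1 (k / 2))
    (R := max R₁ (max R₂ R₃)) hN hST hM hM0 hq hq3
    hη0 hη2 hη3 (measurable_thinFn _ _ _ _ _) hexp.1 hexp.2 one_pos
    (thinFn_sub_log_le hA0 hβ1.le (by linarith) hν.le) (lt_min one_pos (by linarith))
    (fun x hx => Or.inl ?_) x₀
  have hr2 : 0 ≤ rad (x : Plane) ^ (-2 : ℝ) := Real.rpow_nonneg (rad_pos _).le _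
  by_cases hxB : (x : Plane) ∈ DB
  · have := hbd x hxB ((le_max_left _ _).trans hx)
    rw [one_mul] at this
    refine this.trans (neg_le_neg (mul_le_mul_of_nonneg_right (min_le_left _ _) hr2))
  · obtain ⟨e1, e2⟩ := hR₂ x ⟨x.2, hS x.2, hxB⟩
      (((le_max_left _ _).trans (le_max_right _ _)).trans hx)
    have e3 := (abs_le.1 (hint x ε e1 e2)).2
    have e4 := hR₃ (rad x) ((((le_max_right _ _).trans (le_max_right _ _)).trans hx).trans
      (le_add_of_nonneg_left zero_le_one))
    have e5 := mul_le_mul_of_nonneg_left (thin_inv_sq_bounds hA0 hβ1.le (hST x.2)).2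
      (show 0 ≤ 1 / 2 * Sig 0 0 - β / 2 * Sig 1 1 by linarith)
    rw [← mul_assoc, ← hk] at e5
    have e6 := mul_le_mul_of_nonneg_right (min_le_right 1 (k / 2)) hr2
    have e7 := mul_le_mul_of_nonneg_right hCε hr2
    linarith only [e3, e4, e5, e6, e7]

/-- The mirror image of the subcritical case: the leading interior coefficient is positive, and `g =
-1` makes the boundary drift positive too. -/
theorem isTransient_thin_supercritical (haP : 0 < aP) (haM : 0 < aM) (hβP : 0 ≤ βP)
    (hβM : 0 ≤ βM) (hβP1 : βP < 1) (hβM1 : βM < 1)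
    (hDB : IsBoundaryLayer (domain aP aM βP βM) DB B)
    (hflatP : βP = 0 → ∀ x ∈ DB, x 1 ≤ 0 →
      Metric.infDist x ((domain aP aM βP βM)ᶜ ∩ {y | y 1 < 0}) ≤ B)
    (hflatM : βM = 0 → ∀ x ∈ DB, 0 ≤ x 1 →
      Metric.infDist x ((domain aP aM βP βM)ᶜ ∩ {y | 0 < y 1}) ≤ B)
    (hS : S ⊆ domain aP aM βP βM) (hR : Reflection κ DB aP aM βP βM 0 0)
    (hN : NonConfinement κ) (hMp : BoundedMoments κ) {Sig : Matrix (Fin 2) (Fin 2) ℝ}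
    (hSig : Sig.PosDef) (hβ : Sig 0 0 / Sig 1 1 < max βP βM)
    (hZ : ZeroDrift κ (interiorPart S (domain aP aM βP βM) DB))
    (hC : Covariance κ (interiorPart S (domain aP aM βP βM) DB) Sig) (x₀ : S) :
    IsTransient κ x₀ := by
  obtain ⟨hS0, hS1, -, -⟩ := posDef_entries hSig
  have hβ0 : 0 < max βP βM := (div_pos hS0 hS1).trans hβ
  obtain ⟨q, M, hq, hq3, hM0, hM⟩ := exists_momentBound hMp
  obtain ⟨b, ν, θ, R₁, hb, hν, hθ, hbd⟩ := exists_boundary_stepDrift_thinFn_le haP haM hβP hβM hβP1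
    hβM1 hβ0 hDB hflatP hflatM hS hR hM hq hq3 (g := -1) (by norm_num)
  have hβ1 : max βP βM < 1 := max_lt hβP1 hβM1
  have hST := hS.trans (domain_subset_thin haP haM hβP hβM)
  obtain ⟨β, hβe⟩ : ∃ β, β = max βP βM := ⟨_, rfl⟩
  obtain ⟨A, hA⟩ : ∃ A, A = max aP aM := ⟨_, rfl⟩
  have hA0 : 0 ≤ A := hA ▸ haP.le.trans (le_max_left _ _)
  rw [← hβe] at hβ1 hθ hbd hβ hβ0
  rw [← hβe, ← hA] at hST
  obtain ⟨η, hη0, hη1, hη2, hη3⟩ : ∃ η : ℝ, 0 < η ∧ η ≤ 1 - β ∧ η ≤ (q - 2) ^ 2 / (2 * q) ∧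
      2 * η ≤ q - 2 :=
    ⟨min (1 - β) (min ((q - 2) ^ 2 / (2 * q)) ((q - 2) / 2)),
      lt_min (by linarith) (lt_min (div_pos (pow_pos (by linarith) 2) (by linarith)) (by linarith)),
      min_le_left _ _, (min_le_right _ _).trans (min_le_left _ _), by
        linarith [(min_le_right (1 - β) _).trans
          (min_le_right ((q - 2) ^ 2 / (2 * q)) ((q - 2) / 2))]⟩
  have hexp := hasExpansion_thinFn (A := A) (c := β / 2) (g := -1) (b := b) hA0 hβ1.le hη0
    (by linarith) hη1 (show η ≤ 1 - θ by linarith) hν.le hq hq3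
  obtain ⟨C, hC0, hint⟩ := exists_interior_stepDrift_thinFn_le hM hM0 hq hA0 hβ1.le hν.le hST hexp.2
    Sig
  rw [div_lt_iff₀ hS1] at hβ
  obtain ⟨k, hk0, hk⟩ : ∃ k : ℝ, 0 < k ∧
      k = (-(1 / 2) * Sig 0 0 + β / 2 * Sig 1 1) * ((1 + A) ^ 2)⁻¹ :=
    ⟨_, mul_pos (by linarith) (by positivity), rfl⟩
  obtain ⟨ε, hε, hCε⟩ : ∃ ε : ℝ, 0 < ε ∧ C * ε ≤ k / 4 := by
    refine ⟨k / (4 * (C + 1)), by positivity, ?_⟩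
    rw [mul_div_assoc', div_le_div_iff₀ (by positivity) (by norm_num)]
    nlinarith
  obtain ⟨R₂, hR₂⟩ := exists_interior_error_le hZ hC hε
  obtain ⟨R₃, hR₃⟩ := eventually_atTop.1 (eventually_rpow_le C (show 0 < k / 4 by linarith)
    (show -2 - ν < -2 by linarith))
  refine isTransient_of_expansion (η := η) (lam := 1) (c := min 1 (k / 2))
    (R := max R₁ (max R₂ R₃)) hN hST hM hM0 hq
    hη0 hη2 hη3 (measurable_thinFn _ _ _ _ _) hexp.1 hexp.2 one_pos
    (thinFn_sub_log_le hA0 hβ1.le (by linarith) hν.le) (lt_min one_pos (by linarith))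
    (fun x hx => ?_) x₀
  have hr2 : 0 ≤ rad (x : Plane) ^ (-2 : ℝ) := Real.rpow_nonneg (rad_pos _).le _
  by_cases hxB : (x : Plane) ∈ DB
  · have := hbd x hxB ((le_max_left _ _).trans hx)
    rw [neg_one_mul, neg_le_neg_iff] at this
    exact (mul_le_mul_of_nonneg_right (min_le_left _ _) hr2).trans this
  · obtain ⟨e1, e2⟩ := hR₂ x ⟨x.2, hS x.2, hxB⟩
      (((le_max_left _ _).trans (le_max_right _ _)).trans hx)
    have e3 := (abs_le.1 (hint x ε e1 e2)).1
    have e4 := hR₃ (rad x) ((((le_max_right _ _).trans (le_max_right _ _)).trans hx).trans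
      (le_add_of_nonneg_left zero_le_one))
    have e5 := mul_le_mul_of_nonneg_left (thin_inv_sq_bounds hA0 hβ1.le (hST x.2)).2
      (show 0 ≤ -(1 / 2) * Sig 0 0 + β / 2 * Sig 1 1 by linarith)
    rw [← mul_assoc, ← hk] at e5
    have e6 := mul_le_mul_of_nonneg_right (min_le_right 1 (k / 2)) hr2
    have e7 := mul_le_mul_of_nonneg_right hCε hr2
    linarith only [e3, e4, e5, e6, e7]

/-- The leading interior coefficient vanishes, so the borderline alternative is used in the
interior: the power rates make the drift O(rad^(-2-η)), and the horizontal derivative alone keeps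
the gradient nondegenerate. At the boundary the drift is still strictly negative. -/
theorem isRecurrent_thin_critical (haP : 0 < aP) (haM : 0 < aM) (hβP : 0 ≤ βP)
    (hβM : 0 ≤ βM) (hβP1 : βP < 1) (hβM1 : βM < 1)
    (hDB : IsBoundaryLayer (domain aP aM βP βM) DB B)
    (hflatP : βP = 0 → ∀ x ∈ DB, x 1 ≤ 0 →
      Metric.infDist x ((domain aP aM βP βM)ᶜ ∩ {y | y 1 < 0}) ≤ B)
    (hflatM : βM = 0 → ∀ x ∈ DB, 0 ≤ x 1 →
      Metric.infDist x ((domain aP aM βP βM)ᶜ ∩ {y | 0 < y 1}) ≤ B)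
    (hS : S ⊆ domain aP aM βP βM) (hR : Reflection κ DB aP aM βP βM 0 0)
    (hN : NonConfinement κ) (hMp : BoundedMoments κ) {Sig : Matrix (Fin 2) (Fin 2) ℝ}
    (hSig : Sig.PosDef) (hβ : max βP βM = Sig 0 0 / Sig 1 1)
    (hZ : ZeroDriftPlus κ (interiorPart S (domain aP aM βP βM) DB))
    (hC : Covariance κ (interiorPart S (domain aP aM βP βM) DB) Sig)
    (hCp : CovariancePlus κ (interiorPart S (domain aP aM βP βM) DB) Sig) (x₀ : S) :
    IsRecurrent κ x₀ := by
  obtain ⟨hS0, hS1, -, -⟩ := posDef_entries hSig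
  have hβ0 : 0 < max βP βM := hβ ▸ div_pos hS0 hS1
  obtain ⟨q, M, hq, hq3, hM0, hM⟩ := exists_momentBound hMp
  obtain ⟨b, ν, θ, R₁, hb, hν, hθ, hbd⟩ := exists_boundary_stepDrift_thinFn_le haP haM hβP hβM hβP1
    hβM1 hβ0 hDB hflatP hflatM hS hR hM hq hq3 (one_pow 2)
  have hβ1 : max βP βM < 1 := max_lt hβP1 hβM1
  have hST := hS.trans (domain_subset_thin haP haM hβP hβM)
  obtain ⟨β, hβe⟩ : ∃ β, β = max βP βM := ⟨_, rfl⟩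
  obtain ⟨A, hA⟩ : ∃ A, A = max aP aM := ⟨_, rfl⟩
  have hA0 : 0 ≤ A := hA ▸ haP.le.trans (le_max_left _ _)
  rw [← hβe] at hβ1 hθ hbd hβ hβ0
  rw [← hβe, ← hA] at hST
  obtain ⟨ε, C₁, R₂, hε, hC₁, hR₂⟩ := exists_interior_error_rate hZ hCp
  obtain ⟨η, hη0, hη1, hη2, hη3, hην, hηε⟩ : ∃ η : ℝ, 0 < η ∧ η ≤ 1 - β ∧
      η ≤ (q - 2) ^ 2 / (2 * q) ∧ 2 * η ≤ q - 2 ∧ η ≤ ν ∧ η ≤ ε := by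
    refine ⟨min (min (1 - β) (min ((q - 2) ^ 2 / (2 * q)) ((q - 2) / 2))) (min ν ε),
      lt_min (lt_min (by linarith) (lt_min (div_pos (pow_pos (by linarith) 2) (by linarith))
        (by linarith))) (lt_min hν hε),
      (min_le_left _ _).trans (min_le_left _ _),
      (min_le_left _ _).trans ((min_le_right _ _).trans (min_le_left _ _)), ?_,
      (min_le_right _ _).trans (min_le_left _ _), (min_le_right _ _).trans (min_le_right _ _)⟩
    have := (min_le_left (min (1 - β) (min ((q - 2) ^ 2 / (2 * q)) ((q - 2) / 2)))
      (min ν ε)).trans ((min_le_right _ _).trans (min_le_right _ _))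
    linarith
  have hexp := hasExpansion_thinFn (A := A) (c := β / 2) (g := 1) (b := b) hA0 hβ1.le hη0
    (by linarith) hη1 (show η ≤ 1 - θ by linarith) hν.le hq hq3
  obtain ⟨C, hC0, hint⟩ := exists_interior_stepDrift_thinFn_le hM hM0 hq hA0 hβ1.le hν.le hST hexp.2
    Sig
  rw [eq_div_iff hS1.ne'] at hβ
  obtain ⟨lam, hlam, hquad⟩ := exists_quadratic_lower_bound hSig
  obtain ⟨R₃, hR₃⟩ := hC lam hlam
  obtain ⟨R₄, hR₄⟩ := exists_thinD1_lower_bound (c := β / 2) (g := 1) hA0 hβ1 (one_pow 2) hb hν.le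
    (show θ ≤ β by linarith)
  obtain ⟨k, hk0, hk⟩ : ∃ k : ℝ, 0 < k ∧ k = lam * ((2 * (1 + A))⁻¹) ^ 2 := ⟨_, by positivity, rfl⟩
  refine isRecurrent_of_expansion (η := η) (C := C * (C₁ + 1)) (lam := 1) (c := min 1 k)
    (R := max (max R₁ R₂) (max R₃ R₄)) hN hST hM hM0 hq hq3
    hη0 hη2 hη3 (measurable_thinFn _ _ _ _ _) hexp.1 hexp.2 one_pos
    (thinFn_sub_log_le hA0 hβ1.le (by linarith) hν.le) (lt_min one_pos hk0)
    (fun x hx => ?_) x₀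
  have hr := rad_pos (x : Plane)
  have hr1 := one_le_rad (x : Plane)
  have hr2 : 0 ≤ rad (x : Plane) ^ (-2 : ℝ) := Real.rpow_nonneg hr.le _
  by_cases hxB : (x : Plane) ∈ DB
  · have := hbd x hxB (((le_max_left _ _).trans (le_max_left _ _)).trans hx)
    rw [one_mul] at this
    exact Or.inl (this.trans (neg_le_neg (mul_le_mul_of_nonneg_right (min_le_left _ _) hr2)))
  · right
    have hxI : (x : Plane) ∈ interiorPart S (domain aP aM βP βM) DB := ⟨x.2, hS x.2, hxB⟩
    constructor
    · obtain ⟨e1, e2⟩ := hR₂ x hxI (((le_max_right _ _).trans (le_max_left _ _)).trans hx)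
      have e3 := (abs_le.1 (hint x _ e1 e2)).2
      rw [show -(1 / 2) * Sig 0 0 + β / 2 * Sig 1 1 = 0 by linarith, zero_mul, sub_zero] at e3
      refine e3.trans ?_
      rw [mul_assoc C (C₁ + 1)]
      refine mul_le_mul_of_nonneg_left ?_ hC0
      have p1 : C₁ * rad (x : Plane) ^ (-ε) * rad (x : Plane) ^ (-2 : ℝ) ≤
          C₁ * rad (x : Plane) ^ (-2 - η) := by
        rw [mul_assoc, ← Real.rpow_add hr]
        exact mul_le_mul_of_nonneg_left
          (Real.rpow_le_rpow_of_exponent_le hr1 (by linarith)) hC₁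
      have p2 : rad (x : Plane) ^ (-2 - ν) ≤ rad (x : Plane) ^ (-2 - η) :=
        Real.rpow_le_rpow_of_exponent_le hr1 (by linarith)
      linarith
    · have hN' := hR₃ _ (((le_max_left _ _).trans (le_max_right _ _)).trans hx) x hxI le_rfl
      have e1 := hR₄ x (hST x.2) (((le_max_right _ _).trans (le_max_right _ _)).trans hx)
      refine le_trans ?_ (hquad _ hN' _ _)
      have e2 : ((2 * (1 + A))⁻¹ * (rad (x : Plane))⁻¹) ^ 2 ≤
          thinD1 (β / 2) 1 b ν θ x ^ 2 := pow_le_pow_left₀ (by positivity) e1 2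
      calc min 1 k * rad (x : Plane) ^ (-2 : ℝ) ≤ k * rad (x : Plane) ^ (-2 : ℝ) :=
            mul_le_mul_of_nonneg_right (min_le_right _ _) hr2
        _ = lam * ((2 * (1 + A))⁻¹ * (rad (x : Plane))⁻¹) ^ 2 := by
            rw [hk, rpow_neg_two hr]; ring
        _ ≤ _ := mul_le_mul_of_nonneg_left (e2.trans (le_add_of_nonneg_right (sq_nonneg _))) hlam.le

end Thin

/-! ### The complex logarithm adapted to the covariance. -/

lemma norm_le_abs_add_abs (x : Plane) : ‖x‖ ≤ |x 0| + |x 1| := by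
  rw [EuclideanSpace.norm_eq, Fin.sum_univ_two, Real.sqrt_le_left (by positivity)]
  simp only [Real.norm_eq_abs]
  nlinarith [abs_nonneg (x 0), abs_nonneg (x 1)]

/-- The closed right half-plane. -/
def halfPlane : Set Plane := {x | 0 ≤ x 0}

/-- The complex linear coordinate `1 + v x₁ + i x₂`. -/
def zeta (v : ℂ) (x : Plane) : ℂ := 1 + (x 0 * v + Complex.I * x 1)

/-- The real part of `v⁻¹ log ζ`. -/
def zetaLog (v : ℂ) (x : Plane) : ℝ := (v⁻¹ * Complex.log (zeta v x)).re

section Zeta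

variable {v : ℂ}

lemma zeta_re (x : Plane) : (zeta v x).re = 1 + x 0 * v.re := by simp [zeta]

lemma zeta_im (x : Plane) : (zeta v x).im = x 0 * v.im + x 1 := by simp [zeta]

lemma zeta_re_pos (hv : 0 < v.re) {x : Plane} (hx : x ∈ halfPlane) : 0 < (zeta v x).re := by
  rw [zeta_re]
  have := mul_nonneg (show 0 ≤ x 0 from hx) hv.le
  linarith

lemma one_le_norm_zeta (hv : 0 < v.re) {x : Plane} (hx : x ∈ halfPlane) : 1 ≤ ‖zeta v x‖ := by
  have h1 := (le_abs_self _).trans (Complex.abs_re_le_norm (zeta v x))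
  rw [zeta_re] at h1
  have := mul_nonneg (show 0 ≤ x 0 from hx) hv.le
  linarith

lemma zeta_sub (x y : Plane) :
    zeta v y = zeta v x + (((y 0 - x 0 : ℝ) : ℂ) * v + Complex.I * ((y 1 - x 1 : ℝ) : ℂ)) := by
  simp only [zeta]; push_cast; ring

lemma norm_increment_le (d : Plane) :
    ‖((d 0 : ℝ) : ℂ) * v + Complex.I * ((d 1 : ℝ) : ℂ)‖ ≤ (‖v‖ + 1) * ‖d‖ := by
  refine (norm_add_le _ _).trans ?_
  rw [norm_mul, norm_mul, Complex.norm_I, Complex.norm_real, Complex.norm_real, one_mul, add_mul,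
    one_mul, mul_comm]
  exact add_le_add (mul_le_mul_of_nonneg_left (abs_coord_le_norm d 0) (norm_nonneg _))
    (abs_coord_le_norm d 1)

/-- Re v > 0 makes v and i independent over ℝ, so both coordinates are controlled by ζ, and it keeps
Re ζ ≥ 1 on the half-plane, away from the branch cut. -/
lemma exists_zeta_scale (hv : 0 < v.re) : ∃ L : ℝ, 1 ≤ L ∧ ∀ x ∈ halfPlane,
    1 ≤ ‖zeta v x‖ ∧ ‖zeta v x‖ ≤ L * rad x ∧ rad x ≤ L * ‖zeta v x‖ := by
  refine ⟨‖v‖ + 2 + (1 / v.re + |v.im| * (1 / v.re)), ?_, fun x hx => ?_⟩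
  · have : 0 ≤ 1 / v.re + |v.im| * (1 / v.re) := by positivity
    linarith [norm_nonneg v]
  have h1 := one_le_norm_zeta hv hx
  have hk : 0 ≤ 1 / v.re + |v.im| * (1 / v.re) := by positivity
  have hr1 := one_le_rad x
  refine ⟨h1, ?_, ?_⟩
  · have h2 : ‖zeta v x‖ ≤ 1 + (‖v‖ + 1) * ‖x‖ := by
      refine (norm_add_le _ _).trans ?_
      rw [norm_one]
      exact add_le_add_right (norm_increment_le x) 1
    have h3 : ‖x‖ ≤ rad x := by unfold rad; linarith
    have h4 := mul_le_mul_of_nonneg_left h3 (show 0 ≤ ‖v‖ + 1 by positivity)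
    have h5 := mul_nonneg hk (rad_pos x).le
    linarith
  · have h2 := (le_abs_self _).trans (Complex.abs_re_le_norm (zeta v x))
    rw [zeta_re] at h2
    have h3 : |x 0| ≤ 1 / v.re * ‖zeta v x‖ := by
      rw [abs_of_nonneg hx, one_div_mul_eq_div, le_div_iff₀ hv]
      linarith
    have h4 := Complex.abs_im_le_norm (zeta v x)
    rw [zeta_im] at h4
    have h5 : |x 1| ≤ ‖zeta v x‖ + |v.im| * (1 / v.re * ‖zeta v x‖) := by
      have e : x 1 = (x 0 * v.im + x 1) - v.im * x 0 := by ring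
      rw [e]
      refine (abs_sub _ _).trans (add_le_add h4 ?_)
      rw [abs_mul]
      exact mul_le_mul_of_nonneg_left h3 (abs_nonneg _)
    have h6 := norm_le_abs_add_abs x
    have h7 := mul_nonneg (norm_nonneg v) (norm_nonneg (zeta v x))
    unfold rad
    linarith

lemma measurable_zetaLog : Measurable (zetaLog v) := by
  have h : Measurable (zeta v) := by unfold zeta; fun_prop
  exact Complex.measurable_re.comp ((Complex.measurable_log.comp h).const_mul _)

/-- The logarithm has a second order expansion with cubic error in the right half-plane. -/
lemma norm_log_add_sub_le {z w : ℂ} (hz : 0 < z.re) (hw : ‖w‖ ≤ ‖z‖ / 2) :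
    ‖Complex.log (z + w) - Complex.log z - w / z + (w / z) ^ 2 / 2‖ ≤ (‖w‖ / ‖z‖) ^ 3 := by
  have hz0 : z ≠ 0 := fun h => by simp [h] at hz
  have hn : 0 < ‖z‖ := norm_pos_iff.2 hz0
  obtain ⟨u, hu⟩ : ∃ u, u = w / z := ⟨_, rfl⟩
  have hun : ‖u‖ ≤ 1 / 2 := by
    rw [hu, norm_div, div_le_iff₀ hn]; linarith
  have hre : 0 < (1 + u).re := by
    have := (abs_le.1 (Complex.abs_re_le_norm u)).1
    simp only [Complex.add_re, Complex.one_re]; linarith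
  have h1u : 1 + u ≠ 0 := fun h => by simp [h] at hre
  have hmul : z + w = z * (1 + u) := by rw [hu]; field_simp
  -- Both factors have argument of modulus below π/2, so the principal logarithm of the product
  -- splits.
  have harg1 := abs_lt.1 (Complex.abs_arg_lt_pi_div_two_iff.2 (Or.inl hz))
  have harg2 := abs_lt.1 (Complex.abs_arg_lt_pi_div_two_iff.2 (Or.inl hre))
  rw [hmul, Complex.log_mul hz0 h1u ⟨by linarith, by linarith⟩, ← hu, ← norm_div, ← hu]
  have h := Complex.norm_log_sub_logTaylor_le 2 (show ‖u‖ < 1 by linarith)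
  have ht : Complex.logTaylor (2 + 1) u = u - u ^ 2 / 2 := by
    simp [Complex.logTaylor, Finset.sum_range_succ]; ring
  rw [ht] at h
  have e : Complex.log z + Complex.log (1 + u) - Complex.log z - u + u ^ 2 / 2 =
      Complex.log (1 + u) - (u - u ^ 2 / 2) := by ring
  rw [e]
  refine h.trans ?_
  have h2 : (1 - ‖u‖)⁻¹ ≤ 2 := by
    rw [inv_le_comm₀ (by linarith) (by norm_num)]; linarith
  have h3 := mul_le_mul_of_nonneg_left h2 (pow_nonneg (norm_nonneg u) 3)
  have h4 := pow_nonneg (norm_nonneg u) 3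
  norm_num at h3 ⊢
  linarith

lemma abs_log_norm_zeta_le (hv : 0 < v.re) {x : Plane} (hx : x ∈ halfPlane) :
    ‖Complex.log (zeta v x)‖ ≤ Real.log ‖zeta v x‖ + 2 := by
  have h1 := Complex.norm_le_abs_re_add_abs_im (Complex.log (zeta v x))
  rw [Complex.log_re, Complex.log_im,
    abs_of_nonneg (Real.log_nonneg (one_le_norm_zeta hv hx))] at h1
  have h2 := (Complex.abs_arg_lt_pi_div_two_iff.2 (Or.inl (zeta_re_pos hv hx))).le
  linarith [Real.pi_lt_four]

/-- The factor v⁻¹ normalizes the horizontal derivative of v⁻¹ log ζ to 1/ζ, whose real part is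
small near the vertical axis. The range constant (2(‖v‖ + 1))⁻¹ keeps the change of ζ below ‖ζ‖/2.
-/
lemma hasExpansion_zetaLog (hv : 0 < v.re) {η q : ℝ} (hη0 : 0 < η) (hη1 : η ≤ 1) (hq : 2 < q)
    (hq3 : q ≤ 3) :
    HasExpansion halfPlane η q (zetaLog v) (fun x => ((zeta v x)⁻¹).re)
      (fun x => (Complex.I * v⁻¹ * (zeta v x)⁻¹).re)
      (fun x => (-(1 / 2) * v * ((zeta v x)⁻¹) ^ 2).re)
      (fun x => (-Complex.I * ((zeta v x)⁻¹) ^ 2).re)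
      (fun x => (1 / 2 * v⁻¹ * ((zeta v x)⁻¹) ^ 2).re) ∧
    LogScale halfPlane (fun x => ((zeta v x)⁻¹).re)
      (fun x => (Complex.I * v⁻¹ * (zeta v x)⁻¹).re)
      (fun x => (-(1 / 2) * v * ((zeta v x)⁻¹) ^ 2).re)
      (fun x => (-Complex.I * ((zeta v x)⁻¹) ^ 2).re)
      (fun x => (1 / 2 * v⁻¹ * ((zeta v x)⁻¹) ^ 2).re) := by
  have hv0 : v ≠ 0 := fun h => by simp [h] at hv
  obtain ⟨L, hL, hscale⟩ := exists_zeta_scale hv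
  have hV : 0 < ‖v‖ + 1 := by positivity
  refine hasExpansion_of_scale (τ := fun x => ‖zeta v x‖) (k := (2 * (‖v‖ + 1))⁻¹) hL
    (by positivity) (inv_le_one_of_one_le₀ (by linarith [norm_nonneg v])) hscale hη0 hη1 hq hq3
    ⟨‖v⁻¹‖ * (‖v‖ + 1) ^ 3, fun x hx y _ hd => ?_⟩ ⟨‖v⁻¹‖ * (2 * (‖v‖ + 1) + 6), fun x hx y hy => ?_⟩
    ⟨1 + ‖v‖ + ‖v⁻¹‖, fun x hx => ?_⟩
  · have hn := one_le_norm_zeta hv hx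
    have hz0 : zeta v x ≠ 0 := norm_pos_iff.1 (by linarith)
    obtain ⟨w, hw⟩ : ∃ w, w = ((y 0 - x 0 : ℝ) : ℂ) * v + Complex.I * ((y 1 - x 1 : ℝ) : ℂ) :=
      ⟨_, rfl⟩
    have hwn : ‖w‖ ≤ (‖v‖ + 1) * ‖y - x‖ := hw ▸ norm_increment_le (y - x)
    have hw2 : ‖w‖ ≤ ‖zeta v x‖ / 2 := by
      refine hwn.trans ?_
      calc (‖v‖ + 1) * ‖y - x‖ ≤ (‖v‖ + 1) * ((2 * (‖v‖ + 1))⁻¹ * ‖zeta v x‖) := by gcongr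
        _ = _ := by field_simp
    have h := norm_log_add_sub_le (zeta_re_pos hv hx) hw2
    have e : zetaLog v y - zetaLog v x - linPart (fun x => ((zeta v x)⁻¹).re)
        (fun x => (Complex.I * v⁻¹ * (zeta v x)⁻¹).re) x y -
        quadPart (fun x => (-(1 / 2) * v * ((zeta v x)⁻¹) ^ 2).re)
          (fun x => (-Complex.I * ((zeta v x)⁻¹) ^ 2).re)
          (fun x => (1 / 2 * v⁻¹ * ((zeta v x)⁻¹) ^ 2).re) x y =
        (v⁻¹ * (Complex.log (zeta v x + w) - Complex.log (zeta v x) - w / zeta v x +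
          (w / zeta v x) ^ 2 / 2)).re := by
      have hy : zeta v y = zeta v x + w := by rw [hw]; exact zeta_sub x y
      have key : v⁻¹ * (Complex.log (zeta v x + w) - Complex.log (zeta v x) - w / zeta v x +
          (w / zeta v x) ^ 2 / 2) = v⁻¹ * Complex.log (zeta v y) - v⁻¹ * Complex.log (zeta v x) -
          (((y 0 - x 0 : ℝ) : ℂ) * (zeta v x)⁻¹ +
            ((y 1 - x 1 : ℝ) : ℂ) * (Complex.I * v⁻¹ * (zeta v x)⁻¹)) -
          ((((y 0 - x 0) ^ 2 : ℝ) : ℂ) * (-(1 / 2) * v * ((zeta v x)⁻¹) ^ 2) +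
            (((y 0 - x 0) * (y 1 - x 1) : ℝ) : ℂ) * (-Complex.I * ((zeta v x)⁻¹) ^ 2) +
            (((y 1 - x 1) ^ 2 : ℝ) : ℂ) * (1 / 2 * v⁻¹ * ((zeta v x)⁻¹) ^ 2)) := by
        rw [hy]
        generalize Complex.log (zeta v x + w) = l₁
        generalize Complex.log (zeta v x) = l₂
        rw [hw]
        push_cast
        generalize ((y 0 : ℝ) : ℂ) - ((x 0 : ℝ) : ℂ) = d₀
        generalize ((y 1 : ℝ) : ℂ) - ((x 1 : ℝ) : ℂ) = d₁
        have hI : Complex.I ^ 2 = -1 := Complex.I_sq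
        field_simp
        linear_combination d₁ ^ 2 * hI
      rw [key]
      simp only [Complex.sub_re, Complex.add_re, Complex.re_ofReal_mul, zetaLog, linPart, quadPart]
      ring
    rw [e]
    refine (Complex.abs_re_le_norm _).trans ?_
    rw [norm_mul]
    have hpos : 0 ≤ ‖zeta v x‖ ^ (-η) * (‖y - x‖ / ‖zeta v x‖) ^ 2 := by positivity
    calc ‖v⁻¹‖ * _ ≤ ‖v⁻¹‖ * (‖w‖ / ‖zeta v x‖) ^ 3 := by gcongr
      _ ≤ ‖v⁻¹‖ * ((‖v‖ + 1) * ‖y - x‖ / ‖zeta v x‖) ^ 3 := by gcongr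
      _ = ‖v⁻¹‖ * (‖v‖ + 1) ^ 3 * (‖y - x‖ / ‖zeta v x‖) ^ 3 := by
          rw [mul_div_assoc, mul_pow, mul_assoc]
      _ ≤ _ := mul_le_mul_of_nonneg_left (by linarith) (by positivity)
  · have hn := one_le_norm_zeta hv hx
    have hn' := one_le_norm_zeta hv hy
    have hx1 := abs_log_norm_zeta_le hv hx
    have hy1 := abs_log_norm_zeta_le hv hy
    have hl := Real.log_nonneg hn
    obtain ⟨u, hu⟩ : ∃ u, u = ‖y - x‖ / ‖zeta v x‖ := ⟨_, rfl⟩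
    have hu0 : 0 ≤ u := by rw [hu]; positivity
    have hlog : Real.log ‖zeta v y‖ ≤ Real.log ‖zeta v x‖ + (‖v‖ + 1) * u := by
      have h1 : ‖zeta v y‖ ≤ ‖zeta v x‖ * (1 + (‖v‖ + 1) * u) := by
        rw [zeta_sub x y]
        refine (norm_add_le _ _).trans ((add_le_add_right (norm_increment_le (y - x)) _).trans
          (le_of_eq ?_))
        rw [hu]; field_simp
      have hp : 0 < 1 + (‖v‖ + 1) * u := by positivity
      refine (Real.log_le_log (by linarith) h1).trans ?_
      rw [Real.log_mul (by linarith) hp.ne']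
      linarith [Real.log_le_sub_one_of_pos hp]
    have e : zetaLog v y - zetaLog v x =
        (v⁻¹ * (Complex.log (zeta v y) - Complex.log (zeta v x))).re := by
      rw [mul_sub, Complex.sub_re]; rfl
    rw [e, ← hu]
    refine (Complex.abs_re_le_norm _).trans ?_
    rw [norm_mul, mul_assoc]
    refine mul_le_mul_of_nonneg_left ((norm_sub_le _ _).trans ?_) (norm_nonneg _)
    have p1 := mul_nonneg (norm_nonneg v) hl
    have p2 := mul_nonneg (norm_nonneg v) hu0
    have p3 := norm_nonneg v
    nlinarith only [hx1, hy1, hlog, p1, p2, p3, hu0, hl]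
  · have hn := one_le_norm_zeta hv hx
    have h0 : 0 < ‖zeta v x‖ := by linarith
    have hv1 := norm_nonneg v
    have hv2 := norm_nonneg v⁻¹
    have gen : ∀ c : ℂ, ‖c‖ ≤ 1 + ‖v‖ + ‖v⁻¹‖ →
        |(c * (zeta v x)⁻¹).re| ≤ (1 + ‖v‖ + ‖v⁻¹‖) / ‖zeta v x‖ ∧
        |(c * ((zeta v x)⁻¹) ^ 2).re| ≤ (1 + ‖v‖ + ‖v⁻¹‖) / ‖zeta v x‖ ^ 2 := fun c hc => by
      refine ⟨(Complex.abs_re_le_norm _).trans ?_, (Complex.abs_re_le_norm _).trans ?_⟩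
      · rw [norm_mul, norm_inv, ← div_eq_mul_inv]; gcongr
      · rw [norm_mul, norm_pow, norm_inv, inv_pow, ← div_eq_mul_inv]; gcongr
    refine ⟨?_, (gen _ ?_).1, (gen _ ?_).2, (gen _ ?_).2, (gen _ ?_).2⟩
    · simpa using (gen 1 (by rw [norm_one]; linarith)).1
    · rw [norm_mul, Complex.norm_I]; linarith
    · rw [norm_mul]; norm_num
      linarith [(norm_inv v).symm]
    · rw [norm_neg, Complex.norm_I]; linarith
    · rw [norm_mul]; norm_num
      linarith [(norm_inv v).symm]

/-- The argument of ζ is bounded and ‖ζ‖ is comparable with `rad`, so log ζ differs from the real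
number log rad by a bounded amount. -/
lemma exists_zetaLog_sub_log_le (hv : 0 < v.re) : ∃ K : ℝ, ∀ x ∈ halfPlane,
    |zetaLog v x - (v⁻¹).re * Real.log (rad x)| ≤ K := by
  obtain ⟨L, hL, hscale⟩ := exists_zeta_scale hv
  refine ⟨‖v⁻¹‖ * (Real.log L + 2), fun x hx => ?_⟩
  obtain ⟨h1, h2, h3⟩ := hscale x hx
  have hr := rad_pos x
  have hz : 0 < ‖zeta v x‖ := by linarith
  have hL0 : 0 < L := by linarith
  have e : zetaLog v x - (v⁻¹).re * Real.log (rad x) =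
      (v⁻¹ * (Complex.log (zeta v x) - (Real.log (rad x) : ℂ))).re := by
    rw [mul_sub, Complex.sub_re, zetaLog, Complex.re_mul_ofReal]
  rw [e]
  refine (Complex.abs_re_le_norm _).trans ?_
  rw [norm_mul]
  refine mul_le_mul_of_nonneg_left ((Complex.norm_le_abs_re_add_abs_im _).trans ?_) (norm_nonneg _)
  rw [Complex.sub_re, Complex.sub_im, Complex.log_re, Complex.log_im, Complex.ofReal_re,
    Complex.ofReal_im, sub_zero]
  have ha := (Complex.abs_arg_lt_pi_div_two_iff.2 (Or.inl (zeta_re_pos hv hx))).le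
  have g1 := Real.log_le_log hz h2
  have g2 := Real.log_le_log hr h3
  rw [Real.log_mul hL0.ne' hr.ne'] at g1
  rw [Real.log_mul hL0.ne' hz.ne'] at g2
  refine add_le_add (abs_le.2 ⟨by linarith, by linarith⟩) (by linarith [Real.pi_lt_four])

end Zeta

/-! ### The decaying correction. -/

/-- The smooth quadratic radius `1 + x₁² + x₂²`. -/
def sqRad (x : Plane) : ℝ := 1 + x 0 ^ 2 + x 1 ^ 2

/-- The decaying correction `x₁ (1 + x₁² + x₂²) ^ (-(1 + ν) / 2)`. -/
def decayFn (ν : ℝ) (x : Plane) : ℝ := x 0 * sqRad x ^ (-(1 + ν) / 2)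

/-- The first partial derivative of `decayFn`. -/
def decayD1 (ν : ℝ) (x : Plane) : ℝ :=
  sqRad x ^ (-(1 + ν) / 2) - (1 + ν) * (x 0 ^ 2 * sqRad x ^ (-(1 + ν) / 2 - 1))

/-- The second partial derivative of `decayFn`. -/
def decayD2 (ν : ℝ) (x : Plane) : ℝ := -((1 + ν) * (x 0 * x 1 * sqRad x ^ (-(1 + ν) / 2 - 1)))

section Decay

variable {ν : ℝ}

lemma plane_norm_sq (x : Plane) : ‖x‖ ^ 2 = x 0 ^ 2 + x 1 ^ 2 := by
  simp [EuclideanSpace.norm_sq_eq, Fin.sum_univ_two]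

lemma sqRad_eq (x : Plane) : sqRad x = 1 + ‖x‖ ^ 2 := by rw [plane_norm_sq, sqRad, add_assoc]

lemma sqRad_pos (x : Plane) : 0 < sqRad x := by rw [sqRad_eq]; positivity

lemma sqRad_le (x : Plane) : sqRad x ≤ rad x ^ 2 := by
  rw [sqRad_eq, rad]; nlinarith [norm_nonneg x]

lemma rad_sq_le (x : Plane) : rad x ^ 2 ≤ 2 * sqRad x := by
  rw [sqRad_eq, rad]; nlinarith [sq_nonneg (‖x‖ - 1)]

lemma sqRad_rpow_le (hν : 0 < ν) (hν1 : ν ≤ 1) (x : Plane) :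
    sqRad x ^ (-(1 + ν) / 2) ≤ 2 * rad x ^ (-1 - ν) := by
  have hr := rad_pos x
  have h := Real.rpow_le_rpow_of_nonpos (by positivity : 0 < rad x ^ 2 / 2)
    (by linarith [rad_sq_le x] : rad x ^ 2 / 2 ≤ sqRad x) (show -(1 + ν) / 2 ≤ 0 by linarith)
  refine h.trans ?_
  rw [Real.div_rpow (by positivity) (by norm_num), ← Real.rpow_natCast, ← Real.rpow_mul hr.le,
    div_eq_mul_inv, ← Real.rpow_neg (by norm_num), mul_comm]
  have h2 : (2 : ℝ) ^ (-(-(1 + ν) / 2)) ≤ 2 := by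
    calc (2 : ℝ) ^ (-(-(1 + ν) / 2)) ≤ 2 ^ (1 : ℝ) :=
          Real.rpow_le_rpow_of_exponent_le (by norm_num) (by linarith)
      _ = 2 := Real.rpow_one 2
  have e : ((2 : ℕ) : ℝ) * (-(1 + ν) / 2) = -1 - ν := by push_cast; ring
  rw [e]
  exact mul_le_mul_of_nonneg_right h2 (Real.rpow_nonneg hr.le _)

lemma le_sqRad_rpow (hν : 0 < ν) (x : Plane) :
    rad x ^ (-1 - ν) ≤ sqRad x ^ (-(1 + ν) / 2) := by
  have hr := rad_pos x
  have h := Real.rpow_le_rpow_of_nonpos (sqRad_pos x) (sqRad_le x)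
    (show -(1 + ν) / 2 ≤ 0 by linarith)
  refine le_trans (le_of_eq ?_) h
  rw [← Real.rpow_natCast, ← Real.rpow_mul hr.le]
  congr 1
  push_cast; ring

lemma abs_decayFn_le (hν : 0 < ν) (hν1 : ν ≤ 1) (x : Plane) : |decayFn ν x| ≤ 2 := by
  have hr := rad_pos x
  rw [decayFn, abs_mul, abs_of_nonneg (Real.rpow_nonneg (sqRad_pos x).le _)]
  have h1 : |x 0| ≤ rad x := (abs_coord_le_norm x 0).trans (by unfold rad; linarith)
  have h2 : rad x ^ (-1 - ν) ≤ (rad x)⁻¹ := by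
    rw [← Real.rpow_neg_one]
    exact Real.rpow_le_rpow_of_exponent_le (one_le_rad x) (by linarith)
  calc |x 0| * sqRad x ^ (-(1 + ν) / 2) ≤ rad x * (2 * (rad x)⁻¹) := by
        refine mul_le_mul h1 ((sqRad_rpow_le hν hν1 x).trans (by linarith))
          (Real.rpow_nonneg (sqRad_pos x).le _) hr.le
    _ = 2 := by field_simp

lemma mul_sqRad_rpow_le {y : ℝ} {x : Plane} (a : ℝ) (hy : |y| ≤ ‖x‖ ^ 2) :
    |y * sqRad x ^ (a - 1)| ≤ sqRad x ^ a := by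
  have hQ := sqRad_pos x
  rw [abs_mul, abs_of_nonneg (Real.rpow_nonneg hQ.le _), Real.rpow_sub_one hQ.ne']
  calc |y| * (sqRad x ^ a / sqRad x) ≤ sqRad x * (sqRad x ^ a / sqRad x) :=
        mul_le_mul_of_nonneg_right (hy.trans (by rw [sqRad_eq]; linarith))
          (div_nonneg (Real.rpow_nonneg hQ.le _) hQ.le)
    _ = _ := by field_simp

lemma abs_decayD_le (hν : 0 < ν) (hν1 : ν ≤ 1) (x : Plane) :
    |decayD1 ν x| ≤ 6 * rad x ^ (-1 - ν) ∧ |decayD2 ν x| ≤ 4 * rad x ^ (-1 - ν) := by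
  have hQ := Real.rpow_nonneg (sqRad_pos x).le (-(1 + ν) / 2)
  have hle := sqRad_rpow_le hν hν1 x
  have hn := plane_norm_sq x
  have h1 := mul_sqRad_rpow_le (y := x 0 ^ 2) (x := x) (-(1 + ν) / 2)
    (by rw [abs_of_nonneg (sq_nonneg _), hn]; nlinarith [sq_nonneg (x 1)])
  have h2 := mul_sqRad_rpow_le (y := x 0 * x 1) (x := x) (-(1 + ν) / 2)
    (by rw [abs_le, hn]; constructor <;> nlinarith [sq_nonneg (x 0 - x 1), sq_nonneg (x 0 + x 1)])
  constructor
  · rw [decayD1]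
    refine (abs_sub _ _).trans ?_
    rw [abs_of_nonneg hQ, abs_mul, abs_of_pos (show 0 < 1 + ν by linarith)]
    have := mul_le_mul (show 1 + ν ≤ 2 by linarith) h1 (abs_nonneg _) (by norm_num)
    linarith
  · rw [decayD2, abs_neg, abs_mul, abs_of_pos (show 0 < 1 + ν by linarith)]
    have := mul_le_mul (show 1 + ν ≤ 2 by linarith) h2 (abs_nonneg _) (by norm_num)
    linarith

lemma measurable_decayFn : Measurable (decayFn ν) := by
  unfold decayFn sqRad
  fun_prop

/-- Second order terms in the expansion of the decaying correction are negligible. -/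
lemma exists_decayFn_local_le (hν : 0 < ν) (hν1 : ν ≤ 1) : ∃ K : ℝ, 0 ≤ K ∧ ∀ x y : Plane,
    ‖y - x‖ ≤ 1 / 12 * rad x →
    |decayFn ν y - decayFn ν x - linPart (decayD1 ν) (decayD2 ν) x y| ≤
      K * (rad x ^ (-ν) * (‖y - x‖ / rad x) ^ 2) := by
  obtain ⟨K, hK, h⟩ := abs_add_rpow_sub_sub_le (-(1 + ν) / 2)
  refine ⟨2 * (36 * K + 2 + (12 + 36 * K)), by positivity, fun x y hd => ?_⟩
  have hr := rad_pos x
  have hr1 := one_le_rad x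
  have hQ := sqRad_pos x
  obtain ⟨a, ha⟩ : ∃ a, a = -(1 + ν) / 2 := ⟨_, rfl⟩
  obtain ⟨d0, hd0⟩ : ∃ d0, d0 = y 0 - x 0 := ⟨_, rfl⟩
  obtain ⟨d1, hd1⟩ : ∃ d1, d1 = y 1 - x 1 := ⟨_, rfl⟩
  obtain ⟨u, hu⟩ : ∃ u, u = ‖y - x‖ / rad x := ⟨_, rfl⟩
  have hu0 : 0 ≤ u := by rw [hu]; positivity
  have hdu : ‖y - x‖ = rad x * u := by rw [hu]; field_simp
  have hu1 : u ≤ 1 / 12 := by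
    rw [hu, div_le_iff₀ hr]; exact hd
  have hx0 : |x 0| ≤ rad x := (abs_coord_le_norm x 0).trans (by unfold rad; linarith)
  have hx1 : |x 1| ≤ rad x := (abs_coord_le_norm x 1).trans (by unfold rad; linarith)
  have hd0a : |d0| ≤ rad x * u := by
    rw [hd0, ← hdu]; exact abs_coord_le_norm (y - x) 0
  have hnd : d0 ^ 2 + d1 ^ 2 = (rad x * u) ^ 2 := by
    rw [← hdu, plane_norm_sq, hd0, hd1]; simp
  have hxd : |x 0 * d0 + x 1 * d1| ≤ rad x * (rad x * u) := by
    have hcs : (x 0 * d0 + x 1 * d1) ^ 2 ≤ (rad x * (rad x * u)) ^ 2 := by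
      have h1 : (x 0 * d0 + x 1 * d1) ^ 2 ≤ (x 0 ^ 2 + x 1 ^ 2) * (d0 ^ 2 + d1 ^ 2) := by
        nlinarith [sq_nonneg (x 0 * d1 - x 1 * d0)]
      have h2 : x 0 ^ 2 + x 1 ^ 2 ≤ rad x ^ 2 := by
        have := sqRad_le x
        rw [sqRad] at this; linarith
      calc _ ≤ _ := h1
        _ ≤ rad x ^ 2 * (rad x * u) ^ 2 := by rw [hnd]; gcongr
        _ = _ := by ring
    exact abs_le_of_sq_le_sq hcs (by positivity)
  obtain ⟨e, he⟩ : ∃ e, e = 2 * (x 0 * d0 + x 1 * d1) + (d0 ^ 2 + d1 ^ 2) := ⟨_, rfl⟩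
  have hQy : sqRad y = sqRad x + e := by
    rw [he, hd0, hd1, sqRad, sqRad]; ring
  have hr2u : 0 ≤ rad x ^ 2 * u := by positivity
  have heabs : |e| ≤ 3 * (rad x ^ 2 * u) := by
    rw [he]
    refine (abs_add_le _ _).trans ?_
    rw [abs_mul, abs_two, abs_of_nonneg (by positivity : 0 ≤ d0 ^ 2 + d1 ^ 2), hnd]
    nlinarith only [hxd, hr2u, hu1, hu0]
  have hradQ := rad_sq_le x
  have heQ : |e / sqRad x| ≤ 6 * u := by
    rw [abs_div, abs_of_pos hQ, div_le_iff₀ hQ]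
    nlinarith only [heabs, hradQ, hu0]
  -- The increment satisfies |e| ≤ 6u · sqRad x, which is why the relative jump is restricted to u ≤
  -- 1/12.
  have he2 : |e| ≤ sqRad x / 2 := by
    nlinarith only [heabs, hradQ, hu1, hu0, hQ]
  obtain ⟨P, hP⟩ : ∃ P, P = sqRad x ^ a := ⟨_, rfl⟩
  have hP0 : 0 ≤ P := hP ▸ Real.rpow_nonneg hQ.le _
  have hT := h (sqRad x) e hQ he2
  rw [← ha, ← hQy, ← hP, Real.rpow_sub_one hQ.ne', ← hP] at hT
  obtain ⟨Y, hY⟩ : ∃ Y, Y = sqRad y ^ a := ⟨_, rfl⟩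
  rw [← hY] at hT
  have heq2 : (e / sqRad x) ^ 2 ≤ (6 * u) ^ 2 := by
    rw [← sq_abs]; gcongr
  have hT1 : |Y - P - a * (P / sqRad x) * e| ≤ 36 * K * (P * u ^ 2) := by
    refine hT.trans ?_
    calc K * P * (e / sqRad x) ^ 2 ≤ K * P * (6 * u) ^ 2 := by gcongr
      _ = _ := by ring
  have haa : |a| ≤ 1 := by rw [ha, abs_le]; constructor <;> linarith
  have hT2 : |Y - P| ≤ (12 + 36 * K) * (P * u) := by
    have e1 : Y - P = (Y - P - a * (P / sqRad x) * e) + a * P * (e / sqRad x) := by ring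
    rw [e1]
    refine (abs_add_le _ _).trans ?_
    have e2 : |a * P * (e / sqRad x)| ≤ 1 * P * (6 * u) := by
      rw [abs_mul, abs_mul, abs_of_nonneg hP0]; gcongr
    have e3 : 36 * K * (P * u ^ 2) ≤ 36 * K * (P * u) := by
      have : u ^ 2 ≤ u := by nlinarith
      gcongr
    have e4 := mul_nonneg hP0 hu0
    linarith
  have hid : decayFn ν y - decayFn ν x - linPart (decayD1 ν) (decayD2 ν) x y =
      x 0 * (Y - P - a * (P / sqRad x) * e) + a * x 0 * (P / sqRad x) * (d0 ^ 2 + d1 ^ 2) +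
        d0 * (Y - P) := by
    simp only [decayFn, decayD1, decayD2, linPart]
    rw [← ha, ← hY, ← hP, Real.rpow_sub_one hQ.ne', ← hP, ← hd0, ← hd1, he,
      show y 0 = x 0 + d0 by rw [hd0]; ring, show 1 + ν = -2 * a by rw [ha]; ring]
    ring
  rw [hid]
  have t1 : |x 0 * (Y - P - a * (P / sqRad x) * e)| ≤ rad x * (36 * K * (P * u ^ 2)) := by
    rw [abs_mul]; exact mul_le_mul hx0 hT1 (abs_nonneg _) hr.le
  have t2 : |a * x 0 * (P / sqRad x) * (d0 ^ 2 + d1 ^ 2)| ≤ rad x * (2 * (P * u ^ 2)) := by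
    have hPQ : P / sqRad x ≤ 2 * P / rad x ^ 2 := by
      rw [div_le_div_iff₀ hQ (by positivity)]
      nlinarith only [hradQ, hP0]
    rw [abs_mul, abs_mul, abs_mul, abs_of_nonneg (div_nonneg hP0 hQ.le),
      abs_of_nonneg (by positivity : 0 ≤ d0 ^ 2 + d1 ^ 2), hnd]
    calc |a| * |x 0| * (P / sqRad x) * (rad x * u) ^ 2 ≤
          1 * rad x * (2 * P / rad x ^ 2) * (rad x * u) ^ 2 := by gcongr
      _ = _ := by field_simp
  have t3 : |d0 * (Y - P)| ≤ rad x * ((12 + 36 * K) * (P * u ^ 2)) := by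
    rw [abs_mul]
    calc |d0| * |Y - P| ≤ rad x * u * ((12 + 36 * K) * (P * u)) := by gcongr
      _ = _ := by ring
  have hPr : P ≤ 2 * rad x ^ (-1 - ν) := by
    rw [hP, ha]; exact sqRad_rpow_le hν hν1 x
  have hrr : rad x * rad x ^ (-1 - ν) = rad x ^ (-ν) := by
    rw [show -1 - ν = -ν - 1 by ring, Real.rpow_sub_one hr.ne']; field_simp
  have hfin : rad x * (P * u ^ 2) ≤ 2 * (rad x ^ (-ν) * u ^ 2) := by
    rw [← hrr]
    calc rad x * (P * u ^ 2) ≤ rad x * (2 * rad x ^ (-1 - ν) * u ^ 2) := by gcongr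
      _ = _ := by ring
  refine (abs_add_three _ _ _).trans ((add_le_add_three t1 t2 t3).trans ?_)
  rw [← hu]
  calc _ = (36 * K + 2 + (12 + 36 * K)) * (rad x * (P * u ^ 2)) := by ring
    _ ≤ (36 * K + 2 + (12 + 36 * K)) * (2 * (rad x ^ (-ν) * u ^ 2)) := by gcongr
    _ = _ := by ring

/-- Second derivatives of the correction are O(rad^(-2-ν)), so with η ≤ ν the quadratic part is
absorbed by the error. -/
lemma hasExpansion_decayFn (hν : 0 < ν) (hν1 : ν ≤ 1) {η q : ℝ} (hη0 : 0 < η) (hη : η ≤ ν)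
    (hq : 2 < q) (hq3 : q ≤ 3) :
    HasExpansion halfPlane η q (decayFn ν) (decayD1 ν) (decayD2 ν) (fun _ => 0) (fun _ => 0)
      (fun _ => 0) ∧
    LogScale halfPlane (decayD1 ν) (decayD2 ν) (fun _ => 0) (fun _ => 0) (fun _ => 0) := by
  obtain ⟨K, hK, h⟩ := exists_decayFn_local_le hν hν1
  refine hasExpansion_of_scale (τ := rad) (k := 1 / 12) (L := 1) le_rfl (by norm_num) (by norm_num)
    (fun x _ => ⟨one_le_rad x, by rw [one_mul], by rw [one_mul]⟩) hη0 (hη.trans hν1) hq hq3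
    ⟨K, fun x _ y _ hd => ?_⟩ ⟨4, fun x _ y _ => ?_⟩ ⟨6, fun x _ => ?_⟩
  · have hr := rad_pos x
    have e : quadPart (fun _ => 0) (fun _ => 0) (fun _ => 0) x y = 0 := by simp [quadPart]
    rw [e, sub_zero]
    refine (h x y hd).trans (mul_le_mul_of_nonneg_left ?_ hK)
    have h1 : rad x ^ (-ν) ≤ rad x ^ (-η) :=
      Real.rpow_le_rpow_of_exponent_le (one_le_rad x) (by linarith)
    have h2 := mul_le_mul_of_nonneg_right h1 (sq_nonneg (‖y - x‖ / rad x))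
    have h3 : 0 ≤ (‖y - x‖ / rad x) ^ 3 := by positivity
    linarith
  · have h1 := abs_decayFn_le hν hν1 x
    have h2 := abs_decayFn_le hν hν1 y
    have h3 := Real.log_nonneg (one_le_rad x)
    have h4 : 0 ≤ ‖y - x‖ / rad x := div_nonneg (norm_nonneg _) (rad_pos x).le
    refine (abs_sub _ _).trans ?_
    linarith
  · have hr := rad_pos x
    obtain ⟨h1, h2⟩ := abs_decayD_le hν hν1 x
    have h3 : rad x ^ (-1 - ν) ≤ (rad x)⁻¹ := by
      rw [← Real.rpow_neg_one]
      exact Real.rpow_le_rpow_of_exponent_le (one_le_rad x) (by linarith)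
    have h4 : 0 < (rad x)⁻¹ := inv_pos.2 hr
    have h5 : (0 : ℝ) ≤ 6 / rad x ^ 2 := by positivity
    rw [div_eq_mul_inv 6 (rad x)]
    simp only [abs_zero]
    exact ⟨by linarith, by linarith, h5, h5, h5⟩

end Decay

/-! ### Drift estimates and the layer for wide domains. -/

/-- If the second order part of an expansion vanishes for the limiting covariance matrix, then the
drift in the interior is small. -/
lemma LogScale.exists_abs_stepDrift_le {S D : Set Plane} {κ : Kernel S S}
    {D1 D2 q11 q12 q22 : Plane → ℝ} (hsc : LogScale D D1 D2 q11 q12 q22) (hS : S ⊆ D)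
    {Sig : Matrix (Fin 2) (Fin 2) ℝ}
    (hzero : ∀ x ∈ D, q11 x * Sig 0 0 + q12 x * Sig 0 1 + q22 x * Sig 1 1 = 0) :
    ∃ C : ℝ, 0 ≤ C ∧ ∀ (x : S) (δ : ℝ), ‖meanIncrement κ x‖ ≤ δ * (rad x)⁻¹ →
      opNorm (secondMoment κ x - Sig) ≤ δ →
      |stepDrift κ D1 D2 q11 q12 q22 x| ≤ C * (δ * rad x ^ (-2 : ℝ)) := by
  obtain ⟨K, hK, hsc⟩ := hsc
  refine ⟨5 * K, by positivity, fun x δ hm hN => ?_⟩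
  have hr := rad_pos (x : Plane)
  obtain ⟨h1, h2, h3, h4, h5⟩ := hsc x (hS x.2)
  have m0 := (abs_coord_le_norm (meanIncrement κ x) 0).trans hm
  have m1 := (abs_coord_le_norm (meanIncrement κ x) 1).trans hm
  have n0 := (abs_apply_le_opNorm (secondMoment κ x - Sig) 0 0).trans hN
  have n1 := (abs_apply_le_opNorm (secondMoment κ x - Sig) 0 1).trans hN
  have n2 := (abs_apply_le_opNorm (secondMoment κ x - Sig) 1 1).trans hN
  simp only [Matrix.sub_apply] at n0 n1 n2
  have hδ : 0 ≤ δ := (abs_nonneg _).trans n0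
  have e : stepDrift κ D1 D2 q11 q12 q22 x =
      (D1 x * meanIncrement κ x 0 + D2 x * meanIncrement κ x 1) +
      (q11 x * (secondMoment κ x 0 0 - Sig 0 0) + q12 x * (secondMoment κ x 0 1 - Sig 0 1) +
        q22 x * (secondMoment κ x 1 1 - Sig 1 1)) := by
    have := hzero x (hS x.2)
    simp only [stepDrift]
    linear_combination this
  have p : ∀ a b A' : ℝ, |a| ≤ K / A' → |b| ≤ δ * (rad x ^ 2 / A')⁻¹ → 0 < A' →
      |a * b| ≤ K * (δ * rad x ^ (-2 : ℝ)) := fun a b A' ha hb hA' => by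
    rw [abs_mul, rpow_neg_two hr]
    calc |a| * |b| ≤ K / A' * (δ * (rad x ^ 2 / A')⁻¹) := by gcongr
      _ = _ := by field_simp
  have hr1 : rad (x : Plane) ^ 2 / rad x = rad x := by field_simp
  have hr2 : rad (x : Plane) ^ 2 / rad x ^ 2 = 1 := by field_simp
  have t1 := p _ _ _ h1 (m0.trans_eq (by rw [hr1])) hr
  have t2 := p _ _ _ h2 (m1.trans_eq (by rw [hr1])) hr
  have t3 := p _ _ _ h3 (n0.trans_eq (by rw [hr2, inv_one, mul_one])) (pow_pos hr 2)
  have t4 := p _ _ _ h4 (n1.trans_eq (by rw [hr2, inv_one, mul_one])) (pow_pos hr 2)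
  have t5 := p _ _ _ h5 (n2.trans_eq (by rw [hr2, inv_one, mul_one])) (pow_pos hr 2)
  rw [e]
  refine (abs_add_le _ _).trans ((add_le_add (abs_add_le _ _) (abs_add_three _ _ _)).trans ?_)
  linarith

/-- In the boundary layer the drift is determined by the derivative along the direction of
reflection, up to second order terms. -/
lemma ReflectsAlong.exists_stepDrift_le {S T D : Set Plane} {κ : Kernel S S} [IsMarkovKernel κ]
    {n : Plane → Plane} {D1 D2 q11 q12 q22 : Plane → ℝ} {q M : ℝ} (hR : ReflectsAlong κ T n)
    (hT : T ⊆ D) (hsc : LogScale D D1 D2 q11 q12 q22) (hM : MomentBound κ q M) (hq : 2 < q) :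
    ∃ c K R : ℝ, 0 < c ∧ ∀ x : S, (x : Plane) ∈ T → R ≤ ‖(x : Plane)‖ → ∃ μ : ℝ, c ≤ μ ∧
      stepDrift κ D1 D2 q11 q12 q22 x ≤
        μ * (n x 0 * D1 x + n x 1 * D2 x) + K * rad x ^ (-2 : ℝ) := by
  obtain ⟨K, hK, hsc⟩ := hsc
  obtain ⟨c, C, R, hc, hC, h⟩ := hR.exists_decomposition
  refine ⟨c, 2 * K * C + 3 * K * (1 + M), R, hc, fun x hx hxR => ?_⟩
  obtain ⟨μ, ρ₀, ρ₁, hμ, hρ0, hρ1, hm0, hm1⟩ := h x hx hxR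
  obtain ⟨d1, d2, d3, d4, d5⟩ := hsc x (hT hx)
  have hr := rad_pos (x : Plane)
  have hquad := (le_abs_self _).trans (abs_quad_le hM hq x d3 d4 d5)
  refine ⟨μ, hμ, ?_⟩
  have b2 : D1 x * ρ₀ + D2 x * ρ₁ ≤ 2 * K * C * rad x ^ (-2 : ℝ) := by
    calc _ ≤ |D1 x * ρ₀ + D2 x * ρ₁| := le_abs_self _
      _ ≤ |D1 x| * |ρ₀| + |D2 x| * |ρ₁| := by
          rw [← abs_mul, ← abs_mul]; exact abs_add_le _ _
      _ ≤ K / rad x * (C / rad x) + K / rad x * (C / rad x) := by gcongr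
      _ = _ := by rw [rpow_neg_two hr]; field_simp; ring
  have b3 : 3 * (K / rad x ^ 2) * (1 + M) = 3 * K * (1 + M) * rad x ^ (-2 : ℝ) := by
    rw [rpow_neg_two hr]; ring
  rw [b3] at hquad
  simp only [stepDrift, hm0, hm1]
  linarith

/-- A nearby point `y` outside `D` is left of the axis, beyond the curve on the side of `x`, or
beyond the opposite one. The middle case gives a (y 0)^γ = O(rad), hence the exponent γ⁻¹; in the
last, s x 1 ≥ 0 keeps y 0 bounded. -/
lemma exists_layer_fst_le {D DB : Set Plane} {a a' γ γ' s B : ℝ} (ha : 0 < a) (ha' : 0 < a')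
    (hγ : 0 < γ) (hγ' : 0 < γ') (hs : |s| = 1)
    (hD : ∀ x, x ∈ D ↔ 0 ≤ x 0 ∧ s * x 1 ≤ a * x 0 ^ γ ∧ -(s * x 1) ≤ a' * x 0 ^ γ')
    (hDB : IsBoundaryLayer D DB B) :
    ∃ C : ℝ, 0 ≤ C ∧ ∀ x ∈ DB, 0 ≤ s * x 1 → x 0 ≤ C * rad x ^ γ⁻¹ := by
  have hw : (!₂[-1, s] : Plane) ∈ Dᶜ := fun h => by
    have := ((hD _).1 h).1
    norm_num at this
  obtain ⟨b, hb⟩ : ∃ b, b = max (B + 1) 1 := ⟨_, rfl⟩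
  have hb0 : 0 < b := hb ▸ lt_max_of_lt_right one_pos
  refine ⟨b + (((1 + b) / a) ^ γ⁻¹ + (b / a') ^ γ'⁻¹), by positivity, fun x hx hx1 => ?_⟩
  obtain ⟨y, hy, hd⟩ := exists_dist_lt_of_infDist_le ⟨_, hw⟩ (hDB.2 x hx)
  have hd' : ‖x - y‖ < b := by
    rw [← dist_eq_norm]; exact hd.trans_le (hb ▸ le_max_left _ _)
  have h0 := (abs_lt.1 ((abs_coord_le_norm (x - y) 0).trans_lt hd')).2
  have h1 : |s * (x 1 - y 1)| < b := by
    rw [abs_mul, hs, one_mul]; exact (abs_coord_le_norm (x - y) 1).trans_lt hd'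
  obtain ⟨h1, h2⟩ := abs_lt.1 h1
  simp only [PiLp.sub_apply] at h0
  have hr1 := one_le_rad x
  have hrγ : 1 ≤ rad x ^ γ⁻¹ := Real.one_le_rpow hr1 (inv_pos.2 hγ).le
  have c1 : 0 ≤ ((1 + b) / a) ^ γ⁻¹ * rad x ^ γ⁻¹ := by positivity
  have c2 : (b / a') ^ γ'⁻¹ ≤ (b / a') ^ γ'⁻¹ * rad x ^ γ⁻¹ :=
    le_mul_of_one_le_right (by positivity) hrγ
  have c3 : b ≤ b * rad x ^ γ⁻¹ := le_mul_of_one_le_right hb0.le hrγ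
  have c4 : 0 ≤ (b / a') ^ γ'⁻¹ := by positivity
  rw [add_mul, add_mul]
  by_cases hy0 : 0 ≤ y 0
  · have hroot : ∀ δ t : ℝ, 0 < δ → y 0 ^ δ ≤ t → y 0 ≤ t ^ δ⁻¹ := fun δ t hδ ht => by
      rw [← Real.rpow_rpow_inv hy0 hδ.ne']
      exact Real.rpow_le_rpow (Real.rpow_nonneg hy0 _) ht (inv_pos.2 hδ).le
    by_cases hc : a * y 0 ^ γ < s * y 1
    · have hsx : s * x 1 ≤ rad x := by
        refine (le_abs_self _).trans ?_
        rw [abs_mul, hs, one_mul]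
        exact (abs_coord_le_norm x 1).trans (by unfold rad; linarith)
      have h2 : y 0 ^ γ ≤ (1 + b) / a * rad x := by
        rw [div_mul_eq_mul_div, le_div_iff₀ ha]
        have := mul_le_mul_of_nonneg_left hr1 hb0.le
        linarith
      have h3 := hroot γ _ hγ h2
      rw [Real.mul_rpow (by positivity) (by linarith)] at h3
      linarith
    · have hlow : a' * y 0 ^ γ' < -(s * y 1) := by
        by_contra hcon
        exact hy ((hD y).2 ⟨hy0, not_lt.1 hc, not_lt.1 hcon⟩)
      have h3 := hroot γ' (b / a') hγ' (by
        rw [le_div_iff₀ ha']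
        linarith)
      linarith
  · linarith

/-! ### The Lyapunov function for wide domains. -/

/-- The Lyapunov function for domains that are wider than a cone. -/
def wideFn (v : ℂ) (ν : ℝ) (x : Plane) : ℝ := zetaLog v x + -1 * decayFn ν x

/-- The first partial derivative of `wideFn`. -/
def wideD1 (v : ℂ) (ν : ℝ) (x : Plane) : ℝ := ((zeta v x)⁻¹).re + -1 * decayD1 ν x

/-- The second partial derivative of `wideFn`. -/
def wideD2 (v : ℂ) (ν : ℝ) (x : Plane) : ℝ :=
  (Complex.I * v⁻¹ * (zeta v x)⁻¹).re + -1 * decayD2 ν x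

/-- The leading part of half the second derivative of `wideFn` in the first variable. -/
def wideQ11 (v : ℂ) (x : Plane) : ℝ := (-(1 / 2) * v * ((zeta v x)⁻¹) ^ 2).re + -1 * 0

/-- The leading part of the mixed second derivative of `wideFn`. -/
def wideQ12 (v : ℂ) (x : Plane) : ℝ := (-Complex.I * ((zeta v x)⁻¹) ^ 2).re + -1 * 0

/-- The leading part of half the second derivative of `wideFn` in the second variable. -/
def wideQ22 (v : ℂ) (x : Plane) : ℝ := (1 / 2 * v⁻¹ * ((zeta v x)⁻¹) ^ 2).re + -1 * 0

section Wide

variable {v : ℂ} {ν : ℝ}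

lemma measurable_wideFn : Measurable (wideFn v ν) :=
  measurable_zetaLog.add (measurable_decayFn.const_mul (-1))

lemma hasExpansion_wideFn (hv : 0 < v.re) (hν : 0 < ν) (hν1 : ν ≤ 1) {η q : ℝ} (hη0 : 0 < η)
    (hη : η ≤ ν) (hq : 2 < q) (hq3 : q ≤ 3) :
    HasExpansion halfPlane η q (wideFn v ν) (wideD1 v ν) (wideD2 v ν) (wideQ11 v) (wideQ12 v)
      (wideQ22 v) ∧
    LogScale halfPlane (wideD1 v ν) (wideD2 v ν) (wideQ11 v) (wideQ12 v) (wideQ22 v) := by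
  have e1 := hasExpansion_zetaLog hv hη0 (hη.trans hν1) hq hq3
  have e2 := hasExpansion_decayFn hν hν1 hη0 hη hq hq3
  exact ⟨e1.1.add (e2.1.const_mul (-1)), e1.2.add (e2.2.const_mul (-1))⟩

lemma exists_wideFn_sub_log_le (hv : 0 < v.re) (hν : 0 < ν) (hν1 : ν ≤ 1) :
    ∃ K : ℝ, ∀ x ∈ halfPlane, |wideFn v ν x - (v⁻¹).re * Real.log (rad x)| ≤ K := by
  obtain ⟨K, h⟩ := exists_zetaLog_sub_log_le hv
  refine ⟨K + 2, fun x hx => ?_⟩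
  have e : wideFn v ν x - (v⁻¹).re * Real.log (rad x) =
      (zetaLog v x - (v⁻¹).re * Real.log (rad x)) - decayFn ν x := by simp only [wideFn]; ring
  rw [e]
  exact (abs_sub _ _).trans (add_le_add (h x hx) (abs_decayFn_le hν hν1 x))

/-- The root (√det - iρ)/σ₁² of the characteristic polynomial of the operator with coefficient
matrix `Sig`; positivity of the determinant puts it in the right half-plane. -/
lemma exists_root_of_posDef {Sig : Matrix (Fin 2) (Fin 2) ℝ} (hSig : Sig.PosDef) :
    ∃ v : ℂ, 0 < v.re ∧ v ^ 2 * Sig 0 0 + 2 * Complex.I * v * Sig 0 1 - Sig 1 1 = 0 := by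
  obtain ⟨h0, -, -, hdet⟩ := posDef_entries hSig
  obtain ⟨s, hs⟩ : ∃ s, s = Real.sqrt (Sig 0 0 * Sig 1 1 - Sig 0 1 ^ 2) := ⟨_, rfl⟩
  have hs0 : 0 < s := hs ▸ Real.sqrt_pos.2 hdet
  have hs2 : s ^ 2 = Sig 0 0 * Sig 1 1 - Sig 0 1 ^ 2 := by rw [hs, Real.sq_sqrt hdet.le]
  refine ⟨⟨s / Sig 0 0, -(Sig 0 1 / Sig 0 0)⟩, div_pos hs0 h0, ?_⟩
  apply Complex.ext <;> simp [sq] <;> field_simp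
  · linear_combination hs2
  · ring

/-- The three coefficients share the factor -(1/2)v⁻¹ζ⁻², and what remains is the polynomial of
which `v` is a root. -/
lemma wideQ_apply_eq_zero (hv : 0 < v.re) {Sig : Matrix (Fin 2) (Fin 2) ℝ}
    (hroot : v ^ 2 * Sig 0 0 + 2 * Complex.I * v * Sig 0 1 - Sig 1 1 = 0) (x : Plane) :
    wideQ11 v x * Sig 0 0 + wideQ12 v x * Sig 0 1 + wideQ22 v x * Sig 1 1 = 0 := by
  have hv0 : v ≠ 0 := fun h => by simp [h] at hv
  have key : (-(1 / 2) * v * ((zeta v x)⁻¹) ^ 2) * (Sig 0 0 : ℝ) +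
      (-Complex.I * ((zeta v x)⁻¹) ^ 2) * (Sig 0 1 : ℝ) +
      (1 / 2 * v⁻¹ * ((zeta v x)⁻¹) ^ 2) * (Sig 1 1 : ℝ) = 0 := by
    have : -(1 / 2) * v⁻¹ * ((zeta v x)⁻¹) ^ 2 *
      (v ^ 2 * Sig 0 0 + 2 * Complex.I * v * Sig 0 1 - Sig 1 1) = 0 := by rw [hroot, mul_zero]
    rw [← this]
    have hvv : v⁻¹ * v = 1 := inv_mul_cancel₀ hv0
    linear_combination ((zeta v x)⁻¹) ^ 2 * ((1 / 2) * v * Sig 0 0 + Complex.I * Sig 0 1) * hvv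
  have h := congrArg Complex.re key
  simp only [Complex.add_re, Complex.re_mul_ofReal, Complex.zero_re] at h
  simp only [wideQ11, wideQ12, wideQ22, mul_zero, add_zero]
  exact h

/-- The gradient of `wideFn` is of exact order `1 / rad`. -/
lemma exists_wide_gradient_lower_bound (hv : 0 < v.re) (hν : 0 < ν) (hν1 : ν ≤ 1) :
    ∃ c R : ℝ, 0 < c ∧ ∀ x ∈ halfPlane, R ≤ ‖x‖ →
      c * rad x ^ (-2 : ℝ) ≤ wideD1 v ν x ^ 2 + wideD2 v ν x ^ 2 := by
  have hv0 : v ≠ 0 := fun h => by simp [h] at hv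
  obtain ⟨L, hL, hscale⟩ := exists_zeta_scale hv
  obtain ⟨C, hC0, hC⟩ : ∃ C, 0 < C ∧ C = v.re ^ 2 + 2 * v.im ^ 2 + 2 * Complex.normSq v ^ 2 :=
    ⟨_, by positivity, rfl⟩
  obtain ⟨k, hk0, hk⟩ : ∃ k, 0 < k ∧ k = v.re ^ 2 / (C * L ^ 2) := ⟨_, by positivity, rfl⟩
  obtain ⟨R, hR⟩ := eventually_atTop.1 (eventually_rpow_le 52 (show 0 < k / 4 by linarith)
    (show -2 - 2 * ν < -2 by linarith))
  refine ⟨k / 4, R, by linarith, fun x hx hxR => ?_⟩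
  obtain ⟨h1, h2, h3⟩ := hscale x hx
  have hr := rad_pos x
  have hz : 0 < ‖zeta v x‖ := by linarith
  obtain ⟨e1, he1⟩ : ∃ e1, e1 = ((zeta v x)⁻¹).re := ⟨_, rfl⟩
  obtain ⟨e2, he2⟩ : ∃ e2, e2 = (Complex.I * v⁻¹ * (zeta v x)⁻¹).re := ⟨_, rfl⟩
  obtain ⟨b, hb⟩ : ∃ b, b = ((zeta v x)⁻¹).im := ⟨_, rfl⟩
  have hnv : Complex.normSq v ≠ 0 := by simpa using hv0
  -- As Re v ≠ 0, the imaginary part of 1/ζ is recovered from the two partial derivatives, so the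
  -- gradient controls ‖ζ‖⁻¹.
  have hlin : Complex.normSq v * e2 = v.im * e1 - v.re * b := by
    rw [he1, he2, hb]
    simp only [Complex.mul_re, Complex.mul_im, Complex.I_re, Complex.I_im, Complex.inv_re v,
      Complex.inv_im v]
    field_simp
    ring
  have hnorm : ‖zeta v x‖⁻¹ ^ 2 = e1 ^ 2 + b ^ 2 := by
    rw [← norm_inv, ← Complex.normSq_eq_norm_sq, Complex.normSq_apply, he1, hb]; ring
  have hlow : v.re ^ 2 * ‖zeta v x‖⁻¹ ^ 2 ≤ C * (e1 ^ 2 + e2 ^ 2) := by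
    have hrb : (v.re * b) ^ 2 ≤ 2 * (v.im * e1) ^ 2 + 2 * (Complex.normSq v * e2) ^ 2 := by
      have : v.re * b = v.im * e1 - Complex.normSq v * e2 := by linarith
      rw [this]; nlinarith only [sq_nonneg (v.im * e1 + Complex.normSq v * e2)]
    have p1 : 0 ≤ (v.re * e2) ^ 2 := sq_nonneg _
    have p2 : 0 ≤ (v.im * e2) ^ 2 := sq_nonneg _
    have p3 : 0 ≤ (Complex.normSq v * e1) ^ 2 := sq_nonneg _
    rw [hnorm, hC]
    linarith
  have hinv : (L * rad x)⁻¹ ^ 2 ≤ ‖zeta v x‖⁻¹ ^ 2 := by gcongr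
  have hE : k * rad x ^ (-2 : ℝ) ≤ e1 ^ 2 + e2 ^ 2 := by
    rw [hk, rpow_neg_two hr]
    have q1 := (mul_le_mul_of_nonneg_left hinv (sq_nonneg v.re)).trans hlow
    calc v.re ^ 2 / (C * L ^ 2) * (rad x ^ 2)⁻¹ = v.re ^ 2 * (L * rad x)⁻¹ ^ 2 / C := by
          field_simp
      _ ≤ _ := by rw [div_le_iff₀ hC0]; linarith
  obtain ⟨c1, c2⟩ := abs_decayD_le hν hν1 x
  have hsqr : (rad x ^ (-1 - ν)) ^ 2 = rad x ^ (-2 - 2 * ν) := by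
    rw [sq, ← Real.rpow_add hr]; ring_nf
  have g1 : decayD1 ν x ^ 2 ≤ 36 * rad x ^ (-2 - 2 * ν) := by
    rw [← sq_abs, ← hsqr]
    calc _ ≤ (6 * rad x ^ (-1 - ν)) ^ 2 := by gcongr
      _ = _ := by ring
  have g2 : decayD2 ν x ^ 2 ≤ 16 * rad x ^ (-2 - 2 * ν) := by
    rw [← sq_abs, ← hsqr]
    calc _ ≤ (4 * rad x ^ (-1 - ν)) ^ 2 := by gcongr
      _ = _ := by ring
  have hfar := hR (rad x) (hxR.trans (le_add_of_nonneg_left zero_le_one))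
  have w1 : e1 ^ 2 ≤ 2 * wideD1 v ν x ^ 2 + 2 * decayD1 ν x ^ 2 := by
    have : e1 = wideD1 v ν x + decayD1 ν x := by rw [he1, wideD1]; ring
    rw [this]; nlinarith only [sq_nonneg (wideD1 v ν x - decayD1 ν x)]
  have w2 : e2 ^ 2 ≤ 2 * wideD2 v ν x ^ 2 + 2 * decayD2 ν x ^ 2 := by
    have : e2 = wideD2 v ν x + decayD2 ν x := by rw [he2, wideD2]; ring
    rw [this]; nlinarith only [sq_nonneg (wideD2 v ν x - decayD2 ν x)]
  linarith

/-- Along the inward normal near a boundary curve `x₂ = ± a x₁ ^ β` with `β > 1`, the function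
`wideFn` decreases. -/
lemma exists_wide_normal_derivative_le (hv : 0 < v.re) (hν : 0 < ν) {a β s C : ℝ} (ha : 0 < a)
    (hβ : 1 < β) (hνβ : ν < 1 - β⁻¹) (hs : |s| = 1) (hC : 0 ≤ C) :
    ∃ R : ℝ, ∀ x ∈ halfPlane, 0 ≤ s * x 1 → s * x 1 ≤ a * x 0 ^ β → x 0 ≤ C * rad x ^ β⁻¹ →
      R ≤ ‖x‖ → (Real.sqrt (1 + (a * β * x 0 ^ (β - 1)) ^ 2))⁻¹ *
        (a * β * x 0 ^ (β - 1) * wideD1 v ν x - s * wideD2 v ν x) ≤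
        -(1 / 8 * rad x ^ (-1 - ν)) := by
  have hβ0 : 0 < β := by linarith
  obtain ⟨γ, hγ⟩ : ∃ γ, γ = β⁻¹ := ⟨_, rfl⟩
  have hγ0 : 0 < γ := hγ ▸ inv_pos.2 hβ0
  rw [← hγ] at hνβ ⊢
  have hν1 : ν ≤ 1 := by linarith
  obtain ⟨L, hL, hscale⟩ := exists_zeta_scale hv
  obtain ⟨K, hK, hsc⟩ := (hasExpansion_wideFn hv hν hν1 hν le_rfl (q := 3) (by norm_num) le_rfl).2
  obtain ⟨k, hk0, hk⟩ : ∃ k, 0 < k ∧ k = a * β * ((2 * a)⁻¹) ^ (1 - γ) := ⟨_, by positivity, rfl⟩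
  have ev := (((eventually_rpow_le C (show (0 : ℝ) < 1 / 4 by norm_num)
    (show γ < 1 by linarith)).and
    (eventually_rpow_le ((1 + v.re * C) * L ^ 2) (show (0 : ℝ) < 1 / 4 by norm_num)
      (show γ - 2 < -1 - ν by linarith))).and
    ((eventually_rpow_le 1 hk0 (show 0 < 1 - γ by linarith)).and
    (eventually_rpow_le (K / k) (show (0 : ℝ) < 1 / 8 by norm_num)
      (show γ - 2 < -1 - ν by linarith))))
  obtain ⟨R, hR⟩ := eventually_atTop.1 ev
  refine ⟨max R 4, fun x hx hx1 hx2 hx3 hxR => ?_⟩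
  have hr := rad_pos x
  have hr1 := one_le_rad x
  have hr4 : 4 ≤ ‖x‖ := (le_max_right _ _).trans hxR
  obtain ⟨⟨E1, E2⟩, E3, E4⟩ :=
    hR (rad x) (((le_max_left _ _).trans hxR).trans (le_add_of_nonneg_left zero_le_one))
  rw [Real.rpow_one] at E1
  rw [Real.rpow_zero, mul_one] at E3
  have hx0 : 0 ≤ x 0 := hx
  obtain ⟨h1, h2, h3⟩ := hscale x hx
  have hz : 0 < ‖zeta v x‖ := by linarith
  have hQ := sqRad_pos x
  obtain ⟨ρ, hρ⟩ : ∃ ρ, ρ = rad x ^ (-1 - ν) := ⟨_, rfl⟩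
  have hρ0 : 0 < ρ := hρ ▸ Real.rpow_pos_of_pos hr _
  rw [← hρ] at E2 E4 ⊢
  -- Re(1/ζ) = Re ζ/‖ζ‖² has order rad^(γ-2) in the layer, smaller than ρ = rad^(-1-ν) because ν < 1
  -- - γ.
  have hre : ((zeta v x)⁻¹).re ≤ 1 / 4 * ρ := by
    refine le_trans ?_ E2
    have p1 : (zeta v x).re ≤ (1 + v.re * C) * rad x ^ γ := by
      rw [zeta_re]
      have := Real.one_le_rpow hr1 hγ0.le
      have := mul_le_mul_of_nonneg_right hx3 hv.le
      linarith
    rw [Complex.inv_re, Complex.normSq_eq_norm_sq, Real.rpow_sub hr, Real.rpow_two,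
      div_le_iff₀ (by positivity)]
    have p2 : rad x ^ 2 ≤ L ^ 2 * ‖zeta v x‖ ^ 2 := by rw [← mul_pow]; gcongr
    have p3 : 0 ≤ (1 + v.re * C) * rad x ^ γ := by positivity
    calc (zeta v x).re ≤ (1 + v.re * C) * rad x ^ γ * 1 := by linarith
      _ ≤ (1 + v.re * C) * rad x ^ γ * (L ^ 2 * ‖zeta v x‖ ^ 2 / rad x ^ 2) := by
          refine mul_le_mul_of_nonneg_left ?_ p3
          rw [le_div_iff₀ (by positivity), one_mul]; exact p2
      _ = _ := by ring
  -- The negative part of the derivative carries (x 0)²/sqRad, which is at most 1/8 once x 0 ≤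
  -- rad/4.
  have hdec : 3 / 4 * ρ ≤ decayD1 ν x := by
    obtain ⟨P, hP⟩ : ∃ P, P = sqRad x ^ (-(1 + ν) / 2) := ⟨_, rfl⟩
    have hρP : ρ ≤ P := by rw [hρ, hP]; exact le_sqRad_rpow hν x
    have hP0 : 0 < P := hρ0.trans_le hρP
    rw [decayD1, Real.rpow_sub_one hQ.ne', ← hP]
    have p1 : x 0 ^ 2 / sqRad x ≤ 1 / 8 := by
      rw [div_le_iff₀ hQ]
      have p2 : x 0 ≤ 1 / 4 * rad x := hx3.trans E1
      have p3 := pow_le_pow_left₀ hx0 p2 2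
      have p4 := rad_sq_le x
      linarith
    have p5 : x 0 ^ 2 * (P / sqRad x) ≤ 1 / 8 * P := by
      calc _ = x 0 ^ 2 / sqRad x * P := by ring
        _ ≤ _ := by gcongr
    have p6 : 0 ≤ x 0 ^ 2 * (P / sqRad x) := by positivity
    have p7 : (1 + ν) * (x 0 ^ 2 * (P / sqRad x)) ≤ 2 * (1 / 8 * P) := by gcongr; linarith
    linarith
  have hD1 : wideD1 v ν x ≤ -(1 / 2 * ρ) := by rw [wideD1]; linarith
  obtain ⟨w, hw⟩ : ∃ w, w = a * β * x 0 ^ (β - 1) := ⟨_, rfl⟩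
  -- Here the height is at least rad/2 and lies below the curve, so x 0 is at least of order rad^γ
  -- and the slope at least of order rad^(1-γ): the normal is asymptotically horizontal.
  have hwk : k * rad x ^ (1 - γ) ≤ w := by
    have p1 : rad x / 2 ≤ s * x 1 := by
      have q1 := norm_le_abs_add_abs x
      have q2 : |x 1| = s * x 1 := by rw [← abs_of_nonneg hx1, abs_mul, hs, one_mul]
      rw [q2, abs_of_nonneg hx0] at q1
      have q3 := hx3.trans E1
      unfold rad at q3 ⊢
      linarith
    have p2 : (2 * a)⁻¹ * rad x ≤ x 0 ^ β := by
      rw [inv_mul_le_iff₀ (by positivity)]; linarith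
    have p3 : ((2 * a)⁻¹ * rad x) ^ γ ≤ x 0 := by
      rw [← Real.rpow_rpow_inv hx0 hβ0.ne', hγ]
      exact Real.rpow_le_rpow (by positivity) p2 (inv_pos.2 hβ0).le
    have p4 : ((2 * a)⁻¹ * rad x) ^ (1 - γ) ≤ x 0 ^ (β - 1) := by
      have := Real.rpow_le_rpow (by positivity) p3 (show 0 ≤ β - 1 by linarith)
      rw [← Real.rpow_mul (by positivity)] at this
      have e : γ * (β - 1) = 1 - γ := by rw [hγ]; field_simp
      rwa [e] at this
    rw [hk, hw, mul_assoc, ← Real.mul_rpow (by positivity) hr.le]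
    exact mul_le_mul_of_nonneg_left p4 (by positivity)
  have hw1 : 1 ≤ w := E3.trans hwk
  rw [← hw]
  obtain ⟨N, hN⟩ : ∃ N, N = (Real.sqrt (1 + w ^ 2))⁻¹ := ⟨_, rfl⟩
  have hsq : w ≤ Real.sqrt (1 + w ^ 2) := Real.le_sqrt_of_sq_le (by linarith)
  have hsq2 : Real.sqrt (1 + w ^ 2) ≤ 2 * w := by
    rw [Real.sqrt_le_left (by linarith)]; nlinarith
  have hw0 : 0 < w := by linarith
  have hNw : 1 / 2 ≤ N * w := by
    rw [hN, ← div_eq_inv_mul, le_div_iff₀ (by linarith)]; linarith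
  have hN1 : N ≤ w⁻¹ := hN ▸ inv_anti₀ hw0 hsq
  have hN0 : 0 ≤ N := by rw [hN]; positivity
  have t1 : N * w * wideD1 v ν x ≤ -(1 / 4 * ρ) := by
    have := mul_le_mul_of_nonneg_left hD1 (show 0 ≤ N * w by linarith)
    have := mul_le_mul_of_nonneg_right hNw hρ0.le
    linarith
  -- The vertical component of the normal is at most 1/w, so the vertical derivative, of order
  -- 1/rad, enters only at order rad^(γ-2).
  have t2 : -(N * (s * wideD2 v ν x)) ≤ 1 / 8 * ρ := by
    refine le_trans ?_ E4
    have d2 := (hsc x hx).2.1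
    have p1 : w⁻¹ ≤ (k * rad x ^ (1 - γ))⁻¹ := inv_anti₀ (by positivity) hwk
    calc _ ≤ |N * (s * wideD2 v ν x)| := neg_le_abs _
      _ = N * |wideD2 v ν x| := by rw [abs_mul, abs_mul, hs, one_mul, abs_of_nonneg hN0]
      _ ≤ (k * rad x ^ (1 - γ))⁻¹ * (K / rad x) := by
          have := hN1.trans p1
          gcongr
      _ = _ := by
          rw [show γ - 2 = -(1 - γ) - 1 by ring, Real.rpow_sub_one hr.ne', Real.rpow_neg hr.le]
          field_simp
  rw [← hN]
  have e : N * (w * wideD1 v ν x - s * wideD2 v ν x) =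
      N * w * wideD1 v ν x + -(N * (s * wideD2 v ν x)) := by ring
  rw [e]
  linarith

end Wide

section Wide

variable {S T : Set Plane} {κ : Kernel S S} [IsMarkovKernel κ] {q M : ℝ} {v : ℂ} {ν : ℝ}

/-- In a boundary layer with reflection along the normal, `wideFn` is a strict supermartingale. -/
lemma exists_boundary_stepDrift_wideFn_le (hv : 0 < v.re) (hν : 0 < ν) {a β s C R₀ : ℝ}
    (ha : 0 < a) (hβ : 1 < β) (hνβ : ν < 1 - β⁻¹) (hs : |s| = 1) (hC : 0 ≤ C)
    (hM : MomentBound κ q M) (hq : 2 < q) {n : Plane → Plane} (hR : ReflectsAlong κ T n)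
    (hT : ∀ x ∈ T, 0 ≤ x 0 ∧ 0 ≤ s * x 1 ∧ s * x 1 ≤ a * x 0 ^ β)
    (hn : ∀ x, n x = (Real.sqrt (1 + (a * β * x 0 ^ (β - 1)) ^ 2))⁻¹ •
      !₂[a * β * x 0 ^ (β - 1), -s])
    (hnear : ∀ x ∈ T, R₀ ≤ ‖x‖ → x 0 ≤ C * rad x ^ β⁻¹) :
    ∃ R : ℝ, ∀ x : S, (x : Plane) ∈ T → R ≤ ‖(x : Plane)‖ →
      stepDrift κ (wideD1 v ν) (wideD2 v ν) (wideQ11 v) (wideQ12 v) (wideQ22 v) x ≤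
        -(1 * rad x ^ (-2 : ℝ)) := by
  have hβi : 0 < β⁻¹ := inv_pos.2 (by linarith)
  have hν1 : ν < 1 := by linarith
  have hsc := (hasExpansion_wideFn hv hν hν1.le hν le_rfl (q := 3) (by norm_num) le_rfl).2
  obtain ⟨c, K, R₁, hc, h₁⟩ := hR.exists_stepDrift_le (D := halfPlane) (fun x hx => (hT x hx).1) hsc
    hM hq
  obtain ⟨R₂, h₂⟩ := exists_wide_normal_derivative_le hv hν ha hβ hνβ hs hC
  -- As ν < 1, the gain rad^(-1-ν) dominates the second order terms of order rad⁻².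
  obtain ⟨R₃, h₃⟩ := eventually_atTop.1 (eventually_rpow_le (K + 1)
    (show 0 < c * (1 / 8) by positivity) (show (-2 : ℝ) < -1 - ν by linarith))
  refine ⟨max (max R₀ R₁) (max R₂ R₃), fun x hx hxR => ?_⟩
  obtain ⟨μ, hμ, hdrift⟩ := h₁ x hx (((le_max_right _ _).trans (le_max_left _ _)).trans hxR)
  obtain ⟨t1, t2, t3⟩ := hT x hx
  have hder := h₂ x t1 t2 t3 (hnear x hx (((le_max_left _ _).trans (le_max_left _ _)).trans hxR))
    (((le_max_left _ _).trans (le_max_right _ _)).trans hxR)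
  have hfar := h₃ (rad x) ((((le_max_right _ _).trans (le_max_right _ _)).trans hxR).trans
    (le_add_of_nonneg_left zero_le_one))
  have hρ : 0 ≤ rad (x : Plane) ^ (-1 - ν) := Real.rpow_nonneg (rad_pos _).le _
  refine hdrift.trans ?_
  have e : n x 0 * wideD1 v ν x + n x 1 * wideD2 v ν x =
      (Real.sqrt (1 + (a * β * (x : Plane) 0 ^ (β - 1)) ^ 2))⁻¹ *
        (a * β * (x : Plane) 0 ^ (β - 1) * wideD1 v ν x - s * wideD2 v ν x) := by
    rw [hn]
    simp only [PiLp.smul_apply, smul_eq_mul, Matrix.cons_val_zero, Matrix.cons_val_one]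
    ring
  rw [e]
  have p1 := mul_le_mul_of_nonneg_left hder (hc.le.trans hμ)
  have p2 := mul_le_mul_of_nonneg_right hμ hρ
  linarith only [p1, p2, hfar]

lemma exists_mul_rad_rpow_lt_norm (C : ℝ) {γ : ℝ} (hγ : γ < 1) : ∃ R : ℝ, ∀ x : Plane, R ≤ ‖x‖ →
    C * rad x ^ γ < ‖x‖ := by
  obtain ⟨R, hR⟩ := eventually_atTop.1 (eventually_rpow_le C (half_pos one_pos) hγ)
  refine ⟨max R 2, fun x hx => ?_⟩
  have h := hR (rad x) (((le_max_left _ _).trans hx).trans (le_add_of_nonneg_left zero_le_one))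
  rw [Real.rpow_one] at h
  refine h.trans_lt ?_
  have := (le_max_right _ _).trans hx
  unfold rad
  linarith

/-- The leading part of `wideFn` is harmonic for `Sig` whatever the exponents, so its interior drift
is only borderline, and the power rates together with the nondegenerate gradient give recurrence. In
the layer the drift is strictly negative. -/
theorem isRecurrent_wide {aP aM βP βM B : ℝ} {DB : Set Plane} (haP : 0 < aP) (haM : 0 < aM)
    (hβP : 1 < βP) (hβM : 1 < βM)
    (hDB : IsBoundaryLayer (domain aP aM βP βM) DB B)
    (hS : S ⊆ domain aP aM βP βM) (hR : Reflection κ DB aP aM βP βM 0 0)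
    (hN : NonConfinement κ) (hMp : BoundedMoments κ) {Sig : Matrix (Fin 2) (Fin 2) ℝ}
    (hSig : Sig.PosDef)
    (hZ : ZeroDriftPlus κ (interiorPart S (domain aP aM βP βM) DB))
    (hC : Covariance κ (interiorPart S (domain aP aM βP βM) DB) Sig)
    (hCp : CovariancePlus κ (interiorPart S (domain aP aM βP βM) DB) Sig) (x₀ : S) :
    IsRecurrent κ x₀ := by
  have hPpos : 0 < βP := by linarith
  have hMpos : 0 < βM := by linarith
  have hPi : βP⁻¹ < 1 := inv_lt_one_of_one_lt₀ hβP
  have hMi : βM⁻¹ < 1 := inv_lt_one_of_one_lt₀ hβM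
  have hPi0 : 0 < βP⁻¹ := inv_pos.2 hPpos
  obtain ⟨q, M, hq, hq3, hM0, hM⟩ := exists_momentBound hMp
  obtain ⟨v, hv, hroot⟩ := exists_root_of_posDef hSig
  obtain ⟨ν, hν, hνP, hνM⟩ : ∃ ν : ℝ, 0 < ν ∧ ν < 1 - βP⁻¹ ∧ ν < 1 - βM⁻¹ :=
    (exists_between (lt_min (show 0 < 1 - βP⁻¹ by linarith) (show 0 < 1 - βM⁻¹ by linarith))).imp
      fun ν h => ⟨h.1, lt_min_iff.1 h.2⟩
  have hν1 : ν ≤ 1 := by linarith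
  have hSH : S ⊆ halfPlane := fun x hx => (hS hx).1
  obtain ⟨CP, hCP0, hgP⟩ := exists_layer_fst_le (a := aP) (a' := aM) (γ := βP) (γ' := βM) (s := 1)
    haP haM hPpos hMpos abs_one
    (fun x => by
      simp only [domain, Set.mem_ofPred_eq, one_mul]
      exact ⟨fun h => ⟨h.1, h.2.2, by linarith [h.2.1]⟩, fun h => ⟨h.1, by linarith [h.2.2], h.2.1⟩⟩)
    hDB
  obtain ⟨CM, hCM0, hgM⟩ := exists_layer_fst_le (a := aM) (a' := aP) (γ := βM) (γ' := βP) (s := -1)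
    haM haP hMpos hPpos (by simp)
    (fun x => by
      simp only [domain, Set.mem_ofPred_eq, neg_one_mul, neg_neg]
      exact ⟨fun h => ⟨h.1, by linarith [h.2.1], h.2.2⟩, fun h => ⟨h.1, by linarith [h.2.1], h.2.2⟩⟩)
    hDB
  obtain ⟨R₁, h₁⟩ := exists_boundary_stepDrift_wideFn_le (s := 1) (R₀ := 0) hv hν haP hβP hνP abs_one
    hCP0 hM hq hR.1
    (fun x hx => ⟨(hS hx.1).1, by linarith [hx.2.2], by linarith [(hS hx.1).2.2]⟩)
    (fun x => upperNormal_zero _ _ _) (fun x hx _ => hgP x hx.2.1 (by linarith [hx.2.2]))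
  obtain ⟨R₂, h₂⟩ := exists_boundary_stepDrift_wideFn_le (s := -1) (R₀ := 0) hv hν haM hβM hνM
    (by simp) hCM0 hM hq hR.2
    (fun x hx => ⟨(hS hx.1).1, by linarith [hx.2.2], by linarith [(hS hx.1).2.1]⟩)
    (fun x => lowerNormal_zero _ _ _) (fun x hx _ => hgM x hx.2.1 (by linarith [hx.2.2]))
  obtain ⟨R₃, h₃⟩ := exists_mul_rad_rpow_lt_norm CP hPi
  obtain ⟨ε, C₁, R₄, hε, hC₁, hR₄⟩ := exists_interior_error_rate hZ hCp
  obtain ⟨lam, hlam, hquad⟩ := exists_quadratic_lower_bound hSig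
  obtain ⟨R₅, hR₅⟩ := hC lam hlam
  obtain ⟨k, R₆, hk0, hR₆⟩ := exists_wide_gradient_lower_bound hv hν hν1
  obtain ⟨η, hη0, hη2, hη3, hην, hηε⟩ : ∃ η : ℝ, 0 < η ∧
      η ≤ (q - 2) ^ 2 / (2 * q) ∧ 2 * η ≤ q - 2 ∧ η ≤ ν ∧ η ≤ ε := by
    refine ⟨min (min ((q - 2) ^ 2 / (2 * q)) ((q - 2) / 2)) (min ν ε),
      lt_min (lt_min (div_pos (pow_pos (by linarith) 2) (by linarith)) (by linarith))
        (lt_min hν hε),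
      (min_le_left _ _).trans (min_le_left _ _), ?_,
      (min_le_right _ _).trans (min_le_left _ _), (min_le_right _ _).trans (min_le_right _ _)⟩
    have := (min_le_left (min ((q - 2) ^ 2 / (2 * q)) ((q - 2) / 2)) (min ν ε)).trans
      (min_le_right _ _)
    linarith
  have hexp := hasExpansion_wideFn hv hν hν1 hη0 hην hq hq3
  obtain ⟨C, hC0, hint⟩ := hexp.2.exists_abs_stepDrift_le (κ := κ) hSH
    (fun x _ => wideQ_apply_eq_zero hv hroot x)
  obtain ⟨K₀, hlog⟩ := exists_wideFn_sub_log_le hv hν hν1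
  have hvre : 0 < (v⁻¹).re := by
    rw [Complex.inv_re]
    exact div_pos hv (Complex.normSq_pos.2 fun h => by simp [h] at hv)
  refine isRecurrent_of_expansion (η := η) (C := C * C₁) (lam := (v⁻¹).re) (c := min 1 (lam * k))
    (R := max (max (max R₁ R₂) R₃) (max R₄ (max R₅ R₆))) hN hSH hM hM0 hq hq3 hη0 hη2 hη3
    measurable_wideFn hexp.1 hexp.2 hvre hlog (lt_min one_pos (mul_pos hlam hk0))
    (fun x hx => ?_) x₀
  have hr := rad_pos (x : Plane)
  have hr1 := one_le_rad (x : Plane)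
  have hr2 : 0 ≤ rad (x : Plane) ^ (-2 : ℝ) := Real.rpow_nonneg hr.le _
  have hxL := (le_max_left _ _).trans hx
  have hxR := (le_max_right _ _).trans hx
  by_cases hxB : (x : Plane) ∈ DB
  · left
    have hle : stepDrift κ (wideD1 v ν) (wideD2 v ν) (wideQ11 v) (wideQ12 v) (wideQ22 v) x ≤
        -(1 * rad x ^ (-2 : ℝ)) := by
      rcases lt_trichotomy ((x : Plane) 1) 0 with h | h | h
      · exact h₂ x ⟨x.2, hxB, h⟩ (((le_max_right _ _).trans (le_max_left _ _)).trans hxL)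
      -- A layer point on the axis has norm x 0, which is only O(rad^(1/β⁺)); far away this is
      -- impossible.
      · exfalso
        have e1 := hgP x hxB (by rw [h, mul_zero])
        have e2 := h₃ x ((le_max_right _ _).trans hxL)
        have e3 := norm_le_abs_add_abs (x : Plane)
        rw [h, abs_zero, add_zero, abs_of_nonneg (hSH x.2)] at e3
        linarith
      · exact h₁ x ⟨x.2, hxB, h⟩ (((le_max_left _ _).trans (le_max_left _ _)).trans hxL)
    exact hle.trans (neg_le_neg (mul_le_mul_of_nonneg_right (min_le_left _ _) hr2))
  · right
    have hxI : (x : Plane) ∈ interiorPart S (domain aP aM βP βM) DB := ⟨x.2, hS x.2, hxB⟩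
    constructor
    · obtain ⟨e1, e2⟩ := hR₄ x hxI ((le_max_left _ _).trans hxR)
      refine (le_abs_self _).trans ((hint x _ e1 e2).trans ?_)
      rw [mul_assoc C C₁, mul_assoc C₁, ← Real.rpow_add hr]
      exact mul_le_mul_of_nonneg_left (mul_le_mul_of_nonneg_left
        (Real.rpow_le_rpow_of_exponent_le hr1 (by linarith)) hC₁) hC0
    · have hN' := hR₅ _ (((le_max_left _ _).trans (le_max_right _ _)).trans hxR) x hxI le_rfl
      have e1 := hR₆ x (hSH x.2) (((le_max_right _ _).trans (le_max_right _ _)).trans hxR)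
      refine le_trans ?_ (hquad _ hN' _ _)
      calc min 1 (lam * k) * rad (x : Plane) ^ (-2 : ℝ) ≤ lam * k * rad (x : Plane) ^ (-2 : ℝ) :=
            mul_le_mul_of_nonneg_right (min_le_right _ _) hr2
        _ = lam * (k * rad (x : Plane) ^ (-2 : ℝ)) := mul_assoc _ _ _
        _ ≤ _ := mul_le_mul_of_nonneg_left e1 hlam.le

end Wide

end

end ReflectedWalk

theorem theorem1
    (aP aM βP βM B : ℝ) (haP : 0 < aP) (haM : 0 < aM) (hβP : 0 ≤ βP) (hβM : 0 ≤ βM)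
    (hB : 0 < B)
    (D DB S : Set ReflectedWalk.Plane)
    (hD : D = ReflectedWalk.domain aP aM βP βM)
    (hDB : ReflectedWalk.IsBoundaryLayer D DB B)
    -- If the upper (lower) boundary is flat, the lower (upper) half of the layer and its
    -- points on the axis still lie near the lower (upper) boundary.
    (hflatP : βP = 0 → ∀ x ∈ DB, x 1 ≤ 0 → Metric.infDist x (Dᶜ ∩ {y | y 1 < 0}) ≤ B)
    (hflatM : βM = 0 → ∀ x ∈ DB, 0 ≤ x 1 → Metric.infDist x (Dᶜ ∩ {y | 0 < y 1}) ≤ B)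
    (hS : S ⊆ D)
    (κ : ProbabilityTheory.Kernel S S) [ProbabilityTheory.IsMarkovKernel κ]
    (Sig : Matrix (Fin 2) (Fin 2) ℝ) (hSig : Sig.PosDef)
    (hN : ReflectedWalk.NonConfinement κ)
    (hMp : ReflectedWalk.BoundedMoments κ)
    (hZ : ReflectedWalk.ZeroDrift κ (ReflectedWalk.interiorPart S D DB))
    (hR : ReflectedWalk.Reflection κ DB aP aM βP βM 0 0)
    (hC : ReflectedWalk.Covariance κ (ReflectedWalk.interiorPart S D DB) Sig)
    (x₀ : S) :
    (βP < 1 → βM < 1 →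
      (0 < max βP βM → max βP βM < Sig 0 0 / Sig 1 1 → ReflectedWalk.IsRecurrent κ x₀) ∧
      (Sig 0 0 / Sig 1 1 < max βP βM → ReflectedWalk.IsTransient κ x₀) ∧
      (ReflectedWalk.ZeroDriftPlus κ (ReflectedWalk.interiorPart S D DB) →
        ReflectedWalk.CovariancePlus κ (ReflectedWalk.interiorPart S D DB) Sig →
        max βP βM = Sig 0 0 / Sig 1 1 → ReflectedWalk.IsRecurrent κ x₀)) ∧
    (1 < βP → 1 < βM →
      ReflectedWalk.ZeroDriftPlus κ (ReflectedWalk.interiorPart S D DB) →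
      ReflectedWalk.CovariancePlus κ (ReflectedWalk.interiorPart S D DB) Sig →
      ReflectedWalk.IsRecurrent κ x₀) := by
  subst hD
  refine ⟨fun hP hM => ⟨fun h0 h => ?_, fun h => ?_, fun hZp hCp h => ?_⟩, fun hP hM hZp hCp => ?_⟩
  · exact ReflectedWalk.isRecurrent_thin_subcritical haP haM hβP hβM hP hM h0 hDB hflatP hflatM hS hR
      hN hMp hSig h hZ hC x₀
  · exact ReflectedWalk.isTransient_thin_supercritical haP haM hβP hβM hP hM hDB hflatP hflatM hS hR
      hN hMp hSig h hZ hC x₀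
  · exact ReflectedWalk.isRecurrent_thin_critical haP haM hβP hβM hP hM hDB hflatP hflatM hS hR
      hN hMp hSig h hZp hC hCp x₀
  · exact ReflectedWalk.isRecurrent_wide haP haM hP hM hDB hS hR hN hMp hSig hZp hC hCp x₀
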